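/- Let $\mathbb T^2=\mathbb R^2/\mathbb Z^2$. Let $H$ be the space of mean-zero, (weakly) divergence-free fields $u\in L^2(\mathbb T^2,\mathbb R^2)$ with the $L^2$ inner product $\langle\cdot,\cdot\rangle$ and norm $|\cdot|$, let $V=H\cap H^1(\mathbb T^2,\mathbb R^2)$ with the $H^1$ norm and $D(A)=H\cap H^2(\mathbb T^2,\mathbb R^2)$ with the $H^2$ norm. Let $Au=-\Delta u$ for $u\in D(A)$, and let $B(u)=B(u,u)\in H$ be given for $u\in D(A)$ by $$\langle B(u,v),w\rangle=\sum_{i,j=1}^2\int_{\mathbb T^2}u^i\,\frac{\partial v^j}{\partial x^i}\,w^j\,dx\qquad\text{for all } w\in H.$$ Write $|\nabla u|^2$ for the square of the $L^2$ norm of $\nabla u$, and $M=\{u\in H:|u|=1\}$. Let $f:H\to H$ be globally Lipschitz (hence of linear growth) and tangent to $M$, that is, $\langle f(u),u\rangle=0$ for every $u\in M$, and let $u_0\in V\cap M$. For $T>0$, a solution on $[0,T]$ of $$\frac{du}{dt}+Au+B(u)=|\nabla u|^2u+f(u),\qquad u(0)=u_0, \tag{1}$$ is a function $u:[0,T]\to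 H$ with $u\in L^2(0,T;D(A))$ and $\frac{du}{dt}\in L^2(0,T;H)$ (so that $u(t)=u(0)+\int_0^t\frac{du}{ds}\,ds$ for all $t\in[0,T]$), with $u(0)=u_0$, which satisfies the equation in $H$ for almost every $t\in(0,T)$. Then there is a function $u:[0,\infty)\to H$ that is a solution of (1) on $[0,T]$ for every $T>0$, and $u\in L^\infty(0,T;V)\cap L^2(0,T;D(A))$ for every $T>0$. It is unique: for every $T>0$, every solution of (1) on $[0,T]$ coincides with $u$ on $[0,T]$. -/

import Mathlib

open MeasureTheory Set
open scoped ENNReal NNReal ContDiff InnerProductSpace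

noncomputable section

namespace CNS

/-- The two-dimensional torus `ℝ² / ℤ²`. -/
abbrev T2 : Type := UnitAddTorus (Fin 2)

/-- Lebesgue measure on the torus (the Haar measure of total mass one). -/
abbrev torusMeasure : Measure T2 := Measure.pi fun _ => AddCircle.haarAddCircle

abbrev R2 : Type := EuclideanSpace ℝ (Fin 2)

/-- `L²(𝕋², ℝ²)`. -/
abbrev L2 : Type := Lp R2 2 torusMeasure

/-- The quotient map `ℝ² → 𝕋²`. -/
def proj (y : Fin 2 → ℝ) : T2 := fun i => (y i : UnitAddCircle)

/-- Smooth real functions on the torus: those whose periodic lift to `ℝ²` is `C^∞`. -/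
def IsTest (φ : T2 → ℝ) : Prop := ContDiff ℝ ∞ (fun y : Fin 2 → ℝ => φ (proj y))

/-- Classical partial derivative `∂φ/∂xⁱ` on the torus. -/
def pderiv (i : Fin 2) (φ : T2 → ℝ) (x : T2) : ℝ :=
  deriv (fun s : ℝ => φ (x + Pi.single i (s : UnitAddCircle))) 0

/-- `u` is divergence free in the sense of distributions. -/
def IsDivFree (u : L2) : Prop :=
  ∀ φ : T2 → ℝ, IsTest φ → ∫ x, ∑ i, pderiv i φ x * u x i ∂torusMeasure = 0

theorem isOpenQuotientMap_proj : IsOpenQuotientMap proj := by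
  have h : IsOpenQuotientMap (Pi.map (fun (_ : Fin 2) (y : ℝ) => (y : UnitAddCircle))) :=
    IsOpenQuotientMap.piMap (fun _ => QuotientAddGroup.isOpenQuotientMap_mk)
  exact h

theorem pderiv_proj (i : Fin 2) {φ : T2 → ℝ} (hφ : IsTest φ) (y : Fin 2 → ℝ) :
    pderiv i φ (proj y) = fderiv ℝ (fun y : Fin 2 → ℝ => φ (proj y)) y (Pi.single i 1) := by
  have hd : DifferentiableAt ℝ (fun y : Fin 2 → ℝ => φ (proj y)) y :=
    (hφ.differentiable (by simp)) y
  have h1 : ∀ s : ℝ, proj y + Pi.single i (s : UnitAddCircle)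
      = proj (y + s • (Pi.single i 1 : Fin 2 → ℝ)) := by
    intro s
    funext j
    by_cases h : j = i
    · subst h; simp [proj]
    · simp [proj, h]
  unfold pderiv
  simp only [h1]
  exact hd.lineDeriv_eq_fderiv (v := Pi.single i 1)

theorem continuous_pderiv (i : Fin 2) {φ : T2 → ℝ} (hφ : IsTest φ) :
    Continuous (pderiv i φ) := by
  rw [isOpenQuotientMap_proj.isQuotientMap.continuous_iff]
  have h : pderiv i φ ∘ proj
      = fun y => fderiv ℝ (fun y : Fin 2 → ℝ => φ (proj y)) y (Pi.single i 1) := by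
    funext y; exact pderiv_proj i hφ y
  rw [h]
  exact (hφ.continuous_fderiv (by simp)).clm_apply continuous_const

theorem integrable_div (u : L2) {φ : T2 → ℝ} (hφ : IsTest φ) :
    Integrable (fun x => ∑ i, pderiv i φ x * u x i) torusMeasure := by
  refine integrable_finsetSum _ fun i _ => ?_
  have hu : Integrable (fun x => u x i) torusMeasure :=
    (EuclideanSpace.proj (𝕜 := ℝ) i).integrable_comp
      ((Lp.memLp u).integrable (by norm_num))
  obtain ⟨C, hC⟩ := (isCompact_range (continuous_pderiv i hφ)).isBounded.exists_norm_le
  exact hu.bdd_mul (c := C) (continuous_pderiv i hφ).aestronglyMeasurable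
    (Filter.Eventually.of_forall fun x => hC _ (mem_range_self x))

/-- `H`: square integrable, mean zero, divergence free vector fields, with the `L²` inner
product. -/
def H : Submodule ℝ L2 where
  carrier := {u | ∫ x, u x ∂torusMeasure = 0 ∧ IsDivFree u}
  zero_mem' := by
    have h : ((0 : L2) : T2 → R2) =ᵐ[torusMeasure] 0 := Lp.coeFn_zero _ _ _
    refine ⟨?_, fun φ _ => ?_⟩
    · rw [integral_congr_ae h]; simp
    · rw [integral_congr_ae (g := fun _ => (0 : ℝ))]
      · simp
      · filter_upwards [h] with x hx
        simp only [hx, Pi.zero_apply, PiLp.zero_apply, mul_zero, Finset.sum_const_zero]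
  add_mem' := by
    rintro u v ⟨hu, hu'⟩ ⟨hv, hv'⟩
    have h := Lp.coeFn_add u v
    refine ⟨?_, fun φ hφ => ?_⟩
    · rw [integral_congr_ae h]
      simp only [Pi.add_apply]
      rw [integral_add ((Lp.memLp u).integrable (by norm_num))
        ((Lp.memLp v).integrable (by norm_num)), hu, hv, add_zero]
    · rw [integral_congr_ae (g := fun x => (∑ i, pderiv i φ x * u x i)
        + ∑ i, pderiv i φ x * v x i)]
      · rw [integral_add (integrable_div u hφ) (integrable_div v hφ), hu' φ hφ, hv' φ hφ,
          add_zero]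
      · filter_upwards [h] with x hx
        simp only [hx, Pi.add_apply, PiLp.add_apply, mul_add, Finset.sum_add_distrib]
  smul_mem' := by
    rintro c u ⟨hu, hu'⟩
    have h := Lp.coeFn_smul c u
    refine ⟨?_, fun φ hφ => ?_⟩
    · rw [integral_congr_ae h]
      simp only [Pi.smul_apply]
      rw [integral_smul, hu, smul_zero]
    · rw [integral_congr_ae (g := fun x => c * ∑ i, pderiv i φ x * u x i)]
      · rw [integral_const_mul, hu' φ hφ, mul_zero]
      · filter_upwards [h] with x hx
        simp only [hx, Pi.smul_apply, PiLp.smul_apply, smul_eq_mul, Finset.mul_sum]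
        exact Finset.sum_congr rfl fun i _ => by ring

/-- `g ∈ L²` is the weak partial derivative `∂u/∂xⁱ` of `u ∈ L²`. -/
def IsWeakPartial (i : Fin 2) (u g : L2) : Prop :=
  ∀ φ : T2 → ℝ, IsTest φ → ∫ x, pderiv i φ x • u x ∂torusMeasure = -∫ x, φ x • g x ∂torusMeasure

/-- `u ∈ H¹(𝕋², ℝ²)`. -/
def MemH1 (u : L2) : Prop := ∀ i, ∃ g, IsWeakPartial i u g

open Classical in
/-- The weak partial derivative (zero if there is none in `L²`). -/
def wpartial (i : Fin 2) (u : L2) : L2 :=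
  if h : ∃ g, IsWeakPartial i u g then h.choose else 0

/-- `u ∈ H²(𝕋², ℝ²)`. -/
def MemH2 (u : L2) : Prop := MemH1 u ∧ ∀ i, MemH1 (wpartial i u)

/-- `V = H ∩ H¹`. -/
def V : Set H := {u | MemH1 (u : L2)}

/-- `D(A) = H ∩ H²`. -/
def DA : Set H := {u | MemH2 (u : L2)}

/-- The Stokes operator `A u = -Δ u`, meaningful for `u ∈ D(A)`. -/
def stokesA (u : L2) : L2 := -∑ i, wpartial i (wpartial i u)

/-- `|∇u|²`, the square of the `L²` norm of the gradient. -/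
def gradSq (u : L2) : ℝ := ∑ i, ‖wpartial i u‖ ^ 2

/-- `b(u,v,w) = ∑ᵢⱼ ∫ uⁱ (∂vʲ/∂xⁱ) wʲ dx`. -/
def bForm (u v w : L2) : ℝ :=
  ∑ i, ∑ j, ∫ x, u x i * wpartial i v x j * w x j ∂torusMeasure

open Classical in
/-- `B(u,v) ∈ H`, determined by `⟨B(u,v), w⟩ = b(u,v,w)` for all `w ∈ H`
(zero if there is no such element of `H`; there is one for `u ∈ V`, `v ∈ D(A)`). -/
def opB (u v : H) : H :=
  if h : ∃ z : H, ∀ w : H, ⟪z, w⟫_ℝ = bForm u v w then h.choose else 0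

/-- The unit sphere `M` of `H`. -/
def M : Set H := {u | ‖u‖ = 1}

/-- The tangent space `T_u M`. -/
def tangentM (u : H) : Set H := {v | ⟪v, u⟫_ℝ = 0}

/-- Lebesgue measure on the time interval `(0,T)`. -/
def timeMeasure (T : ℝ) : Measure ℝ := volume.restrict (Ioo 0 T)

/-- `u ∈ L^p(0,T;V)`, with the `H¹` norm on `V`. -/
def MemLpV (p : ℝ≥0∞) (T : ℝ) (u : ℝ → H) : Prop :=
  (∀ᵐ t ∂timeMeasure T, u t ∈ V) ∧
  MemLp u p (timeMeasure T) ∧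
  ∀ i, MemLp (fun t => wpartial i (u t)) p (timeMeasure T)

/-- `u ∈ L^p(0,T;D(A))`, with the `H²` norm on `D(A)`. -/
def MemLpDA (p : ℝ≥0∞) (T : ℝ) (u : ℝ → H) : Prop :=
  (∀ᵐ t ∂timeMeasure T, u t ∈ DA) ∧
  MemLp u p (timeMeasure T) ∧
  (∀ i, MemLp (fun t => wpartial i (u t)) p (timeMeasure T)) ∧
  ∀ i j, MemLp (fun t => wpartial j (wpartial i (u t))) p (timeMeasure T)

/-- `u' ∈ L²(0,T;H)` is the time derivative of `u`, and `u` is the (absolutely) continuous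
representative on `[0,T]`. -/
def IsTimeDeriv (T : ℝ) (u u' : ℝ → H) : Prop :=
  MemLp u' 2 (timeMeasure T) ∧
  ∀ t ∈ Icc 0 T, (u t : L2) = (u 0 : L2) + ∫ s in (0 : ℝ)..t, (u' s : L2)

/-- `u` solves `du/dt + A u + B(u) = |∇u|² u + f(u)`, `u(0) = u₀`, on `[0,T]`:
`u ∈ L²(0,T;D(A))`, `du/dt ∈ L²(0,T;H)`, and the equation holds in `H` at almost every time. -/
def IsSolutionOn (f : H → H) (u₀ : H) (T : ℝ) (u : ℝ → H) : Prop :=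
  u 0 = u₀ ∧ MemLpDA 2 T u ∧
  ∃ u' : ℝ → H, IsTimeDeriv T u u' ∧
    ∀ᵐ t ∂timeMeasure T,
      (u' t : L2) + stokesA (u t) + (opB (u t) (u t) : L2)
        = gradSq (u t) • (u t : L2) + (f (u t) : L2)

end CNS

end

/-!
The fields `hartley k • k^⊥ / |k|` with `k ≠ 0` form an orthonormal basis of `H` made of
eigenfields of `A`, with eigenvalues `|2πk|²`. In these coordinates `V` and `D(A)` are weighted `ℓ²`
spaces, and `∑ |k|⁻⁴ < ∞` bounds `sup |u|` by a multiple of `|Au|`, hence `|B(u, v)|` by a multiple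
of `|Au| |∇v|`.

The sphere `M` is invariant because `⟨B(u), u⟩ = 0`, `⟨f(u), u⟩ = 0` and `|∇u|² = ⟨Au, u⟩`. On the
two-dimensional torus also `⟨B(u), Au⟩ = 0`, since the vorticity is transported by the flow, so that
`z = Au - |∇u|² u`, which is orthogonal to `u`, satisfies
`d/dt |∇u|² = -2|z|² + 2⟨z, f(u)⟩ ≤ -|z|² + |f(u)|²` with `|z|² = |Au|² - |∇u|⁴`. This bounds the
Galerkin approximations in `L^∞(0,T;V)` and in `L²(0,T;D(A))`.

The difference `w` of two solutions obeys `d/dt |w|² ≤ c (1 + |Au|² + |Av|²) |w|²`, so that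
Grönwall's inequality yields uniqueness. For two Galerkin approximations the same estimate holds up
to an error that tends to zero with the inverse of the smallest discarded eigenvalue. They are
therefore uniformly Cauchy on `[0, T]`, and no compactness theorem is needed.
-/

noncomputable section

namespace CNS

/-! ### Absolutely continuous curves and Grönwall's inequality -/

section Gronwall

theorem absolutelyContinuousOnInterval_of_dist_le {X Y : Type*} [PseudoMetricSpace X]
    [PseudoMetricSpace Y] {f : ℝ → X} {h : ℝ → Y} {a b C : ℝ}
    (hh : AbsolutelyContinuousOnInterval h a b)
    (hfh : ∀ s ∈ uIcc a b, ∀ t ∈ uIcc a b, dist (f s) (f t) ≤ C * dist (h s) (h t)) :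
    AbsolutelyContinuousOnInterval f a b := by
  unfold AbsolutelyContinuousOnInterval at hh ⊢
  refine squeeze_zero' (.of_forall fun _ => Finset.sum_nonneg fun _ _ => dist_nonneg) ?_
    (by simpa using hh.const_mul C)
  rw [Filter.eventually_inf_principal]
  filter_upwards with p hp
  rw [Finset.mul_sum]
  exact Finset.sum_le_sum fun i hi => hfh _ (hp.1 i hi).1 _ (hp.1 i hi).2

theorem absolutelyContinuousOnInterval_comp_of_locallyLipschitz {X Y : Type*}
    [SeminormedAddCommGroup X] [PseudoMetricSpace Y] {φ : X → Y} {f : ℝ → X} {a b : ℝ}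
    (hφ : LocallyLipschitz φ) (hf : AbsolutelyContinuousOnInterval f a b) :
    AbsolutelyContinuousOnInterval (fun t => φ (f t)) a b := by
  obtain ⟨K, hK⟩ := hφ.locallyLipschitzOn.exists_lipschitzOnWith_of_compact
    (isCompact_uIcc.image_of_continuousOn hf.continuousOn)
  exact absolutelyContinuousOnInterval_of_dist_le (C := K) hf fun s hs t ht =>
    hK.dist_le_mul (f s) (mem_image_of_mem f hs) (f t) (mem_image_of_mem f ht)

theorem le_mul_exp_integral_of_ae_deriv_le {z g : ℝ → ℝ} {a b : ℝ} (hab : a ≤ b)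
    (hz : AbsolutelyContinuousOnInterval z a b) (hg : IntervalIntegrable g volume a b)
    (hle : ∀ᵐ t, t ∈ Ioo a b → deriv z t ≤ g t * z t) :
    z b ≤ z a * Real.exp (∫ s in a..b, g s) := by
  set G : ℝ → ℝ := fun t => ∫ s in a..t, g s with hG
  set ψ : ℝ → ℝ := fun t => z t * Real.exp (-G t) with hψ
  have hGac : AbsolutelyContinuousOnInterval G a b :=
    hg.absolutelyContinuousOnInterval_intervalIntegral left_mem_uIcc
  have hψac : AbsolutelyContinuousOnInterval ψ a b :=
    hz.fun_mul (absolutelyContinuousOnInterval_comp_of_locallyLipschitz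
      (φ := fun r => Real.exp (-r)) (Real.contDiff_exp.comp contDiff_neg).locallyLipschitz hGac)
  have hψ' : ∀ᵐ t, t ∈ Ioo a b → deriv ψ t ≤ 0 := by
    filter_upwards [hz.ae_differentiableAt, hg.ae_hasDerivAt_integral, hle] with t hzt hGt hlet ht
    have htu : t ∈ uIcc a b := Icc_subset_uIcc (Ioo_subset_Icc_self ht)
    have hψt : HasDerivAt ψ (deriv z t * Real.exp (-G t) + z t * (Real.exp (-G t) * -g t)) t :=
      (hzt htu).hasDerivAt.mul (hGt htu a left_mem_uIcc).neg.exp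
    rw [hψt.deriv]
    nlinarith [hlet ht, Real.exp_pos (-G t)]
  have hψ_le : ψ b ≤ ψ a := by
    rw [← sub_nonpos, ← hψac.integral_deriv_eq_sub, intervalIntegral.integral_of_le hab,
      integral_Ioc_eq_integral_Ioo]
    exact integral_nonpos_of_ae ((ae_restrict_iff' measurableSet_Ioo).2 hψ')
  calc z b = ψ b * Real.exp (G b) := by rw [hψ, mul_assoc, ← Real.exp_add]; simp
    _ ≤ ψ a * Real.exp (G b) := by gcongr
    _ = z a * Real.exp (G b) := by simp [hψ, hG]

variable {E : Type*} [NormedAddCommGroup E] [NormedSpace ℝ E]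

/-- On `[0,T]` the curve `w` is absolutely continuous with almost everywhere derivative `w'`.
Absolute continuity is encoded as being the primitive of an integrable function, which in infinite
dimension is the stronger notion. -/
structure IsPrimitiveOn (T : ℝ) (w w' : ℝ → E) : Prop where
  intervalIntegrable : IntervalIntegrable w' volume 0 T
  eq_add_integral : ∀ t ∈ Icc 0 T, w t = w 0 + ∫ s in (0 : ℝ)..t, w' s

namespace IsPrimitiveOn

variable {T : ℝ} {w w' v v' : ℝ → E}

theorem intervalIntegrable_of_mem (hw : IsPrimitiveOn T w w') {s t : ℝ} (hs : s ∈ Icc 0 T)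
    (ht : t ∈ Icc 0 T) : IntervalIntegrable w' volume s t :=
  hw.intervalIntegrable.mono_set
    (uIcc_subset_uIcc (Icc_subset_uIcc hs) (Icc_subset_uIcc ht))

theorem sub_eq_integral (hw : IsPrimitiveOn T w w') {s t : ℝ} (hs : s ∈ Icc 0 T)
    (ht : t ∈ Icc 0 T) : w t - w s = ∫ r in s..t, w' r := by
  have h0 : (0 : ℝ) ∈ Icc 0 T := ⟨le_rfl, hs.1.trans hs.2⟩
  rw [hw.eq_add_integral t ht, hw.eq_add_integral s hs, add_sub_add_left_eq_sub,
    intervalIntegral.integral_interval_sub_left (hw.intervalIntegrable_of_mem h0 ht)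
      (hw.intervalIntegrable_of_mem h0 hs)]

theorem sub (hw : IsPrimitiveOn T w w') (hv : IsPrimitiveOn T v v') :
    IsPrimitiveOn T (fun t => w t - v t) fun t => w' t - v' t where
  intervalIntegrable := hw.intervalIntegrable.sub hv.intervalIntegrable
  eq_add_integral t ht := by
    have h0 : (0 : ℝ) ∈ Icc 0 T := ⟨le_rfl, ht.1.trans ht.2⟩
    rw [hw.eq_add_integral t ht, hv.eq_add_integral t ht, intervalIntegral.integral_sub
      (hw.intervalIntegrable_of_mem h0 ht) (hv.intervalIntegrable_of_mem h0 ht)]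
    abel

theorem absolutelyContinuousOnInterval (hw : IsPrimitiveOn T w w') (hT : 0 ≤ T) :
    AbsolutelyContinuousOnInterval w 0 T := by
  refine absolutelyContinuousOnInterval_of_dist_le (C := 1)
    (hw.intervalIntegrable.norm.absolutelyContinuousOnInterval_intervalIntegral left_mem_uIcc)
    fun s hs t ht => ?_
  rw [uIcc_of_le hT] at hs ht
  have h0 : (0 : ℝ) ∈ Icc 0 T := ⟨le_rfl, hT⟩
  rw [one_mul, dist_eq_norm, Real.dist_eq, hw.sub_eq_integral ht hs,
    intervalIntegral.integral_interval_sub_left (hw.intervalIntegrable_of_mem h0 hs).norm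
      (hw.intervalIntegrable_of_mem h0 ht).norm]
  exact intervalIntegral.norm_integral_le_abs_integral_norm

theorem continuousOn (hw : IsPrimitiveOn T w w') : ContinuousOn w (Icc 0 T) := by
  rcases le_total 0 T with hT | hT
  · simpa only [uIcc_of_le hT] using (hw.absolutelyContinuousOnInterval hT).continuousOn
  · exact (subsingleton_Icc_of_ge hT).continuousOn _

theorem ae_hasDerivAt [CompleteSpace E] (hw : IsPrimitiveOn T w w') :
    ∀ᵐ t, t ∈ Ioo 0 T → HasDerivAt w (w' t) t := by
  filter_upwards [hw.intervalIntegrable.ae_hasDerivAt_integral] with t hint ht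
  have hmem : t ∈ uIcc 0 T := Icc_subset_uIcc (Ioo_subset_Icc_self ht)
  refine ((hint hmem 0 left_mem_uIcc).const_add (w 0)).congr_of_eventuallyEq ?_
  filter_upwards [isOpen_Ioo.mem_nhds ht] with s hs
    using hw.eq_add_integral s (Ioo_subset_Icc_self hs)

end IsPrimitiveOn

theorem IsPrimitiveOn.norm_sq_add_le_mul_exp {E : Type*} [NormedAddCommGroup E]
    [InnerProductSpace ℝ E] [CompleteSpace E] {T ε : ℝ} {w w' : ℝ → E} {g : ℝ → ℝ}
    (hw : IsPrimitiveOn T w w') (hg : IntervalIntegrable g volume 0 T)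
    (hle : ∀ᵐ t, t ∈ Ioo 0 T → 2 * ⟪w t, w' t⟫_ℝ ≤ g t * (‖w t‖ ^ 2 + ε))
    {t : ℝ} (ht : t ∈ Icc 0 T) :
    ‖w t‖ ^ 2 + ε ≤ (‖w 0‖ ^ 2 + ε) * Real.exp (∫ s in (0 : ℝ)..t, g s) := by
  have hT : 0 ≤ T := ht.1.trans ht.2
  have hsub : uIcc 0 t ⊆ uIcc 0 T := uIcc_subset_uIcc left_mem_uIcc (Icc_subset_uIcc ht)
  refine le_mul_exp_integral_of_ae_deriv_le ht.1
    (absolutelyContinuousOnInterval_comp_of_locallyLipschitz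
      ((contDiff_norm_sq ℝ).add contDiff_const).locallyLipschitz
      ((hw.absolutelyContinuousOnInterval hT).mono hsub)) (hg.mono_set hsub) ?_
  filter_upwards [hw.ae_hasDerivAt, hle] with s hder hs hst
  have hsT : s ∈ Ioo 0 T := ⟨hst.1, hst.2.trans_le ht.2⟩
  rw [((hder hsT).norm_sq.add_const ε).deriv]
  exact hs hsT

end Gronwall

/-! ### Diagonal operators in a Hilbert basis -/

section Spectral

variable {ι E : Type*} [NormedAddCommGroup E] [InnerProductSpace ℝ E]

theorem hasSum_coord_mul (e : HilbertBasis ι ℝ E) (u v : E) :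
    HasSum (fun k => ⟪e k, u⟫_ℝ * ⟪e k, v⟫_ℝ) ⟪u, v⟫_ℝ := by
  simpa only [real_inner_comm u] using e.hasSum_inner_mul_inner u v

theorem hasSum_coord_sq (e : HilbertBasis ι ℝ E) (u : E) :
    HasSum (fun k => ⟪e k, u⟫_ℝ ^ 2) (‖u‖ ^ 2) := by
  simpa only [sq, real_inner_self_eq_norm_mul_norm] using hasSum_coord_mul e u u

theorem ext_coord (e : HilbertBasis ι ℝ E) {u v : E} (h : ∀ k, ⟪e k, u⟫_ℝ = ⟪e k, v⟫_ℝ) :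
    u = v := by
  apply e.repr.injective
  ext k
  simpa only [HilbertBasis.repr_apply_apply] using h k

theorem exists_coord_eq (e : HilbertBasis ι ℝ E) {c : ι → ℝ} (hc : Summable fun k => c k ^ 2) :
    ∃ u, ∀ k, ⟪e k, u⟫_ℝ = c k := by
  have hm : Memℓp c 2 := (memℓp_gen_iff (by norm_num)).2 (by simpa using hc)
  refine ⟨e.repr.symm ⟨c, hm⟩, fun k => ?_⟩
  rw [← HilbertBasis.repr_apply_apply, LinearIsometryEquiv.apply_symm_apply]

theorem inner_basis_basis [DecidableEq ι] (e : HilbertBasis ι ℝ E) (k l : ι) :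
    ⟪e k, e l⟫_ℝ = if k = l then 1 else 0 :=
  orthonormal_iff_ite.1 e.orthonormal k l

theorem abs_coord_le_norm (e : HilbertBasis ι ℝ E) (k : ι) (u : E) : |⟪e k, u⟫_ℝ| ≤ ‖u‖ := by
  simpa [e.orthonormal.1 k] using abs_real_inner_le_norm (e k) u

theorem norm_le_of_abs_coord_le (e : HilbertBasis ι ℝ E) {u v : E} {c : ℝ} (hc : 0 ≤ c)
    (h : ∀ k, |⟪e k, u⟫_ℝ| ≤ c * |⟪e k, v⟫_ℝ|) : ‖u‖ ≤ c * ‖v‖ := by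
  refine le_of_sq_le_sq ?_ (by positivity)
  rw [mul_pow]
  refine hasSum_le (fun k => ?_) (hasSum_coord_sq e u) ((hasSum_coord_sq e v).mul_left (c ^ 2))
  rw [← mul_pow, ← sq_abs, ← sq_abs (c * _), abs_mul, abs_of_nonneg hc]
  exact pow_le_pow_left₀ (abs_nonneg _) (h k) 2

/-- Orthogonal projection onto the span of the basis vectors with index in `F`. -/
def trunc (e : HilbertBasis ι ℝ E) (F : Finset ι) : E →L[ℝ] E :=
  ∑ k ∈ F, (innerSL ℝ (e k)).smulRight (e k)

theorem trunc_apply (e : HilbertBasis ι ℝ E) (F : Finset ι) (u : E) :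
    trunc e F u = ∑ k ∈ F, ⟪e k, u⟫_ℝ • e k := by
  simp [trunc]

theorem coord_trunc [DecidableEq ι] (e : HilbertBasis ι ℝ E) (F : Finset ι) (u : E) (k : ι) :
    ⟪e k, trunc e F u⟫_ℝ = if k ∈ F then ⟪e k, u⟫_ℝ else 0 := by
  simp [trunc_apply, inner_sum, inner_smul_right, inner_basis_basis]

theorem coord_trunc_of_mem (e : HilbertBasis ι ℝ E) {F : Finset ι} (u : E) {k : ι} (hk : k ∈ F) :
    ⟪e k, trunc e F u⟫_ℝ = ⟪e k, u⟫_ℝ := by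
  classical
  rw [coord_trunc, if_pos hk]

theorem coord_trunc_of_notMem (e : HilbertBasis ι ℝ E) {F : Finset ι} (u : E) {k : ι}
    (hk : k ∉ F) : ⟪e k, trunc e F u⟫_ℝ = 0 := by
  classical
  rw [coord_trunc, if_neg hk]

theorem trunc_symm (e : HilbertBasis ι ℝ E) (F : Finset ι) (u v : E) :
    ⟪trunc e F u, v⟫_ℝ = ⟪u, trunc e F v⟫_ℝ := by
  simp only [trunc_apply, sum_inner, inner_sum, inner_smul_left, inner_smul_right,
    RCLike.conj_to_real]
  exact Finset.sum_congr rfl fun k _ => by rw [real_inner_comm (e k) u, mul_comm]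

theorem trunc_eq_self {e : HilbertBasis ι ℝ E} {F : Finset ι} {u : E}
    (h : ∀ k ∉ F, ⟪e k, u⟫_ℝ = 0) : trunc e F u = u := by
  refine ext_coord e fun k => ?_
  by_cases hk : k ∈ F
  · rw [coord_trunc_of_mem e _ hk]
  · rw [coord_trunc_of_notMem e _ hk, h k hk]

theorem norm_trunc_le (e : HilbertBasis ι ℝ E) (F : Finset ι) (u : E) : ‖trunc e F u‖ ≤ ‖u‖ := by
  classical
  rw [← one_mul ‖u‖]
  refine norm_le_of_abs_coord_le e zero_le_one fun k => ?_
  rw [coord_trunc, one_mul]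
  split_ifs <;> simp

theorem tendsto_trunc (e : HilbertBasis ι ℝ E) (u : E) :
    Filter.Tendsto (fun F => trunc e F u) Filter.atTop (nhds u) := by
  have h := e.hasSum_repr u
  simp only [HilbertBasis.repr_apply_apply] at h
  exact h.congr fun F => (trunc_apply e F u).symm

/-- The domain of the diagonal operator with eigenvalues `lam` in the basis `e`. -/
def diagDomain (e : HilbertBasis ι ℝ E) (lam : ι → ℝ) : Submodule ℝ E where
  carrier := {u | Summable fun k => (lam k * ⟪e k, u⟫_ℝ) ^ 2}
  zero_mem' := by simp
  add_mem' := by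
    intro u v hu hv
    refine Summable.of_nonneg_of_le (fun k => sq_nonneg _) (fun k => ?_)
      ((hu.mul_left 2).add (hv.mul_left 2))
    simpa only [inner_add_right, mul_add] using
      add_sq_le (a := lam k * ⟪e k, u⟫_ℝ) (b := lam k * ⟪e k, v⟫_ℝ)
  smul_mem' := by
    intro c u hu
    refine (hu.mul_left (c ^ 2)).congr fun k => ?_
    rw [inner_smul_right]
    ring

open Classical in
/-- The diagonal operator with eigenvalues `lam` in the basis `e` (zero off its domain). -/
def diagOp (e : HilbertBasis ι ℝ E) (lam : ι → ℝ) (u : E) : E :=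
  if h : u ∈ diagDomain e lam then (exists_coord_eq e h).choose else 0

/-- The quadratic form of `diagOp e lam`. For the Stokes operator it is `|∇u|²`. -/
def energy (e : HilbertBasis ι ℝ E) (lam : ι → ℝ) (u : E) : ℝ := ⟪diagOp e lam u, u⟫_ℝ

/-- The bounded operator `diagOp e lam ∘ trunc e F`. -/
def truncDiagOp (e : HilbertBasis ι ℝ E) (lam : ι → ℝ) (F : Finset ι) : E →L[ℝ] E :=
  ∑ k ∈ F, lam k • (innerSL ℝ (e k)).smulRight (e k)

variable {e : HilbertBasis ι ℝ E} {lam : ι → ℝ} {u v : E}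

theorem mem_diagDomain_of_coord_eq_zero {F : Finset ι} (h : ∀ k ∉ F, ⟪e k, u⟫_ℝ = 0) :
    u ∈ diagDomain e lam :=
  summable_of_ne_finset_zero (s := F) fun k hk => by simp [h k hk]

theorem trunc_mem_diagDomain (F : Finset ι) (u : E) : trunc e F u ∈ diagDomain e lam :=
  mem_diagDomain_of_coord_eq_zero fun _ hk => coord_trunc_of_notMem e u hk

theorem basis_mem_diagDomain (k : ι) : e k ∈ diagDomain e lam := by
  classical
  refine mem_diagDomain_of_coord_eq_zero (F := {k}) fun l hl => ?_
  rw [inner_basis_basis, if_neg (by simpa using hl)]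

theorem coord_diagOp (hu : u ∈ diagDomain e lam) (k : ι) :
    ⟪e k, diagOp e lam u⟫_ℝ = lam k * ⟪e k, u⟫_ℝ := by
  rw [diagOp, dif_pos hu]
  exact (exists_coord_eq e hu).choose_spec k

theorem diagOp_sub (hu : u ∈ diagDomain e lam) (hv : v ∈ diagDomain e lam) :
    diagOp e lam (u - v) = diagOp e lam u - diagOp e lam v := by
  refine ext_coord e fun k => ?_
  rw [coord_diagOp (sub_mem hu hv), inner_sub_right, inner_sub_right, coord_diagOp hu,
    coord_diagOp hv, mul_sub]

theorem diagOp_smul (c : ℝ) (hu : u ∈ diagDomain e lam) :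
    diagOp e lam (c • u) = c • diagOp e lam u := by
  refine ext_coord e fun k => ?_
  rw [coord_diagOp (Submodule.smul_mem _ c hu), inner_smul_right, inner_smul_right,
    coord_diagOp hu, mul_left_comm]

theorem hasSum_inner_diagOp (hu : u ∈ diagDomain e lam) (v : E) :
    HasSum (fun k => lam k * ⟪e k, u⟫_ℝ * ⟪e k, v⟫_ℝ) ⟪diagOp e lam u, v⟫_ℝ := by
  simpa only [coord_diagOp hu] using hasSum_coord_mul e (diagOp e lam u) v

theorem hasSum_energy (hu : u ∈ diagDomain e lam) :
    HasSum (fun k => lam k * ⟪e k, u⟫_ℝ ^ 2) (energy e lam u) := by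
  simpa only [energy, sq, mul_assoc] using hasSum_inner_diagOp hu u

theorem diagOp_symm (hu : u ∈ diagDomain e lam) (hv : v ∈ diagDomain e lam) :
    ⟪diagOp e lam u, v⟫_ℝ = ⟪u, diagOp e lam v⟫_ℝ := by
  refine (hasSum_inner_diagOp hu v).unique ?_
  rw [real_inner_comm]
  simpa only [mul_right_comm] using hasSum_inner_diagOp hv u

theorem energy_sub_energy (hu : u ∈ diagDomain e lam) (hv : v ∈ diagDomain e lam) :
    energy e lam u - energy e lam v = ⟪diagOp e lam u + diagOp e lam v, u - v⟫_ℝ := by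
  have h : ⟪diagOp e lam v, u⟫_ℝ = ⟪diagOp e lam u, v⟫_ℝ := by
    rw [diagOp_symm hv hu, real_inner_comm]
  rw [energy, energy, inner_add_left, inner_sub_right, inner_sub_right, h]
  ring

theorem energy_smul (c : ℝ) (hu : u ∈ diagDomain e lam) :
    energy e lam (c • u) = c ^ 2 * energy e lam u := by
  rw [energy, diagOp_smul c hu, real_inner_smul_left, real_inner_smul_right, energy, sq, mul_assoc]

theorem energy_nonneg (hlam : ∀ k, 0 ≤ lam k) (hu : u ∈ diagDomain e lam) :
    0 ≤ energy e lam u :=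
  (hasSum_energy hu).nonneg fun k => mul_nonneg (hlam k) (sq_nonneg _)

theorem norm_le_norm_diagOp (hlam : ∀ k, 1 ≤ lam k) (hu : u ∈ diagDomain e lam) :
    ‖u‖ ≤ ‖diagOp e lam u‖ := by
  rw [← one_mul ‖diagOp e lam u‖]
  refine norm_le_of_abs_coord_le e zero_le_one fun k => ?_
  rw [coord_diagOp hu, one_mul, abs_mul]
  exact le_mul_of_one_le_left (abs_nonneg _) ((hlam k).trans (le_abs_self _))

theorem energy_le_norm_sq (hlam : ∀ k, 1 ≤ lam k) (hu : u ∈ diagDomain e lam) :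
    energy e lam u ≤ ‖diagOp e lam u‖ ^ 2 := by
  refine (real_inner_le_norm _ _).trans ?_
  rw [sq]
  gcongr
  exact norm_le_norm_diagOp hlam hu

theorem sqrt_energy_le (hlam : ∀ k, 1 ≤ lam k) (hu : u ∈ diagDomain e lam) :
    √(energy e lam u) ≤ ‖diagOp e lam u‖ :=
  (Real.sqrt_le_left (norm_nonneg _)).2 (energy_le_norm_sq hlam hu)

theorem mul_norm_sub_trunc_sq_le (hlam : ∀ k, 0 ≤ lam k) (hu : u ∈ diagDomain e lam)
    {F : Finset ι} {r : ℝ} (hF : ∀ k ∉ F, r ≤ lam k) :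
    r * ‖u - trunc e F u‖ ^ 2 ≤ energy e lam u := by
  classical
  refine hasSum_le (fun k => ?_) ((hasSum_coord_sq e _).mul_left r) (hasSum_energy hu)
  rw [inner_sub_right, coord_trunc]
  split_ifs with hk
  · simpa using mul_nonneg (hlam k) (sq_nonneg ⟪e k, u⟫_ℝ)
  · simpa using mul_le_mul_of_nonneg_right (hF k hk) (sq_nonneg ⟪e k, u⟫_ℝ)

theorem energy_sub_trunc (hu : u ∈ diagDomain e lam) (F : Finset ι) :
    energy e lam (u - trunc e F u) = energy e lam u - ∑ k ∈ F, lam k * ⟪e k, u⟫_ℝ ^ 2 := by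
  classical
  refine (hasSum_energy (sub_mem hu (trunc_mem_diagDomain F u))).unique ?_
  have hF := hasSum_sum_of_ne_finset_zero (s := F) (L := .unconditional ι)
    (f := fun k => if k ∈ F then lam k * ⟪e k, u⟫_ℝ ^ 2 else 0) fun k hk => if_neg hk
  rw [Finset.sum_congr rfl fun k hk => if_pos hk] at hF
  refine ((hasSum_energy hu).sub hF).congr_fun fun k => ?_
  rw [inner_sub_right, coord_trunc]
  split_ifs <;> simp

theorem tendsto_energy_sub_trunc (hu : u ∈ diagDomain e lam) :
    Filter.Tendsto (fun F => energy e lam (u - trunc e F u)) Filter.atTop (nhds 0) := by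
  simp only [energy_sub_trunc hu]
  simpa using (hasSum_energy hu).const_sub (energy e lam u)

theorem truncDiagOp_apply (F : Finset ι) (u : E) :
    truncDiagOp e lam F u = ∑ k ∈ F, (lam k * ⟪e k, u⟫_ℝ) • e k := by
  simp [truncDiagOp, smul_smul]

theorem diagOp_trunc (F : Finset ι) (u : E) :
    diagOp e lam (trunc e F u) = truncDiagOp e lam F u := by
  classical
  refine ext_coord e fun k => ?_
  rw [coord_diagOp (trunc_mem_diagDomain F u), coord_trunc, truncDiagOp_apply]
  simp [inner_sum, inner_smul_right, inner_basis_basis]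

theorem diagOp_eq_truncDiagOp {F : Finset ι} (h : ∀ k ∉ F, ⟪e k, u⟫_ℝ = 0) :
    diagOp e lam u = truncDiagOp e lam F u := by
  rw [← diagOp_trunc, trunc_eq_self h]

theorem truncDiagOp_symm (F : Finset ι) (u v : E) :
    ⟪truncDiagOp e lam F u, v⟫_ℝ = ⟪u, truncDiagOp e lam F v⟫_ℝ := by
  simp only [truncDiagOp_apply, sum_inner, inner_sum, inner_smul_left, inner_smul_right,
    RCLike.conj_to_real]
  refine Finset.sum_congr rfl fun k _ => ?_
  rw [real_inner_comm (e k) u]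
  ring

theorem trunc_diagOp {F : Finset ι} (h : ∀ k ∉ F, ⟪e k, u⟫_ℝ = 0) :
    trunc e F (diagOp e lam u) = diagOp e lam u := by
  refine trunc_eq_self fun k hk => ?_
  rw [coord_diagOp (mem_diagDomain_of_coord_eq_zero h), h k hk, mul_zero]

end Spectral

/-! ### Convection terms dominated by a diagonal operator -/

section Convection

variable {ι E : Type*} [NormedAddCommGroup E] [InnerProductSpace ℝ E]

/-- The algebraic identities and bounds of the two-dimensional Navier–Stokes convection term `B`,
relative to the Stokes operator, which is diagonal in the basis `e` with eigenvalues `lam` tending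
to infinity. The field `inner_diagOp` is special to two-dimensional periodic flows. -/
structure IsConvection (e : HilbertBasis ι ℝ E) (lam : ι → ℝ) (B : E → E → E) (C : ℝ) : Prop where
  one_le : ∀ k, 1 ≤ lam k
  tail : ∀ r : ℝ, ∃ F : Finset ι, ∀ k ∉ F, r ≤ lam k
  nonneg : 0 ≤ C
  sub_left : ∀ {u v w}, u ∈ diagDomain e lam → v ∈ diagDomain e lam → w ∈ diagDomain e lam →
    B (u - v) w = B u w - B v w
  add_right : ∀ {u v w}, u ∈ diagDomain e lam → v ∈ diagDomain e lam → w ∈ diagDomain e lam →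
    B u (v + w) = B u v + B u w
  smul_right : ∀ {u v} (c : ℝ), u ∈ diagDomain e lam → v ∈ diagDomain e lam →
    B u (c • v) = c • B u v
  norm_le : ∀ {u v}, u ∈ diagDomain e lam → v ∈ diagDomain e lam →
    ‖B u v‖ ≤ C * ‖diagOp e lam u‖ * √(energy e lam v)
  abs_inner_le : ∀ {u v w}, u ∈ diagDomain e lam → v ∈ diagDomain e lam →
    w ∈ diagDomain e lam → |⟪B u v, w⟫_ℝ| ≤ C * ‖u‖ * √(energy e lam v) * ‖diagOp e lam w‖
  inner_basis : ∀ {u} (k l : ι), u ∈ diagDomain e lam → ⟪B u (e k), e l⟫_ℝ = -⟪B u (e l), e k⟫_ℝ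
  inner_diagOp : ∀ {u} {F : Finset ι}, (∀ k ∉ F, ⟪e k, u⟫_ℝ = 0) →
    ⟪B u u, diagOp e lam u⟫_ℝ = 0
  basis_le : ∀ k, ∃ c, ∀ {u w}, u ∈ diagDomain e lam → w ∈ diagDomain e lam →
    |⟪B u (e k), w⟫_ℝ| ≤ c * ‖u‖ * ‖w‖

variable {e : HilbertBasis ι ℝ E} {lam : ι → ℝ} {B : E → E → E} {C : ℝ} {u v w : E}

namespace IsConvection

theorem zero_le (hB : IsConvection e lam B C) (k : ι) : 0 ≤ lam k :=
  zero_le_one.trans (hB.one_le k)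

theorem sub_right (hB : IsConvection e lam B C) (hu : u ∈ diagDomain e lam)
    (hv : v ∈ diagDomain e lam) (hw : w ∈ diagDomain e lam) : B u (v - w) = B u v - B u w := by
  rw [eq_sub_iff_add_eq, ← hB.add_right hu (sub_mem hv hw) hw, sub_add_cancel]

theorem sum_right (hB : IsConvection e lam B C) (hu : u ∈ diagDomain e lam) (F : Finset ι)
    (c : ι → ℝ) : B u (∑ k ∈ F, c k • e k) = ∑ k ∈ F, c k • B u (e k) := by
  classical
  have hmem : ∀ k, c k • e k ∈ diagDomain e lam := fun k =>
    Submodule.smul_mem _ _ (basis_mem_diagDomain k)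
  induction F using Finset.induction_on with
  | empty => simpa using hB.smul_right 0 hu (zero_mem (diagDomain e lam))
  | insert k F hk ih =>
    rw [Finset.sum_insert hk, Finset.sum_insert hk, hB.add_right hu (hmem k)
      (Submodule.sum_mem _ fun k _ => hmem k), hB.smul_right _ hu (basis_mem_diagDomain k), ih]

theorem inner_trunc_trunc (hB : IsConvection e lam B C) (hu : u ∈ diagDomain e lam)
    (F : Finset ι) (v w : E) : ⟪B u (trunc e F v), trunc e F w⟫_ℝ
      = ∑ k ∈ F, ∑ l ∈ F, ⟪e k, v⟫_ℝ * ⟪e l, w⟫_ℝ * ⟪B u (e k), e l⟫_ℝ := by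
  rw [trunc_apply e F v, hB.sum_right hu, sum_inner]
  simp only [trunc_apply, inner_sum, real_inner_smul_left, real_inner_smul_right, mul_assoc]
  exact Finset.sum_congr rfl fun k _ => Finset.sum_congr rfl fun l _ => mul_left_comm ..

theorem inner_trunc_swap (hB : IsConvection e lam B C) (hu : u ∈ diagDomain e lam)
    (F : Finset ι) (v w : E) :
    ⟪B u (trunc e F v), trunc e F w⟫_ℝ = -⟪B u (trunc e F w), trunc e F v⟫_ℝ := by
  rw [hB.inner_trunc_trunc hu, hB.inner_trunc_trunc hu, Finset.sum_comm, ← Finset.sum_neg_distrib]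
  refine Finset.sum_congr rfl fun k _ => ?_
  rw [← Finset.sum_neg_distrib]
  refine Finset.sum_congr rfl fun l _ => ?_
  rw [hB.inner_basis l k hu]
  ring

theorem tendsto_trunc_right (hB : IsConvection e lam B C) (hu : u ∈ diagDomain e lam)
    (hv : v ∈ diagDomain e lam) :
    Filter.Tendsto (fun F => B u (trunc e F v)) Filter.atTop (nhds (B u v)) := by
  rw [tendsto_iff_norm_sub_tendsto_zero]
  refine squeeze_zero (fun _ => norm_nonneg _)
    (g := fun F => C * ‖diagOp e lam u‖ * √(energy e lam (v - trunc e F v))) (fun F => ?_) ?_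
  · rw [norm_sub_rev, ← hB.sub_right hu hv (trunc_mem_diagDomain F v)]
    exact hB.norm_le hu (sub_mem hv (trunc_mem_diagDomain F v))
  · simpa using ((tendsto_energy_sub_trunc hv).sqrt).const_mul (C * ‖diagOp e lam u‖)

theorem inner_swap (hB : IsConvection e lam B C) (hu : u ∈ diagDomain e lam)
    (hv : v ∈ diagDomain e lam) (hw : w ∈ diagDomain e lam) : ⟪B u v, w⟫_ℝ = -⟪B u w, v⟫_ℝ := by
  have hvw := (hB.tendsto_trunc_right hu hv).inner (𝕜 := ℝ) (tendsto_trunc e w)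
  have hwv := (hB.tendsto_trunc_right hu hw).inner (𝕜 := ℝ) (tendsto_trunc e v)
  exact tendsto_nhds_unique hvw (hwv.neg.congr fun F => (hB.inner_trunc_swap hu F v w).symm)

theorem inner_self (hB : IsConvection e lam B C) (hu : u ∈ diagDomain e lam)
    (hv : v ∈ diagDomain e lam) : ⟪B u v, v⟫_ℝ = 0 := by
  linarith [hB.inner_swap hu hv hv]

theorem two_mul_inner_le (hB : IsConvection e lam B C) (hw : w ∈ diagDomain e lam)
    (hu : u ∈ diagDomain e lam) :
    2 * ⟪B w w, u⟫_ℝ ≤ energy e lam w + C ^ 2 * ‖w‖ ^ 2 * ‖diagOp e lam u‖ ^ 2 := by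
  have hle := (le_abs_self _).trans (hB.abs_inner_le hw hw hu)
  have hsq := Real.sq_sqrt (energy_nonneg hB.zero_le hw)
  nlinarith [sq_nonneg (√(energy e lam w) - C * ‖w‖ * ‖diagOp e lam u‖)]

end IsConvection

/-- The vector field `u ↦ -A u - B(u, u) + |∇u|² u + f(u)` of the constrained equation, where
`A = diagOp e lam`. -/
def constrainedRHS (e : HilbertBasis ι ℝ E) (lam : ι → ℝ) (B : E → E → E) (f : E → E) (u : E) :
    E :=
  -diagOp e lam u - B u u + energy e lam u • u + f u

namespace IsConvection

variable {f : E → E} {K : ℝ≥0}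

theorem constrainedRHS_sub (hB : IsConvection e lam B C) (hu : u ∈ diagDomain e lam)
    (hv : v ∈ diagDomain e lam) :
    constrainedRHS e lam B f u - constrainedRHS e lam B f v =
      -diagOp e lam (u - v) - (B (u - v) u + B v (u - v)) + (energy e lam u • (u - v)
        + ⟪diagOp e lam u + diagOp e lam v, u - v⟫_ℝ • v) + (f u - f v) := by
  rw [diagOp_sub hu hv, hB.sub_left hu hv hu, hB.sub_right hv hu hv, ← energy_sub_energy hu hv,
    constrainedRHS, constrainedRHS]
  module

theorem inner_constrainedRHS_self (hB : IsConvection e lam B C) (hu : u ∈ diagDomain e lam) :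
    ⟪u, constrainedRHS e lam B f u⟫_ℝ = energy e lam u * (‖u‖ ^ 2 - 1) + ⟪f u, u⟫_ℝ := by
  rw [constrainedRHS, inner_add_right, inner_add_right, inner_sub_right, inner_neg_right,
    real_inner_smul_right, real_inner_self_eq_norm_sq, real_inner_comm,
    real_inner_comm (B u u), hB.inner_self hu hu, real_inner_comm (f u), ← energy]
  ring

theorem norm_constrainedRHS_le (hB : IsConvection e lam B C) (hu : u ∈ diagDomain e lam) :
    ‖constrainedRHS e lam B f u‖ ≤ ‖diagOp e lam u‖ + C * ‖diagOp e lam u‖ * √(energy e lam u)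
      + energy e lam u * ‖u‖ + ‖f u‖ := by
  have henergy : ‖energy e lam u • u‖ = energy e lam u * ‖u‖ := by
    rw [norm_smul, Real.norm_of_nonneg (energy_nonneg hB.zero_le hu)]
  rw [← henergy, ← norm_neg (diagOp e lam u)]
  exact (norm_add₃_le ..).trans (by
    gcongr
    exact (norm_sub_le ..).trans (by
      rw [norm_neg (diagOp e lam u)]; gcongr; exact hB.norm_le hu hu))

theorem norm_constrainedRHS_sub_le (hB : IsConvection e lam B C) (hf : LipschitzWith K f)
    (hu : u ∈ diagDomain e lam) (hv : v ∈ diagDomain e lam) :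
    ‖constrainedRHS e lam B f u - constrainedRHS e lam B f v‖ ≤
      (1 + C * (‖diagOp e lam u‖ + ‖diagOp e lam v‖) + ‖diagOp e lam u‖ ^ 2
        + (‖diagOp e lam u‖ + ‖diagOp e lam v‖) * ‖v‖ + K) * ‖diagOp e lam (u - v)‖ := by
  have hC := hB.nonneg
  have hw : u - v ∈ diagDomain e lam := sub_mem hu hv
  have hnorm : ‖u - v‖ ≤ ‖diagOp e lam (u - v)‖ := norm_le_norm_diagOp hB.one_le hw
  set w := u - v
  have hBw : ‖B w u‖ ≤ C * ‖diagOp e lam w‖ * ‖diagOp e lam u‖ :=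
    (hB.norm_le hw hu).trans (by gcongr; exact sqrt_energy_le hB.one_le hu)
  have hBv : ‖B v w‖ ≤ C * ‖diagOp e lam v‖ * ‖diagOp e lam w‖ :=
    (hB.norm_le hv hw).trans (by gcongr; exact sqrt_energy_le hB.one_le hw)
  have henergy : ‖energy e lam u • w‖ ≤ ‖diagOp e lam u‖ ^ 2 * ‖diagOp e lam w‖ := by
    rw [norm_smul, Real.norm_of_nonneg (energy_nonneg hB.zero_le hu)]
    gcongr
    exact energy_le_norm_sq hB.one_le hu
  have hinner : ‖⟪diagOp e lam u + diagOp e lam v, w⟫_ℝ • v‖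
      ≤ (‖diagOp e lam u‖ + ‖diagOp e lam v‖) * ‖diagOp e lam w‖ * ‖v‖ := by
    rw [norm_smul]
    gcongr
    exact (norm_inner_le_norm _ _).trans (by gcongr; exact norm_add_le _ _)
  have hfw : ‖f u - f v‖ ≤ K * ‖diagOp e lam w‖ := (hf.norm_sub_le u v).trans (by gcongr)
  rw [hB.constrainedRHS_sub hu hv]
  calc _ ≤ ‖-diagOp e lam w‖ + (‖B w u‖ + ‖B v w‖) + (‖energy e lam u • w‖
        + ‖⟪diagOp e lam u + diagOp e lam v, w⟫_ℝ • v‖) + ‖f u - f v‖ :=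
      (norm_add₃_le ..).trans (by
        gcongr
        · exact (norm_sub_le ..).trans (by gcongr; exact norm_add_le ..)
        · exact norm_add_le ..)
    _ ≤ _ := by rw [norm_neg]; linarith

theorem two_mul_inner_constrainedRHS_sub (hB : IsConvection e lam B C)
    (hu : u ∈ diagDomain e lam) (hv : v ∈ diagDomain e lam) :
    2 * ⟪u - v, constrainedRHS e lam B f u - constrainedRHS e lam B f v⟫_ℝ =
      2 * ⟪B (u - v) (u - v), u⟫_ℝ - 2 * energy e lam (u - v) + 2 * (energy e lam u * ‖u - v‖ ^ 2)
        + 2 * (⟪diagOp e lam u + diagOp e lam v, u - v⟫_ℝ * ⟪u - v, v⟫_ℝ)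
        + 2 * ⟪u - v, f u - f v⟫_ℝ := by
  have hw : u - v ∈ diagDomain e lam := sub_mem hu hv
  have hBw : ⟪u - v, B (u - v) u + B v (u - v)⟫_ℝ = -⟪B (u - v) (u - v), u⟫_ℝ := by
    rw [inner_add_right, real_inner_comm, real_inner_comm (B v (u - v)), hB.inner_self hv hw,
      hB.inner_swap hw hu hw, add_zero]
  rw [hB.constrainedRHS_sub hu hv, inner_add_right, inner_add_right, inner_sub_right,
    inner_neg_right, hBw, inner_add_right, real_inner_smul_right, real_inner_smul_right,
    real_inner_self_eq_norm_sq, real_inner_comm, ← energy]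
  ring

theorem two_mul_inner_constrainedRHS_sub_le (hB : IsConvection e lam B C)
    (hf : LipschitzWith K f) {R : ℝ} (hu : u ∈ diagDomain e lam) (hv : v ∈ diagDomain e lam)
    (hvR : ‖v‖ ≤ R) :
    2 * ⟪u - v, constrainedRHS e lam B f u - constrainedRHS e lam B f v⟫_ℝ ≤
      (C ^ 2 + 2 + 2 * R + 2 * K) * (1 + ‖diagOp e lam u‖ ^ 2 + ‖diagOp e lam v‖ ^ 2)
        * ‖u - v‖ ^ 2 := by
  have hR : 0 ≤ R := (norm_nonneg v).trans hvR
  have hw : u - v ∈ diagDomain e lam := sub_mem hu hv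
  rw [hB.two_mul_inner_constrainedRHS_sub hu hv]
  have hBw := hB.two_mul_inner_le hw hu
  have hyw := energy_nonneg hB.zero_le hw
  set w := u - v
  set a := ‖diagOp e lam u‖
  set b := ‖diagOp e lam v‖
  have hquad : energy e lam u * ‖w‖ ^ 2 ≤ a ^ 2 * ‖w‖ ^ 2 := by
    gcongr
    exact energy_le_norm_sq hB.one_le hu
  have hinner : ⟪diagOp e lam u + diagOp e lam v, w⟫_ℝ * ⟪w, v⟫_ℝ
      ≤ R * (1 + a ^ 2 + b ^ 2) * ‖w‖ ^ 2 := by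
    calc _ ≤ |⟪diagOp e lam u + diagOp e lam v, w⟫_ℝ| * |⟪w, v⟫_ℝ| := by
          rw [← abs_mul]; exact le_abs_self _
      _ ≤ ((a + b) * ‖w‖) * (‖w‖ * R) := by
          gcongr
          · exact (abs_real_inner_le_norm _ _).trans (by gcongr; exact norm_add_le _ _)
          · exact (abs_real_inner_le_norm _ _).trans (by gcongr)
      _ = R * (a + b) * ‖w‖ ^ 2 := by ring
      _ ≤ _ := by
          gcongr R * ?_ * ‖w‖ ^ 2
          nlinarith [sq_nonneg (a - 1), sq_nonneg (b - 1)]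
  have hfw : ⟪w, f u - f v⟫_ℝ ≤ K * ‖w‖ ^ 2 :=
    (real_inner_le_norm _ _).trans (by nlinarith [hf.norm_sub_le u v, norm_nonneg w])
  have hcoef : C ^ 2 * a ^ 2 + 2 * a ^ 2 + 2 * (R * (1 + a ^ 2 + b ^ 2)) + 2 * K ≤
      (C ^ 2 + 2 + 2 * R + 2 * K) * (1 + a ^ 2 + b ^ 2) := by
    have : 0 ≤ C ^ 2 * (1 + b ^ 2) + 2 * (1 + b ^ 2) + 2 * K * (a ^ 2 + b ^ 2) := by positivity
    linarith
  nlinarith [mul_le_mul_of_nonneg_right hcoef (sq_nonneg ‖w‖)]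

theorem coord_constrainedRHS_sub (hB : IsConvection e lam B C) (hu : u ∈ diagDomain e lam)
    (hv : v ∈ diagDomain e lam) (k : ι) :
    ⟪e k, constrainedRHS e lam B f u - constrainedRHS e lam B f v⟫_ℝ =
      -(lam k * ⟪e k, u - v⟫_ℝ) + ⟪B (u - v) (e k), u⟫_ℝ + ⟪B v (e k), u - v⟫_ℝ
        + energy e lam u * ⟪e k, u - v⟫_ℝ
        + ⟪diagOp e lam u + diagOp e lam v, u - v⟫_ℝ * ⟪e k, v⟫_ℝ + ⟪e k, f u - f v⟫_ℝ := by
  have hw : u - v ∈ diagDomain e lam := sub_mem hu hv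
  have hswap : ∀ {x y}, x ∈ diagDomain e lam → y ∈ diagDomain e lam →
      ⟪e k, B x y⟫_ℝ = -⟪B x (e k), y⟫_ℝ := fun hx hy => by
    rw [real_inner_comm, hB.inner_swap hx hy (basis_mem_diagDomain k)]
  rw [hB.constrainedRHS_sub hu hv, inner_add_right, inner_add_right, inner_sub_right,
    inner_neg_right, coord_diagOp hw, inner_add_right, hswap hw hu, hswap hv hw, inner_add_right,
    real_inner_smul_right, real_inner_smul_right]
  ring

theorem exists_abs_coord_constrainedRHS_sub_le (hB : IsConvection e lam B C)
    (hf : LipschitzWith K f) (k : ι) :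
    ∃ c, 0 ≤ c ∧ ∀ u ∈ diagDomain e lam, ∀ v ∈ diagDomain e lam, ‖u‖ ≤ 1 → ‖v‖ ≤ 1 →
      |⟪e k, constrainedRHS e lam B f u - constrainedRHS e lam B f v⟫_ℝ| ≤
        c * (1 + ‖diagOp e lam u‖ + ‖diagOp e lam v‖) * ‖u - v‖ := by
  obtain ⟨c, hc⟩ := hB.basis_le k
  refine ⟨lam k + 2 * |c| + 2 + K, by have := hB.zero_le k; positivity,
    fun u hu v hv hu1 hv1 => ?_⟩
  have hw : u - v ∈ diagDomain e lam := sub_mem hu hv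
  rw [hB.coord_constrainedRHS_sub hu hv]
  have hfw := (abs_coord_le_norm e k _).trans (hf.norm_sub_le u v)
  set w := u - v
  set a := ‖diagOp e lam u‖
  set b := ‖diagOp e lam v‖
  have hcoord : |⟪e k, w⟫_ℝ| ≤ ‖w‖ := abs_coord_le_norm e k w
  have hlin : |lam k * ⟪e k, w⟫_ℝ| ≤ lam k * ‖w‖ := by
    rw [abs_mul, abs_of_nonneg (hB.zero_le k)]
    exact mul_le_mul_of_nonneg_left hcoord (hB.zero_le k)
  have hBw : |⟪B w (e k), u⟫_ℝ| ≤ |c| * ‖w‖ * 1 :=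
    (hc hw hu).trans (by gcongr; exact le_abs_self c)
  have hBv : |⟪B v (e k), w⟫_ℝ| ≤ |c| * 1 * ‖w‖ :=
    (hc hv hw).trans (by gcongr; exact le_abs_self c)
  have hquad : |energy e lam u * ⟪e k, w⟫_ℝ| ≤ a * 1 * ‖w‖ := by
    rw [abs_mul]
    gcongr
    exact (abs_real_inner_le_norm _ _).trans (by gcongr)
  have hinner : |⟪diagOp e lam u + diagOp e lam v, w⟫_ℝ * ⟪e k, v⟫_ℝ| ≤ (a + b) * ‖w‖ * 1 := by
    rw [abs_mul]
    gcongr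
    · exact (abs_real_inner_le_norm _ _).trans (by gcongr; exact norm_add_le _ _)
    · exact (abs_coord_le_norm e k v).trans hv1
  have hcoef : lam k + 2 * |c| + (2 * a + b) + K ≤ (lam k + 2 * |c| + 2 + K) * (1 + a + b) := by
    have := hB.zero_le k
    have : 0 ≤ (lam k + 2 * |c| + K) * (a + b) + 2 + b := by positivity
    linarith
  have hsum := mul_le_mul_of_nonneg_right hcoef (norm_nonneg w)
  rw [abs_le] at *
  constructor <;> linarith

theorem exists_norm_constrainedRHS_trunc_sub_le (hB : IsConvection e lam B C)
    (hf : LipschitzWith K f) (F : Finset ι) :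
    ∃ c : ℝ, 0 ≤ c ∧ ∀ u v : E, ‖u‖ ≤ 1 → ‖v‖ ≤ 1 →
      ‖constrainedRHS e lam B f (trunc e F u) - constrainedRHS e lam B f (trunc e F v)‖
        ≤ c * ‖u - v‖ := by
  have hC := hB.nonneg
  set L := ‖truncDiagOp e lam F‖
  have hdiag : ∀ u : E, ‖diagOp e lam (trunc e F u)‖ ≤ L * ‖u‖ := fun u => by
    rw [diagOp_trunc]
    exact (truncDiagOp e lam F).le_opNorm u
  have hL : ∀ {u : E}, ‖u‖ ≤ 1 → ‖diagOp e lam (trunc e F u)‖ ≤ L := fun hu =>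
    (hdiag _).trans (mul_le_of_le_one_right (norm_nonneg _) hu)
  refine ⟨(1 + C * (L + L) + L ^ 2 + (L + L) * 1 + K) * L, by positivity, fun u v hu hv => ?_⟩
  refine (hB.norm_constrainedRHS_sub_le hf (trunc_mem_diagDomain F u)
    (trunc_mem_diagDomain F v)).trans ?_
  rw [← map_sub, mul_assoc _ L]
  gcongr
  · exact hL hu
  · exact hL hv
  · exact hL hu
  · exact hL hu
  · exact hL hv
  · exact (norm_trunc_le e F v).trans hv
  · exact hdiag _

end IsConvection

end Convection

/-! ### Galerkin approximations -/

theorem max_one_norm_pos {E : Type*} [NormedAddCommGroup E] (u : E) : 0 < max 1 ‖u‖ :=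
  lt_max_of_lt_left one_pos

section Retract

variable {E : Type*} [NormedAddCommGroup E] [NormedSpace ℝ E]

/-- The radial retraction of `E` onto its closed unit ball. -/
def retract (u : E) : E := (max 1 ‖u‖)⁻¹ • u

theorem max_one_norm_smul_retract (u : E) : max 1 ‖u‖ • retract u = u :=
  smul_inv_smul₀ (max_one_norm_pos u).ne' u

theorem norm_retract (u : E) : ‖retract u‖ = (max 1 ‖u‖)⁻¹ * ‖u‖ := by
  rw [retract, norm_smul, norm_inv, Real.norm_of_nonneg (max_one_norm_pos u).le]

theorem norm_retract_le (u : E) : ‖retract u‖ ≤ 1 := by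
  rw [norm_retract, inv_mul_le_iff₀ (max_one_norm_pos u), mul_one]
  exact le_max_right _ _

theorem retract_of_norm_le {u : E} (h : ‖u‖ ≤ 1) : retract u = u := by
  simp [retract, max_eq_left h]

theorem norm_retract_sub_le (u v : E) : ‖retract u - retract v‖ ≤ 2 * ‖u - v‖ := by
  have hp := max_one_norm_pos u
  have hmax : |max 1 ‖v‖ - max 1 ‖u‖| ≤ ‖u - v‖ := by
    refine (abs_max_sub_max_le_max 1 ‖v‖ 1 ‖u‖).trans ?_
    rw [sub_self, abs_zero, max_eq_right (abs_nonneg _), norm_sub_rev]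
    exact abs_norm_sub_norm_le v u
  have hsplit : retract u - retract v =
      (max 1 ‖u‖)⁻¹ • ((u - v) + (max 1 ‖v‖ - max 1 ‖u‖) • retract v) := by
    rw [sub_smul, max_one_norm_smul_retract, sub_add_sub_cancel, smul_sub, inv_smul_smul₀ hp.ne']
    rfl
  rw [hsplit, norm_smul, norm_inv, Real.norm_of_nonneg hp.le]
  calc _ ≤ 1 * (‖u - v‖ + ‖u - v‖ * 1) := by
        gcongr
        · exact inv_le_one_of_one_le₀ (le_max_left _ _)
        · refine (norm_add_le _ _).trans ?_
          rw [norm_smul]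
          gcongr
          · exact hmax
          · exact norm_retract_le v
    _ = 2 * ‖u - v‖ := by ring

theorem max_one_norm_mul_one_sub_norm_retract_sq_le (u : E) :
    max 1 ‖u‖ * (1 - ‖retract u‖ ^ 2) ≤ |‖u‖ ^ 2 - 1| := by
  rcases le_total ‖u‖ 1 with h | h
  · rw [retract_of_norm_le h, max_eq_left h, one_mul, abs_sub_comm]
    exact le_abs_self _
  · have hnorm : ‖retract u‖ = 1 := by
      rw [norm_retract, max_eq_right h, inv_mul_cancel₀ (by positivity)]
    rw [hnorm, one_pow, sub_self, mul_zero]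
    exact abs_nonneg _

end Retract

theorem exists_forall_hasDerivAt_of_lipschitz_of_bounded {E : Type*} [NormedAddCommGroup E]
    [NormedSpace ℝ E] [CompleteSpace E] {X : E → E} {L N : ℝ≥0} (hX : LipschitzWith L X)
    (hN : ∀ u, ‖X u‖ ≤ N) (v₀ : E) {T : ℝ} (hT : 0 ≤ T) :
    ∃ u : ℝ → E, u 0 = v₀ ∧ ∀ t ∈ Icc 0 T, HasDerivAt u (X (u t)) t := by
  have hzero : (0 : ℝ) ∈ Icc (-1) (T + 1) := ⟨by norm_num, by linarith⟩
  have hPL : IsPicardLindelof (fun _ => X) (⟨0, hzero⟩ : Icc (-1) (T + 1)) v₀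
      (N * (T + 1).toNNReal) 0 N L := by
    refine ⟨fun t _ => hX.lipschitzOnWith, fun x _ => continuousOn_const,
      fun t _ x _ => hN x, ?_⟩
    simp [max_eq_left (show (1 : ℝ) ≤ T + 1 by linarith), Real.coe_toNNReal _
      (show 0 ≤ T + 1 by linarith)]
  obtain ⟨u, hu₀, hu⟩ := hPL.exists_eq_forall_mem_Icc_hasDerivWithinAt₀
  exact ⟨u, hu₀, fun t ht => (hu t ⟨by linarith [ht.1], by linarith [ht.2]⟩).hasDerivAt
    (Icc_mem_nhds (by linarith [ht.1]) (by linarith [ht.2]))⟩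

section Galerkin

variable {ι E : Type*} [NormedAddCommGroup E] [InnerProductSpace ℝ E]
  {e : HilbertBasis ι ℝ E} {lam : ι → ℝ} {B : E → E → E} {C : ℝ} {f : E → E} {K : ℝ≥0}
  {F : Finset ι}

theorem abs_inner_self_le_of_tangent (hf : LipschitzWith K f)
    (hfM : ∀ u, ‖u‖ = 1 → ⟪f u, u⟫_ℝ = 0) {u : E} (hu : ‖u‖ ≤ 1) :
    |⟪f u, u⟫_ℝ| ≤ K * (1 - ‖u‖ ^ 2) := by
  rcases eq_or_ne u 0 with rfl | hne
  · simp
  have hpos : 0 < ‖u‖ := norm_pos_iff.2 hne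
  set v := ‖u‖⁻¹ • u with hv
  have huv : ‖u‖ • v = u := smul_inv_smul₀ hpos.ne' u
  have hv1 : ‖v‖ = 1 := by rw [hv, norm_smul, norm_inv, norm_norm, inv_mul_cancel₀ hpos.ne']
  have htangent : ⟪f v, u⟫_ℝ = 0 := by rw [← huv, real_inner_smul_right, hfM v hv1, mul_zero]
  have hdist : ‖u - v‖ = 1 - ‖u‖ := by
    have hsub : u - v = (‖u‖ - 1) • v := by rw [sub_smul, huv, one_smul]
    rw [hsub, norm_smul, hv1, mul_one, Real.norm_eq_abs, abs_sub_comm,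
      abs_of_nonneg (sub_nonneg.2 hu)]
  calc |⟪f u, u⟫_ℝ| = |⟪f u - f v, u⟫_ℝ| := by rw [inner_sub_left, htangent, sub_zero]
    _ ≤ ‖f u - f v‖ * ‖u‖ := abs_real_inner_le_norm _ _
    _ ≤ K * (1 - ‖u‖) * ‖u‖ := by gcongr; exact hdist ▸ hf.norm_sub_le u v
    _ ≤ K * (1 - ‖u‖) * (1 + ‖u‖) := by
        gcongr
        linarith
    _ = K * (1 - ‖u‖ ^ 2) := by ring

/-- The Galerkin vector field on the modes in `F`. It is precomposed with the radial retraction onto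
the unit ball, which makes it bounded and globally Lipschitz without changing it on the sphere. -/
def galerkinField (e : HilbertBasis ι ℝ E) (lam : ι → ℝ) (B : E → E → E) (f : E → E)
    (F : Finset ι) (u : E) : E :=
  trunc e F (constrainedRHS e lam B f (trunc e F (retract u)))

theorem galerkinField_eq {u : E} (hu : ∀ k ∉ F, ⟪e k, u⟫_ℝ = 0) (hu1 : ‖u‖ ≤ 1) :
    galerkinField e lam B f F u = trunc e F (constrainedRHS e lam B f u) := by
  rw [galerkinField, retract_of_norm_le hu1, trunc_eq_self hu]

namespace IsConvection

theorem exists_lipschitzWith_galerkinField (hB : IsConvection e lam B C)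
    (hf : LipschitzWith K f) (F : Finset ι) :
    ∃ L, LipschitzWith L (galerkinField e lam B f F) := by
  obtain ⟨c, hc₀, hc⟩ := hB.exists_norm_constrainedRHS_trunc_sub_le hf F
  refine ⟨⟨c * 2, by positivity⟩, LipschitzWith.of_dist_le_mul fun u v => ?_⟩
  rw [dist_eq_norm, dist_eq_norm, galerkinField, galerkinField, ← map_sub]
  calc _ ≤ c * ‖retract u - retract v‖ :=
        (norm_trunc_le e F _).trans (hc _ _ (norm_retract_le u) (norm_retract_le v))
    _ ≤ c * (2 * ‖u - v‖) := by gcongr; exact norm_retract_sub_le u v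
    _ = c * 2 * ‖u - v‖ := by ring

theorem exists_norm_galerkinField_le (hB : IsConvection e lam B C) (hf : LipschitzWith K f)
    (F : Finset ι) : ∃ N : ℝ≥0, ∀ u, ‖galerkinField e lam B f F u‖ ≤ N := by
  obtain ⟨c, hc₀, hc⟩ := hB.exists_norm_constrainedRHS_trunc_sub_le hf F
  refine ⟨⟨‖constrainedRHS e lam B f (trunc e F 0)‖ + c, by positivity⟩, fun u => ?_⟩
  have hsub := hc (retract u) 0 (norm_retract_le u) (by simp)
  rw [sub_zero] at hsub
  calc _ ≤ ‖constrainedRHS e lam B f (trunc e F (retract u))‖ := norm_trunc_le e F _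
    _ ≤ ‖constrainedRHS e lam B f (trunc e F 0)‖ + c * ‖retract u‖ :=
        (norm_le_norm_add_norm_sub' _ _).trans (by gcongr)
    _ ≤ ‖constrainedRHS e lam B f (trunc e F 0)‖ + c := by
        gcongr
        exact mul_le_of_le_one_right hc₀ (norm_retract_le u)

theorem abs_inner_constrainedRHS_self_le (hB : IsConvection e lam B C) (hf : LipschitzWith K f)
    (hfM : ∀ u, ‖u‖ = 1 → ⟪f u, u⟫_ℝ = 0) {u : E} (hu : ∀ k ∉ F, ⟪e k, u⟫_ℝ = 0)
    (hu1 : ‖u‖ ≤ 1) :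
    |⟪u, constrainedRHS e lam B f u⟫_ℝ| ≤ (‖truncDiagOp e lam F‖ ^ 2 + K) * (1 - ‖u‖ ^ 2) := by
  have hmem := mem_diagDomain_of_coord_eq_zero (lam := lam) hu
  have hsq : 0 ≤ 1 - ‖u‖ ^ 2 := by nlinarith [norm_nonneg u]
  have henergy : energy e lam u ≤ ‖truncDiagOp e lam F‖ ^ 2 := by
    refine (energy_le_norm_sq hB.one_le hmem).trans ?_
    rw [diagOp_eq_truncDiagOp hu]
    gcongr
    exact ((truncDiagOp e lam F).le_opNorm u).trans (mul_le_of_le_one_right (norm_nonneg _) hu1)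
  rw [hB.inner_constrainedRHS_self hmem, add_mul]
  refine (abs_add_le _ _).trans (add_le_add ?_ (abs_inner_self_le_of_tangent hf hfM hu1))
  rw [abs_mul, abs_of_nonneg (energy_nonneg hB.zero_le hmem), abs_sub_comm, abs_of_nonneg hsq]
  gcongr

theorem abs_inner_galerkinField_self_le (hB : IsConvection e lam B C) (hf : LipschitzWith K f)
    (hfM : ∀ u, ‖u‖ = 1 → ⟪f u, u⟫_ℝ = 0) {u : E} (hu : ∀ k ∉ F, ⟪e k, u⟫_ℝ = 0) :
    |⟪u, galerkinField e lam B f F u⟫_ℝ| ≤ (‖truncDiagOp e lam F‖ ^ 2 + K) * |‖u‖ ^ 2 - 1| := by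
  have hr : ∀ k ∉ F, ⟪e k, retract u⟫_ℝ = 0 := fun k hk => by
    rw [retract, real_inner_smul_right, hu k hk, mul_zero]
  have hinner : ⟪u, galerkinField e lam B f F u⟫_ℝ
      = max 1 ‖u‖ * ⟪retract u, constrainedRHS e lam B f (retract u)⟫_ℝ := by
    rw [galerkinField, ← trunc_symm, trunc_eq_self hu, trunc_eq_self hr, ← real_inner_smul_left,
      max_one_norm_smul_retract]
  rw [hinner, abs_mul, abs_of_pos (max_one_norm_pos u)]
  calc _ ≤ max 1 ‖u‖ * ((‖truncDiagOp e lam F‖ ^ 2 + K) * (1 - ‖retract u‖ ^ 2)) := by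
        gcongr
        exact hB.abs_inner_constrainedRHS_self_le hf hfM hr (norm_retract_le u)
    _ = (‖truncDiagOp e lam F‖ ^ 2 + K) * (max 1 ‖u‖ * (1 - ‖retract u‖ ^ 2)) := by ring
    _ ≤ _ := by
        gcongr
        exact max_one_norm_mul_one_sub_norm_retract_sq_le u

theorem coord_eq_zero_of_hasDerivAt_galerkinField {T : ℝ} {u : ℝ → E}
    (hu : ∀ t ∈ Icc 0 T, HasDerivAt u (galerkinField e lam B f F (u t)) t) {k : ι} (hk : k ∉ F)
    (h₀ : ⟪e k, u 0⟫_ℝ = 0) {t : ℝ} (ht : t ∈ Icc 0 T) : ⟪e k, u t⟫_ℝ = 0 := by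
  have hderiv : ∀ s ∈ Icc 0 T, HasDerivAt (fun s => ⟪e k, u s⟫_ℝ) 0 s := fun s hs => by
    simpa [galerkinField, coord_trunc_of_notMem e _ hk] using
      (hasDerivAt_const s (e k)).inner ℝ (hu s hs)
  rw [← h₀]
  exact constant_of_has_deriv_right_zero
    (fun s hs => (hderiv s hs).continuousAt.continuousWithinAt)
    (fun s hs => (hderiv s (Ico_subset_Icc_self hs)).hasDerivWithinAt) t ht

theorem norm_eq_one_of_hasDerivAt_galerkinField (hB : IsConvection e lam B C)
    (hf : LipschitzWith K f) (hfM : ∀ u, ‖u‖ = 1 → ⟪f u, u⟫_ℝ = 0) {T : ℝ} {u : ℝ → E}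
    (hu : ∀ t ∈ Icc 0 T, HasDerivAt u (galerkinField e lam B f F (u t)) t)
    (hcoord : ∀ t ∈ Icc 0 T, ∀ k ∉ F, ⟪e k, u t⟫_ℝ = 0) (h₀ : ‖u 0‖ = 1) {t : ℝ}
    (ht : t ∈ Icc 0 T) : ‖u t‖ = 1 := by
  have hsq : ‖u t‖ ^ 2 - 1 = 0 := by
    refine eq_zero_of_abs_deriv_le_mul_abs_self_of_eq_zero_right
      (f := fun t => ‖u t‖ ^ 2 - 1) (f' := fun t => 2 * ⟪u t, galerkinField e lam B f F (u t)⟫_ℝ)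
      (K := 2 * (‖truncDiagOp e lam F‖ ^ 2 + K))
      (fun s hs => ((hu s hs).norm_sq.sub_const 1).continuousAt.continuousWithinAt)
      (fun s hs => ((hu s (Ico_subset_Icc_self hs)).norm_sq.sub_const 1).hasDerivWithinAt)
      (by simp [h₀]) (fun s hs => ?_) t ht
    rw [norm_mul, Real.norm_two, Real.norm_eq_abs, Real.norm_eq_abs, mul_assoc]
    gcongr
    exact hB.abs_inner_galerkinField_self_le hf hfM (hcoord s (Ico_subset_Icc_self hs))
  exact (pow_eq_one_iff_of_nonneg (norm_nonneg _) two_ne_zero).1 (sub_eq_zero.1 hsq)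

end IsConvection

/-- `u` solves the Galerkin system with modes in `F` on `[0, T]` and stays on the unit sphere. -/
structure IsGalerkin (e : HilbertBasis ι ℝ E) (lam : ι → ℝ) (B : E → E → E) (f : E → E)
    (F : Finset ι) (T : ℝ) (u : ℝ → E) : Prop where
  hasDerivAt : ∀ t ∈ Icc 0 T, HasDerivAt u (trunc e F (constrainedRHS e lam B f (u t))) t
  norm_eq : ∀ t ∈ Icc 0 T, ‖u t‖ = 1
  coord_eq : ∀ t ∈ Icc 0 T, ∀ k ∉ F, ⟪e k, u t⟫_ℝ = 0

theorem IsConvection.exists_isGalerkin [CompleteSpace E] (hB : IsConvection e lam B C)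
    (hf : LipschitzWith K f) (hfM : ∀ u, ‖u‖ = 1 → ⟪f u, u⟫_ℝ = 0) {v₀ : E} (hv₀ : ‖v₀‖ = 1)
    (hv₀F : ∀ k ∉ F, ⟪e k, v₀⟫_ℝ = 0) {T : ℝ} (hT : 0 ≤ T) :
    ∃ u : ℝ → E, u 0 = v₀ ∧ IsGalerkin e lam B f F T u := by
  obtain ⟨L, hL⟩ := hB.exists_lipschitzWith_galerkinField hf F
  obtain ⟨N, hN⟩ := hB.exists_norm_galerkinField_le hf F
  obtain ⟨u, rfl, hu⟩ := exists_forall_hasDerivAt_of_lipschitz_of_bounded hL hN v₀ hT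
  have hcoord : ∀ t ∈ Icc 0 T, ∀ k ∉ F, ⟪e k, u t⟫_ℝ = 0 := fun t ht k hk =>
    coord_eq_zero_of_hasDerivAt_galerkinField hu hk (hv₀F k hk) ht
  have hnorm : ∀ t ∈ Icc 0 T, ‖u t‖ = 1 := fun t ht =>
    hB.norm_eq_one_of_hasDerivAt_galerkinField hf hfM hu hcoord hv₀ ht
  exact ⟨u, rfl, fun t ht => galerkinField_eq (hcoord t ht) (hnorm t ht).le ▸ hu t ht, hnorm,
    hcoord⟩

end Galerkin

section Estimates

theorem norm_le_of_lipschitz_of_norm_eq_one {E : Type*} [NormedAddCommGroup E] {f : E → E}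
    {K : ℝ≥0} (hf : LipschitzWith K f) {u : E} (hu : ‖u‖ = 1) :
    ‖f u‖ ≤ ‖f 0‖ + K := by
  have h := hf.norm_sub_le u 0
  rw [sub_zero, hu, mul_one] at h
  exact (norm_le_norm_add_norm_sub' (f u) (f 0)).trans (by gcongr)

variable {ι E : Type*} [NormedAddCommGroup E] [InnerProductSpace ℝ E]
  {e : HilbertBasis ι ℝ E} {lam : ι → ℝ} {B : E → E → E} {C : ℝ} {f : E → E} {K : ℝ≥0}
  {F G : Finset ι}

theorem inner_trunc_eq (e : HilbertBasis ι ℝ E) (F : Finset ι) (w z : E) :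
    ⟪w, trunc e F z⟫_ℝ = ⟪w, z⟫_ℝ - ⟪w - trunc e F w, z⟫_ℝ := by
  rw [inner_sub_left, trunc_symm, sub_sub_cancel]

theorem energy_sq_le {u : E} (hu1 : ‖u‖ = 1) : energy e lam u ^ 2 ≤ ‖diagOp e lam u‖ ^ 2 := by
  have h := abs_real_inner_le_norm (diagOp e lam u) u
  rw [hu1, mul_one] at h
  exact sq_le_sq.2 (h.trans_eq (abs_norm _).symm)

namespace IsConvection

/-- Since `f(u)` is orthogonal to `u`, only the component `A u - |∇u|² u` of `A u` meets it, and the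
norm of this component is controlled by the dissipation. -/
theorem two_mul_inner_diagOp_constrainedRHS_le (hB : IsConvection e lam B C)
    (hfM : ∀ u, ‖u‖ = 1 → ⟪f u, u⟫_ℝ = 0) {u : E} (hu : ∀ k ∉ F, ⟪e k, u⟫_ℝ = 0)
    (hu1 : ‖u‖ = 1) :
    2 * ⟪diagOp e lam u, constrainedRHS e lam B f u⟫_ℝ ≤
      energy e lam u ^ 2 - ‖diagOp e lam u‖ ^ 2 + ‖f u‖ ^ 2 := by
  set z := diagOp e lam u - energy e lam u • u with hz
  have hinner : ⟪diagOp e lam u, constrainedRHS e lam B f u⟫_ℝ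
      = -‖diagOp e lam u‖ ^ 2 + energy e lam u ^ 2 + ⟪diagOp e lam u, f u⟫_ℝ := by
    rw [constrainedRHS, inner_add_right, inner_add_right, inner_sub_right, inner_neg_right,
      real_inner_smul_right, real_inner_self_eq_norm_sq, real_inner_comm (B u u),
      hB.inner_diagOp hu, ← energy]
    ring
  have hnorm : ‖z‖ ^ 2 = ‖diagOp e lam u‖ ^ 2 - energy e lam u ^ 2 := by
    rw [hz, norm_sub_sq_real, real_inner_smul_right, ← energy, norm_smul, hu1, mul_one,
      Real.norm_eq_abs, sq_abs]
    ring
  have horth : ⟪diagOp e lam u, f u⟫_ℝ = ⟪z, f u⟫_ℝ := by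
    rw [hz, inner_sub_left, real_inner_smul_left, real_inner_comm (f u) u, hfM u hu1, mul_zero,
      sub_zero]
  rw [hinner, horth]
  nlinarith [sq_nonneg (‖z‖ - ‖f u‖), real_inner_le_norm z (f u)]

theorem norm_sub_self_le (hB : IsConvection e lam B C) (hf : LipschitzWith K f) {x : E}
    (hx : x ∈ diagDomain e lam) (hx1 : ‖x‖ = 1) {Y : ℝ} (hxY : energy e lam x ≤ Y) :
    ‖f x - B x x‖ ≤ (C * √Y + ‖f 0‖ + K) * (1 + ‖diagOp e lam x‖ ^ 2) := by
  have hC := hB.nonneg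
  have hBx : ‖B x x‖ ≤ C * √Y * ‖diagOp e lam x‖ := by
    rw [mul_right_comm]
    exact (hB.norm_le hx hx).trans (by gcongr)
  have hle : ‖diagOp e lam x‖ ≤ 1 + ‖diagOp e lam x‖ ^ 2 := by
    nlinarith [sq_nonneg (‖diagOp e lam x‖ - 1)]
  calc ‖f x - B x x‖ ≤ (‖f 0‖ + K) * 1 + C * √Y * ‖diagOp e lam x‖ := by
        rw [mul_one]
        exact (norm_sub_le _ _).trans
          (add_le_add (norm_le_of_lipschitz_of_norm_eq_one hf hx1) hBx)
    _ ≤ (‖f 0‖ + K) * (1 + ‖diagOp e lam x‖ ^ 2)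
        + C * √Y * (1 + ‖diagOp e lam x‖ ^ 2) := by
        gcongr
        linarith [sq_nonneg ‖diagOp e lam x‖]
    _ = _ := by ring

end IsConvection

theorem inner_sub_trunc_constrainedRHS {x : E} (hx : ∀ k ∉ F, ⟪e k, x⟫_ℝ = 0) (v : E) :
    ⟪(x - v) - trunc e F (x - v), constrainedRHS e lam B f x⟫_ℝ
      = -⟪v - trunc e F v, f x - B x x⟫_ℝ := by
  have hsub : (x - v) - trunc e F (x - v) = -(v - trunc e F v) := by
    rw [map_sub, trunc_eq_self hx]
    abel
  have horth : ∀ z, trunc e F z = z → ⟪v - trunc e F v, z⟫_ℝ = 0 := fun z hz => by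
    rw [inner_sub_left, trunc_symm, hz, sub_self]
  have hrhs : constrainedRHS e lam B f x
      = (energy e lam x • x - diagOp e lam x) + (f x - B x x) := by
    rw [constrainedRHS]
    abel
  rw [hsub, inner_neg_left, hrhs, inner_add_right, inner_sub_right, real_inner_smul_right,
    horth _ (trunc_eq_self hx), horth _ (trunc_diagOp hx), mul_zero, sub_zero, zero_add]

namespace IsConvection

theorem abs_inner_sub_trunc_constrainedRHS_le (hB : IsConvection e lam B C)
    (hf : LipschitzWith K f) {x v : E} (hx : ∀ k ∉ F, ⟪e k, x⟫_ℝ = 0) (hx1 : ‖x‖ = 1)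
    {Y r : ℝ} (hr : 0 < r) (hF : ∀ k ∉ F, r ^ 2 ≤ lam k) (hxY : energy e lam x ≤ Y)
    (hv : v ∈ diagDomain e lam) (hvY : energy e lam v ≤ Y) :
    |⟪(x - v) - trunc e F (x - v), constrainedRHS e lam B f x⟫_ℝ| ≤
      r⁻¹ * (√Y * (C * √Y + ‖f 0‖ + K)) * (1 + ‖diagOp e lam x‖ ^ 2) := by
  have htail : ‖v - trunc e F v‖ ≤ r⁻¹ * √Y := by
    rw [inv_mul_eq_div, le_div_iff₀' hr]
    refine Real.le_sqrt_of_sq_le ?_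
    rw [mul_pow]
    exact (mul_norm_sub_trunc_sq_le hB.zero_le hv hF).trans hvY
  rw [inner_sub_trunc_constrainedRHS hx, abs_neg]
  calc _ ≤ ‖v - trunc e F v‖ * ‖f x - B x x‖ := abs_real_inner_le_norm _ _
    _ ≤ (r⁻¹ * √Y) * ((C * √Y + ‖f 0‖ + K) * (1 + ‖diagOp e lam x‖ ^ 2)) := by
        gcongr
        exact hB.norm_sub_self_le hf (mem_diagDomain_of_coord_eq_zero hx) hx1 hxY
    _ = _ := by ring

theorem two_mul_inner_trunc_constrainedRHS_sub_le (hB : IsConvection e lam B C)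
    (hf : LipschitzWith K f) {x y : E} (hx : ∀ k ∉ F, ⟪e k, x⟫_ℝ = 0) (hx1 : ‖x‖ = 1)
    (hy : ∀ k ∉ G, ⟪e k, y⟫_ℝ = 0) (hy1 : ‖y‖ = 1) {Y r : ℝ} (hr : 0 < r)
    (hF : ∀ k ∉ F, r ^ 2 ≤ lam k) (hG : ∀ k ∉ G, r ^ 2 ≤ lam k) (hxY : energy e lam x ≤ Y)
    (hyY : energy e lam y ≤ Y) :
    2 * ⟪x - y, trunc e F (constrainedRHS e lam B f x)
        - trunc e G (constrainedRHS e lam B f y)⟫_ℝ ≤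
      (C ^ 2 + 4 + 2 * K + 4 * (√Y * (C * √Y + ‖f 0‖ + K)))
        * (1 + ‖diagOp e lam x‖ ^ 2 + ‖diagOp e lam y‖ ^ 2) * (‖x - y‖ ^ 2 + r⁻¹) := by
  have hxD := mem_diagDomain_of_coord_eq_zero (lam := lam) hx
  have hyD := mem_diagDomain_of_coord_eq_zero (lam := lam) hy
  have hC := hB.nonneg
  have hmain := hB.two_mul_inner_constrainedRHS_sub_le hf hxD hyD hy1.le
  have hxtail := hB.abs_inner_sub_trunc_constrainedRHS_le hf hx hx1 hr hF hxY hyD hyY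
  have hytail := hB.abs_inner_sub_trunc_constrainedRHS_le hf hy hy1 hr hG hyY hxD hxY
  rw [← neg_sub x y, map_neg, neg_sub_neg, ← neg_sub (x - y), inner_neg_left, abs_neg] at hytail
  set D := √Y * (C * √Y + ‖f 0‖ + K)
  set a := ‖diagOp e lam x‖ ^ 2
  set b := ‖diagOp e lam y‖ ^ 2
  have ha : 0 ≤ r⁻¹ * D * a := by positivity
  have hb : 0 ≤ r⁻¹ * D * b := by positivity
  have hrest : 0 ≤ (C ^ 2 + 4 + 2 * K) * (1 + a + b) * r⁻¹
      + 4 * D * (1 + a + b) * ‖x - y‖ ^ 2 := by positivity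
  rw [inner_sub_right, inner_trunc_eq, inner_trunc_eq]
  rw [inner_sub_right] at hmain
  linarith [neg_le_of_abs_le hxtail, le_of_abs_le hytail]

end IsConvection

namespace IsGalerkin

variable {T : ℝ} {u v : ℝ → E}

theorem continuousOn (hu : IsGalerkin e lam B f F T u) : ContinuousOn u (Icc 0 T) :=
  fun t ht => (hu.hasDerivAt t ht).continuousAt.continuousWithinAt

theorem mem_diagDomain (hu : IsGalerkin e lam B f F T u) {t : ℝ} (ht : t ∈ Icc 0 T) :
    u t ∈ diagDomain e lam :=
  mem_diagDomain_of_coord_eq_zero (hu.coord_eq t ht)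

theorem continuousOn_diagOp (hu : IsGalerkin e lam B f F T u) :
    ContinuousOn (fun t => diagOp e lam (u t)) (Icc 0 T) :=
  ((truncDiagOp e lam F).continuous.comp_continuousOn hu.continuousOn).congr fun t ht =>
    diagOp_eq_truncDiagOp (hu.coord_eq t ht)

theorem continuousOn_energy (hu : IsGalerkin e lam B f F T u) :
    ContinuousOn (fun t => energy e lam (u t)) (Icc 0 T) :=
  hu.continuousOn_diagOp.inner hu.continuousOn

theorem intervalIntegrable_norm_diagOp_sq (hu : IsGalerkin e lam B f F T u) (hT : 0 ≤ T) :
    IntervalIntegrable (fun t => ‖diagOp e lam (u t)‖ ^ 2) volume 0 T :=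
  (hu.continuousOn_diagOp.norm.pow 2).intervalIntegrable_of_Icc hT

theorem continuousOn_constrainedRHS (hu : IsGalerkin e lam B f F T u)
    (hB : IsConvection e lam B C) (hf : LipschitzWith K f) :
    ContinuousOn (fun t => constrainedRHS e lam B f (u t)) (Icc 0 T) := by
  obtain ⟨c, hc₀, hc⟩ := hB.exists_norm_constrainedRHS_trunc_sub_le hf F
  have hlip : LipschitzOnWith c.toNNReal
      (fun x => constrainedRHS e lam B f (trunc e F x)) (Metric.closedBall 0 1) :=
    LipschitzOnWith.of_dist_le_mul fun x hx y hy => by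
      rw [dist_eq_norm, dist_eq_norm, Real.coe_toNNReal _ hc₀]
      exact hc x y (by simpa using hx) (by simpa using hy)
  refine (hlip.continuousOn.comp hu.continuousOn fun t ht => ?_).congr fun t ht => ?_
  · simp [hu.norm_eq t ht]
  · simp only [Function.comp_apply, trunc_eq_self (hu.coord_eq t ht)]

theorem isPrimitiveOn [CompleteSpace E] (hu : IsGalerkin e lam B f F T u)
    (hB : IsConvection e lam B C) (hf : LipschitzWith K f) (hT : 0 ≤ T) :
    IsPrimitiveOn T u fun t => trunc e F (constrainedRHS e lam B f (u t)) := by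
  have hcont : ContinuousOn (fun t => trunc e F (constrainedRHS e lam B f (u t))) (Icc 0 T) :=
    (trunc e F).continuous.comp_continuousOn (hu.continuousOn_constrainedRHS hB hf)
  refine ⟨hcont.intervalIntegrable_of_Icc hT, fun t ht => ?_⟩
  have hsub : Icc 0 t ⊆ Icc 0 T := Icc_subset_Icc_right ht.2
  rw [intervalIntegral.integral_eq_sub_of_hasDerivAt (f := u)
    (fun s hs => hu.hasDerivAt s (hsub (uIcc_of_le ht.1 ▸ hs)))
    ((hcont.mono hsub).intervalIntegrable_of_Icc ht.1), add_sub_cancel]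

theorem hasDerivAt_inner_truncDiagOp (hu : IsGalerkin e lam B f F T u) {t : ℝ}
    (ht : t ∈ Icc 0 T) :
    HasDerivAt (fun t => ⟪truncDiagOp e lam F (u t), u t⟫_ℝ)
      (2 * ⟪diagOp e lam (u t), constrainedRHS e lam B f (u t)⟫_ℝ) t := by
  set z := constrainedRHS e lam B f (u t) with hz
  have hut := hu.hasDerivAt t ht
  have hinner : ⟪truncDiagOp e lam F (u t), trunc e F z⟫_ℝ = ⟪diagOp e lam (u t), z⟫_ℝ := by
    rw [← diagOp_eq_truncDiagOp (hu.coord_eq t ht), ← trunc_symm, trunc_diagOp (hu.coord_eq t ht)]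
  refine (((truncDiagOp e lam F).hasFDerivAt.comp_hasDerivAt t hut).inner ℝ hut).congr_deriv ?_
  rw [← hz, truncDiagOp_symm, Function.comp_apply, real_inner_comm _ (trunc e F z), hinner, two_mul]

theorem energy_sub_eq_integral (hu : IsGalerkin e lam B f F T u) (hB : IsConvection e lam B C)
    (hf : LipschitzWith K f) {t : ℝ} (ht : t ∈ Icc 0 T) :
    energy e lam (u t) - energy e lam (u 0)
      = ∫ s in 0..t, 2 * ⟪diagOp e lam (u s), constrainedRHS e lam B f (u s)⟫_ℝ := by
  have hsub : Icc 0 t ⊆ Icc 0 T := Icc_subset_Icc_right ht.2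
  have henergy : ∀ s ∈ Icc 0 T, energy e lam (u s) = ⟪truncDiagOp e lam F (u s), u s⟫_ℝ :=
    fun s hs => by rw [energy, diagOp_eq_truncDiagOp (hu.coord_eq s hs)]
  have hcont : ContinuousOn
      (fun s => 2 * ⟪diagOp e lam (u s), constrainedRHS e lam B f (u s)⟫_ℝ) (Icc 0 T) :=
    continuousOn_const.mul (hu.continuousOn_diagOp.inner (hu.continuousOn_constrainedRHS hB hf))
  rw [henergy t ht, henergy 0 ⟨le_rfl, ht.1.trans ht.2⟩, eq_comm]
  exact intervalIntegral.integral_eq_sub_of_hasDerivAt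
    (fun s hs => hu.hasDerivAt_inner_truncDiagOp (hsub (uIcc_of_le ht.1 ▸ hs)))
    ((hcont.mono hsub).intervalIntegrable_of_Icc ht.1)

theorem energy_add_integral_le (hu : IsGalerkin e lam B f F T u) (hB : IsConvection e lam B C)
    (hf : LipschitzWith K f) (hfM : ∀ u, ‖u‖ = 1 → ⟪f u, u⟫_ℝ = 0) {t : ℝ}
    (ht : t ∈ Icc 0 T) :
    energy e lam (u t) + ∫ s in 0..t, (‖diagOp e lam (u s)‖ ^ 2 - energy e lam (u s) ^ 2)
      ≤ energy e lam (u 0) + (‖f 0‖ + K) ^ 2 * t := by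
  have hsub : Icc 0 t ⊆ Icc 0 T := Icc_subset_Icc_right ht.2
  have hA := hu.continuousOn_diagOp.mono hsub
  have hi : IntervalIntegrable
      (fun s => 2 * ⟪diagOp e lam (u s), constrainedRHS e lam B f (u s)⟫_ℝ) volume 0 t :=
    (continuousOn_const.mul (hA.inner ((hu.continuousOn_constrainedRHS hB hf).mono
      hsub))).intervalIntegrable_of_Icc ht.1
  have hj : IntervalIntegrable (fun s => ‖diagOp e lam (u s)‖ ^ 2 - energy e lam (u s) ^ 2)
      volume 0 t :=
    ((hA.norm.pow 2).sub ((hu.continuousOn_energy.mono hsub).pow 2)).intervalIntegrable_of_Icc ht.1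
  have hle : ∫ s in 0..t, (2 * ⟪diagOp e lam (u s), constrainedRHS e lam B f (u s)⟫_ℝ
      + (‖diagOp e lam (u s)‖ ^ 2 - energy e lam (u s) ^ 2)) ≤ ∫ _ in 0..t, (‖f 0‖ + K) ^ 2 := by
    refine intervalIntegral.integral_mono_on ht.1 (hi.add hj) intervalIntegrable_const
      fun s hs => ?_
    have hdiss := hB.two_mul_inner_diagOp_constrainedRHS_le hfM (hu.coord_eq s (hsub hs))
      (hu.norm_eq s (hsub hs))
    have hfu : ‖f (u s)‖ ^ 2 ≤ (‖f 0‖ + K) ^ 2 := by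
      gcongr
      exact norm_le_of_lipschitz_of_norm_eq_one hf (hu.norm_eq s (hsub hs))
    linarith
  rw [intervalIntegral.integral_add hi hj, ← hu.energy_sub_eq_integral hB hf ht,
    intervalIntegral.integral_const, sub_zero, smul_eq_mul] at hle
  linarith

theorem energy_le (hu : IsGalerkin e lam B f F T u) (hB : IsConvection e lam B C)
    (hf : LipschitzWith K f) (hfM : ∀ u, ‖u‖ = 1 → ⟪f u, u⟫_ℝ = 0) {t : ℝ}
    (ht : t ∈ Icc 0 T) :
    energy e lam (u t) ≤ energy e lam (u 0) + (‖f 0‖ + K) ^ 2 * T := by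
  have hnonneg : 0 ≤ ∫ s in 0..t, (‖diagOp e lam (u s)‖ ^ 2 - energy e lam (u s) ^ 2) :=
    intervalIntegral.integral_nonneg ht.1 fun s hs =>
      sub_nonneg.2 (energy_sq_le (hu.norm_eq s ⟨hs.1, hs.2.trans ht.2⟩))
  calc _ ≤ energy e lam (u 0) + (‖f 0‖ + K) ^ 2 * t :=
        (le_add_of_nonneg_right hnonneg).trans (hu.energy_add_integral_le hB hf hfM ht)
    _ ≤ _ := by gcongr; exact ht.2

theorem integral_norm_diagOp_sq_le (hu : IsGalerkin e lam B f F T u)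
    (hB : IsConvection e lam B C) (hf : LipschitzWith K f)
    (hfM : ∀ u, ‖u‖ = 1 → ⟪f u, u⟫_ℝ = 0) (hT : 0 ≤ T) {Y : ℝ}
    (hY : energy e lam (u 0) + (‖f 0‖ + K) ^ 2 * T ≤ Y) :
    ∫ s in 0..T, ‖diagOp e lam (u s)‖ ^ 2 ≤ Y + T * Y ^ 2 := by
  have hTT : T ∈ Icc 0 T := ⟨hT, le_rfl⟩
  have hi := hu.intervalIntegrable_norm_diagOp_sq hT
  have hj : IntervalIntegrable (fun t => energy e lam (u t) ^ 2) volume 0 T :=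
    (hu.continuousOn_energy.pow 2).intervalIntegrable_of_Icc hT
  have hdiss := hu.energy_add_integral_le hB hf hfM hTT
  have henergy : ∫ s in 0..T, energy e lam (u s) ^ 2 ≤ ∫ _ in 0..T, Y ^ 2 := by
    refine intervalIntegral.integral_mono_on hT hj intervalIntegrable_const fun s hs => ?_
    gcongr
    · exact energy_nonneg hB.zero_le (hu.mem_diagDomain hs)
    · exact (hu.energy_le hB hf hfM hs).trans hY
  rw [intervalIntegral.integral_const, sub_zero, smul_eq_mul] at henergy
  rw [intervalIntegral.integral_sub hi hj] at hdiss
  linarith [energy_nonneg hB.zero_le (hu.mem_diagDomain hTT)]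

theorem norm_sub_sq_le [CompleteSpace E] (hu : IsGalerkin e lam B f F T u)
    (hv : IsGalerkin e lam B f G T v) (hB : IsConvection e lam B C) (hf : LipschitzWith K f)
    {Y Z r : ℝ} (hr : 0 < r)
    (hF : ∀ k ∉ F, r ^ 2 ≤ lam k) (hG : ∀ k ∉ G, r ^ 2 ≤ lam k)
    (huY : ∀ t ∈ Icc 0 T, energy e lam (u t) ≤ Y) (hvY : ∀ t ∈ Icc 0 T, energy e lam (v t) ≤ Y)
    (huZ : ∫ s in 0..T, ‖diagOp e lam (u s)‖ ^ 2 ≤ Z)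
    (hvZ : ∫ s in 0..T, ‖diagOp e lam (v s)‖ ^ 2 ≤ Z) {t : ℝ} (ht : t ∈ Icc 0 T) :
    ‖u t - v t‖ ^ 2 ≤ (‖u 0 - v 0‖ ^ 2 + r⁻¹) *
      Real.exp ((C ^ 2 + 4 + 2 * K + 4 * (√Y * (C * √Y + ‖f 0‖ + K))) * (T + 2 * Z)) := by
  have hT : 0 ≤ T := ht.1.trans ht.2
  have hC := hB.nonneg
  set D := C ^ 2 + 4 + 2 * K + 4 * (√Y * (C * √Y + ‖f 0‖ + K))
  set g : ℝ → ℝ := fun s => D * (1 + ‖diagOp e lam (u s)‖ ^ 2 + ‖diagOp e lam (v s)‖ ^ 2)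
  have hiu := hu.intervalIntegrable_norm_diagOp_sq hT
  have hiv := hv.intervalIntegrable_norm_diagOp_sq hT
  have hg : IntervalIntegrable g volume 0 T :=
    ((intervalIntegrable_const.add hiu).add hiv).const_mul D
  have hgint : ∫ s in 0..T, g s ≤ D * (T + 2 * Z) := by
    rw [intervalIntegral.integral_const_mul, intervalIntegral.integral_add
      (intervalIntegrable_const.add hiu) hiv, intervalIntegral.integral_add
      intervalIntegrable_const hiu, intervalIntegral.integral_const, sub_zero, smul_eq_mul, mul_one,
      add_assoc, two_mul]
    gcongr
  have hgt : ∫ s in 0..t, g s ≤ ∫ s in 0..T, g s :=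
    intervalIntegral.integral_mono_interval le_rfl ht.1 ht.2
      (Filter.Eventually.of_forall fun s => by positivity) hg
  have hprim := (hu.isPrimitiveOn hB hf hT).sub (hv.isPrimitiveOn hB hf hT)
  have hgronwall := hprim.norm_sq_add_le_mul_exp hg (Filter.Eventually.of_forall fun s hs => by
      have hs' : s ∈ Icc 0 T := Ioo_subset_Icc_self hs
      exact hB.two_mul_inner_trunc_constrainedRHS_sub_le hf (hu.coord_eq s hs') (hu.norm_eq s hs')
        (hv.coord_eq s hs') (hv.norm_eq s hs') hr hF hG (huY s hs') (hvY s hs')) ht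
  refine (le_add_of_nonneg_right (inv_nonneg.2 hr.le)).trans (hgronwall.trans ?_)
  gcongr
  exact hgt.trans hgint

end IsGalerkin

end Estimates

/-! ### Measurability and semicontinuity along curves -/

section TimeMeasure

instance (T : ℝ) : IsFiniteMeasure (timeMeasure T) := by
  unfold timeMeasure
  infer_instance

theorem timeMeasure_eq_restrict_Ioc (T : ℝ) : timeMeasure T = volume.restrict (Ioc 0 T) :=
  Measure.restrict_congr_set Ioo_ae_eq_Ioc

theorem timeMeasure_mono {S T : ℝ} (h : S ≤ T) : timeMeasure S ≤ timeMeasure T :=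
  Measure.restrict_mono (Ioo_subset_Ioo_right h) le_rfl

theorem ae_timeMeasure_iff {T : ℝ} {p : ℝ → Prop} :
    (∀ᵐ t ∂timeMeasure T, p t) ↔ ∀ᵐ t, t ∈ Ioo 0 T → p t :=
  ae_restrict_iff' measurableSet_Ioo

theorem ae_timeMeasure_of_Icc {T : ℝ} {p : ℝ → Prop} (h : ∀ t ∈ Icc 0 T, p t) :
    ∀ᵐ t ∂timeMeasure T, p t :=
  ae_timeMeasure_iff.2 (Filter.Eventually.of_forall fun t ht => h t (Ioo_subset_Icc_self ht))

theorem integral_timeMeasure {E : Type*} [NormedAddCommGroup E] [NormedSpace ℝ E] {T : ℝ}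
    (hT : 0 ≤ T) (h : ℝ → E) : ∫ t, h t ∂timeMeasure T = ∫ t in 0..T, h t := by
  rw [timeMeasure_eq_restrict_Ioc, intervalIntegral.integral_of_le hT]

variable {E : Type*} [NormedAddCommGroup E]

theorem integrable_timeMeasure_iff {T : ℝ} (hT : 0 ≤ T) {h : ℝ → E} :
    Integrable h (timeMeasure T) ↔ IntervalIntegrable h volume 0 T := by
  rw [timeMeasure_eq_restrict_Ioc, intervalIntegrable_iff_integrableOn_Ioc_of_le hT,
    IntegrableOn]

theorem aestronglyMeasurable_of_continuousOn {T : ℝ} {h : ℝ → E}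
    (hh : ContinuousOn h (Icc 0 T)) : AEStronglyMeasurable h (timeMeasure T) :=
  (hh.mono Ioo_subset_Icc_self).aestronglyMeasurable measurableSet_Ioo

theorem integrable_timeMeasure_of_continuousOn {T : ℝ} {h : ℝ → E}
    (hh : ContinuousOn h (Icc 0 T)) : Integrable h (timeMeasure T) :=
  (hh.integrableOn_Icc.mono_set Ioo_subset_Icc_self)

end TimeMeasure

section Semicontinuity

variable {ι E : Type*} [NormedAddCommGroup E] [InnerProductSpace ℝ E]
  {e : HilbertBasis ι ℝ E} {lam : ι → ℝ} {u : E}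

theorem hasSum_norm_diagOp_sq (hu : u ∈ diagDomain e lam) :
    HasSum (fun k => (lam k * ⟪e k, u⟫_ℝ) ^ 2) (‖diagOp e lam u‖ ^ 2) := by
  simpa only [coord_diagOp hu] using hasSum_coord_sq e (diagOp e lam u)

/-- The square of the norm of `diagOp e lam u`, as an extended nonnegative number which is infinite
off the domain. -/
def diagNormSq (e : HilbertBasis ι ℝ E) (lam : ι → ℝ) (u : E) : ℝ≥0∞ :=
  ∑' k, ENNReal.ofReal ((lam k * ⟪e k, u⟫_ℝ) ^ 2)

theorem diagNormSq_eq (hu : u ∈ diagDomain e lam) :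
    diagNormSq e lam u = ENNReal.ofReal (‖diagOp e lam u‖ ^ 2) := by
  have hsum := hasSum_norm_diagOp_sq hu
  rw [← hsum.tsum_eq, ENNReal.ofReal_tsum_of_nonneg (fun k => sq_nonneg _) hsum.summable,
    diagNormSq]

theorem mem_diagDomain_of_diagNormSq_ne_top (h : diagNormSq e lam u ≠ ⊤) :
    u ∈ diagDomain e lam :=
  (ENNReal.summable_toReal h).congr fun _ => ENNReal.toReal_ofReal (sq_nonneg _)

open Filter Topology in
theorem diagNormSq_le_liminf {un : ℕ → E} (h : Tendsto un atTop (𝓝 u)) :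
    diagNormSq e lam u ≤ liminf (fun n => diagNormSq e lam (un n)) atTop := by
  rw [diagNormSq, ENNReal.tsum_eq_iSup_sum]
  refine iSup_le fun S => ?_
  have hsum : Tendsto (fun n => ∑ k ∈ S, ENNReal.ofReal ((lam k * ⟪e k, un n⟫_ℝ) ^ 2)) atTop
      (𝓝 (∑ k ∈ S, ENNReal.ofReal ((lam k * ⟪e k, u⟫_ℝ) ^ 2))) :=
    tendsto_finsetSum S fun k _ =>
      ENNReal.tendsto_ofReal (((tendsto_const_nhds.inner h).const_mul (lam k)).pow 2)
  rw [← hsum.liminf_eq]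
  exact liminf_le_liminf (Eventually.of_forall fun n => ENNReal.sum_le_tsum S)

variable {α : Type*} [MeasurableSpace α] {μ : Measure α} {w : α → E}

theorem aestronglyMeasurable_of_coord [Countable ι] (e : HilbertBasis ι ℝ E)
    (h : ∀ k, AEStronglyMeasurable (fun a => ⟪e k, w a⟫_ℝ) μ) : AEStronglyMeasurable w μ := by
  refine aestronglyMeasurable_of_tendsto_ae (u := Filter.atTop) (f := fun F a => trunc e F (w a))
    (fun F => ?_) (Filter.Eventually.of_forall fun a => tendsto_trunc e (w a))
  simp only [trunc_apply]
  exact Finset.aestronglyMeasurable_fun_sum _ fun k _ => (h k).smul_const (e k)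

theorem aestronglyMeasurable_coord (hw : AEStronglyMeasurable w μ) (k : ι) :
    AEStronglyMeasurable (fun a => ⟪e k, w a⟫_ℝ) μ :=
  aestronglyMeasurable_const.inner hw

theorem aestronglyMeasurable_diagOp [Countable ι] (hw : AEStronglyMeasurable w μ)
    (hmem : ∀ᵐ a ∂μ, w a ∈ diagDomain e lam) :
    AEStronglyMeasurable (fun a => diagOp e lam (w a)) μ := by
  refine aestronglyMeasurable_of_coord e fun k => ?_
  refine ((aestronglyMeasurable_coord (e := e) hw k).const_mul (lam k)).congr ?_
  filter_upwards [hmem] with a ha using (coord_diagOp ha k).symm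

theorem aemeasurable_diagNormSq [Countable ι] (hw : AEStronglyMeasurable w μ) :
    AEMeasurable (fun a => diagNormSq e lam (w a)) μ :=
  AEMeasurable.tsum fun k => AEMeasurable.ennreal_ofReal
    (((aestronglyMeasurable_coord hw k).const_mul (lam k)).pow 2).aemeasurable

theorem lintegral_diagNormSq_eq (hmem : ∀ᵐ a ∂μ, w a ∈ diagDomain e lam)
    (hint : Integrable (fun a => ‖diagOp e lam (w a)‖ ^ 2) μ) :
    ∫⁻ a, diagNormSq e lam (w a) ∂μ = ENNReal.ofReal (∫ a, ‖diagOp e lam (w a)‖ ^ 2 ∂μ) := by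
  rw [ofReal_integral_eq_lintegral_ofReal hint (Filter.Eventually.of_forall fun a => sq_nonneg _)]
  refine lintegral_congr_ae ?_
  filter_upwards [hmem] with a ha using diagNormSq_eq ha

open Filter Topology in
theorem lintegral_diagNormSq_le_of_tendsto [Countable ι] {wn : ℕ → α → E} {Z : ℝ≥0∞}
    (hwn : ∀ n, AEStronglyMeasurable (wn n) μ)
    (hlim : ∀ᵐ a ∂μ, Tendsto (fun n => wn n a) atTop (𝓝 (w a)))
    (hZ : ∀ n, ∫⁻ a, diagNormSq e lam (wn n a) ∂μ ≤ Z) :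
    ∫⁻ a, diagNormSq e lam (w a) ∂μ ≤ Z := by
  calc ∫⁻ a, diagNormSq e lam (w a) ∂μ
      ≤ ∫⁻ a, liminf (fun n => diagNormSq e lam (wn n a)) atTop ∂μ :=
        lintegral_mono_ae (hlim.mono fun a ha => diagNormSq_le_liminf ha)
    _ ≤ liminf (fun n => ∫⁻ a, diagNormSq e lam (wn n a) ∂μ) atTop :=
        lintegral_liminf_le' fun n => aemeasurable_diagNormSq (hwn n)
    _ ≤ Z := liminf_le_of_frequently_le' (Frequently.of_forall hZ)

theorem ae_mem_diagDomain_of_lintegral_ne_top [Countable ι] (hw : AEStronglyMeasurable w μ)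
    (hfin : ∫⁻ a, diagNormSq e lam (w a) ∂μ ≠ ⊤) : ∀ᵐ a ∂μ, w a ∈ diagDomain e lam :=
  (ae_lt_top' (aemeasurable_diagNormSq hw) hfin).mono fun _ ha =>
    mem_diagDomain_of_diagNormSq_ne_top ha.ne

theorem memLp_diagOp_of_lintegral_ne_top [Countable ι] (hw : AEStronglyMeasurable w μ)
    (hfin : ∫⁻ a, diagNormSq e lam (w a) ∂μ ≠ ⊤) : MemLp (fun a => diagOp e lam (w a)) 2 μ := by
  have hmem := ae_mem_diagDomain_of_lintegral_ne_top hw hfin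
  have hmeas := aestronglyMeasurable_diagOp hw hmem
  rw [← memLp_norm_iff hmeas, memLp_two_iff_integrable_sq hmeas.norm]
  refine ⟨hmeas.norm.pow 2, ?_⟩
  rw [hasFiniteIntegral_iff_ofReal (Filter.Eventually.of_forall fun a => sq_nonneg _)]
  refine (lintegral_mono_ae ?_).trans_lt hfin.lt_top
  filter_upwards [hmem] with a ha using (diagNormSq_eq ha).ge

variable {B : E → E → E} {C : ℝ} {f : E → E} {K : ℝ≥0}

/- The coordinate `⟪e k, B u u⟫ = -⟪B u (e k), u⟫` is Lipschitz on bounded subsets of the domain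
although `B` is not continuous in the norm. -/
theorem IsConvection.aestronglyMeasurable_convection [Countable ι] (hB : IsConvection e lam B C)
    (hw : AEStronglyMeasurable w μ) (hmem : ∀ᵐ a ∂μ, w a ∈ diagDomain e lam)
    (hnorm : ∀ᵐ a ∂μ, ‖w a‖ ≤ 1) : AEStronglyMeasurable (fun a => B (w a) (w a)) μ := by
  refine aestronglyMeasurable_of_coord e fun k => ?_
  obtain ⟨c, hc⟩ := hB.basis_le k
  have hlip : LipschitzOnWith (2 * c.toNNReal) (fun u => -⟪B u (e k), u⟫_ℝ)
      {u | u ∈ diagDomain e lam ∧ ‖u‖ ≤ 1} := by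
    refine LipschitzOnWith.of_dist_le_mul fun u hu v hv => ?_
    have huv := sub_mem hu.1 hv.1
    have hsplit : -⟪B u (e k), u⟫_ℝ - -⟪B v (e k), v⟫_ℝ
        = -(⟪B (u - v) (e k), u⟫_ℝ + ⟪B v (e k), u - v⟫_ℝ) := by
      rw [hB.sub_left hu.1 hv.1 (basis_mem_diagDomain k), inner_sub_left, inner_sub_right]
      ring
    rw [dist_eq_norm, dist_eq_norm, hsplit, norm_neg, two_mul, NNReal.coe_add, add_mul,
      Real.norm_eq_abs]
    refine (abs_add_le ..).trans (add_le_add ((hc huv hu.1).trans ?_) ((hc hv.1 huv).trans ?_))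
    · calc c * ‖u - v‖ * ‖u‖ ≤ c.toNNReal * ‖u - v‖ * 1 := by
            gcongr
            exacts [Real.le_coe_toNNReal c, hu.2]
        _ = c.toNNReal * ‖u - v‖ := mul_one _
    · calc c * ‖v‖ * ‖u - v‖ ≤ c.toNNReal * 1 * ‖u - v‖ := by
            gcongr
            exacts [Real.le_coe_toNNReal c, hv.2]
        _ = c.toNNReal * ‖u - v‖ := by rw [mul_one]
  obtain ⟨g, hg, hgeq⟩ := hlip.extend_real
  refine (hg.continuous.comp_aestronglyMeasurable hw).congr ?_
  filter_upwards [hmem, hnorm] with a ha hna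
  refine (hgeq ⟨ha, hna⟩).symm.trans ?_
  rw [real_inner_comm (B (w a) (w a)), hB.inner_swap ha ha (basis_mem_diagDomain k)]

theorem IsConvection.memLp_constrainedRHS [Countable ι] [IsFiniteMeasure μ]
    (hB : IsConvection e lam B C) (hf : LipschitzWith K f) {Y : ℝ}
    (hw : AEStronglyMeasurable w μ) (hmem : ∀ᵐ a ∂μ, w a ∈ diagDomain e lam)
    (hnorm : ∀ᵐ a ∂μ, ‖w a‖ = 1) (henergy : ∀ᵐ a ∂μ, energy e lam (w a) ≤ Y)
    (hA : MemLp (fun a => diagOp e lam (w a)) 2 μ) :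
    MemLp (fun a => constrainedRHS e lam B f (w a)) 2 μ := by
  have hmeas : AEStronglyMeasurable (fun a => constrainedRHS e lam B f (w a)) μ :=
    ((hA.1.neg.sub (hB.aestronglyMeasurable_convection hw hmem (hnorm.mono fun _ h => h.le))).add
      ((hA.1.inner (𝕜 := ℝ) hw).smul hw)).add (hf.continuous.comp_aestronglyMeasurable hw)
  have hbound : MemLp (fun a => (1 + C * √Y) * ‖diagOp e lam (w a)‖ + (Y + (‖f 0‖ + K))) 2 μ :=
    (hA.norm.const_mul _).add (memLp_const _)
  refine hbound.of_le hmeas ?_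
  filter_upwards [hmem, henergy, hnorm] with a ha haY hna
  refine ((hB.norm_constrainedRHS_le ha).trans ?_).trans (le_abs_self _)
  have hfa := norm_le_of_lipschitz_of_norm_eq_one hf hna
  have hCa : C * ‖diagOp e lam (w a)‖ * √(energy e lam (w a))
      ≤ C * ‖diagOp e lam (w a)‖ * √Y := by
    have := hB.nonneg
    gcongr
  rw [hna]
  linarith

end Semicontinuity

open Filter Topology in
theorem tendsto_integral_of_norm_sub_le_mul {α E : Type*} [MeasurableSpace α] {μ : Measure α}
    [NormedAddCommGroup E] [NormedSpace ℝ E] {φn : ℕ → α → E} {φ : α → E} {g : ℕ → α → ℝ} {W : ℝ}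
    (hφn : ∀ n, Integrable (φn n) μ) (hφ : Integrable φ μ) (hg : ∀ n, Integrable (g n) μ)
    (hW : ∀ n, ∫ a, g n a ∂μ ≤ W)
    (hle : ∀ δ > 0, ∀ᶠ n in atTop, ∀ᵐ a ∂μ, ‖φn n a - φ a‖ ≤ δ * g n a) :
    Tendsto (fun n => ∫ a, φn n a ∂μ) atTop (𝓝 (∫ a, φ a ∂μ)) := by
  rw [Metric.tendsto_nhds]
  intro ε hε
  filter_upwards [hle (ε / (|W| + 1)) (by positivity)] with n hn
  rw [dist_eq_norm, ← integral_sub (hφn n) hφ]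
  calc ‖∫ a, φn n a - φ a ∂μ‖ ≤ ∫ a, ε / (|W| + 1) * g n a ∂μ :=
        norm_integral_le_of_norm_le ((hg n).const_mul _) hn
    _ = ε / (|W| + 1) * ∫ a, g n a ∂μ := integral_const_mul _ _
    _ ≤ ε / (|W| + 1) * |W| := by
        gcongr
        exact (hW n).trans (le_abs_self W)
    _ < ε := by
        rw [div_mul_eq_mul_div, div_lt_iff₀ (by positivity)]
        linarith

/-! ### Strong solutions -/

section StrongSolution

variable {ι E : Type*} [NormedAddCommGroup E] [InnerProductSpace ℝ E]

/-- Strong solutions on `[0, T]` of the abstract equation `u' = constrainedRHS e lam B f u`, in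
integrated form. -/
structure IsStrongSolution (e : HilbertBasis ι ℝ E) (lam : ι → ℝ) (B : E → E → E) (f : E → E)
    (T : ℝ) (u : ℝ → E) : Prop where
  mem_diagDomain : ∀ᵐ t ∂timeMeasure T, u t ∈ diagDomain e lam
  memLp_diagOp : MemLp (fun t => diagOp e lam (u t)) 2 (timeMeasure T)
  memLp_constrainedRHS : MemLp (fun t => constrainedRHS e lam B f (u t)) 2 (timeMeasure T)
  eq_add_integral : ∀ t ∈ Icc 0 T, u t = u 0 + ∫ s in 0..t, constrainedRHS e lam B f (u s)

variable {e : HilbertBasis ι ℝ E} {lam : ι → ℝ} {B : E → E → E} {C : ℝ} {f : E → E} {K : ℝ≥0}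
  {T : ℝ} {u v : ℝ → E}

namespace IsStrongSolution

theorem isPrimitiveOn (hu : IsStrongSolution e lam B f T u) (hT : 0 ≤ T) :
    IsPrimitiveOn T u fun t => constrainedRHS e lam B f (u t) where
  intervalIntegrable :=
    (integrable_timeMeasure_iff hT).1 (hu.memLp_constrainedRHS.integrable one_le_two)
  eq_add_integral := hu.eq_add_integral

theorem intervalIntegrable_norm_diagOp_sq (hu : IsStrongSolution e lam B f T u) (hT : 0 ≤ T) :
    IntervalIntegrable (fun t => ‖diagOp e lam (u t)‖ ^ 2) volume 0 T :=
  (integrable_timeMeasure_iff hT).1 hu.memLp_diagOp.norm.integrable_sq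

theorem eqOn [CompleteSpace E] (hB : IsConvection e lam B C) (hf : LipschitzWith K f)
    (hT : 0 ≤ T) (hu : IsStrongSolution e lam B f T u) (hv : IsStrongSolution e lam B f T v)
    (h0 : u 0 = v 0) : EqOn u v (Icc 0 T) := by
  intro t ht
  obtain ⟨R, hR⟩ := isCompact_Icc.exists_bound_of_continuousOn (hv.isPrimitiveOn hT).continuousOn
  have hg : IntervalIntegrable (fun s => (C ^ 2 + 2 + 2 * R + 2 * K) *
      (1 + ‖diagOp e lam (u s)‖ ^ 2 + ‖diagOp e lam (v s)‖ ^ 2)) volume 0 T :=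
    ((intervalIntegrable_const.add (hu.intervalIntegrable_norm_diagOp_sq hT)).add
      (hv.intervalIntegrable_norm_diagOp_sq hT)).const_mul _
  have hgronwall := ((hu.isPrimitiveOn hT).sub (hv.isPrimitiveOn hT)).norm_sq_add_le_mul_exp
    (ε := 0) hg (by
      filter_upwards [ae_timeMeasure_iff.1 hu.mem_diagDomain,
        ae_timeMeasure_iff.1 hv.mem_diagDomain] with s hus hvs hs
      rw [add_zero]
      exact hB.two_mul_inner_constrainedRHS_sub_le hf (hus hs) (hvs hs)
        (hR s (Ioo_subset_Icc_self hs))) ht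
  rw [h0, sub_self, norm_zero, zero_pow two_ne_zero, add_zero, add_zero, zero_mul] at hgronwall
  exact sub_eq_zero.1 (norm_eq_zero.1 (pow_eq_zero_iff two_ne_zero |>.1
    (hgronwall.antisymm (sq_nonneg _))))

theorem mono {S : ℝ} (hu : IsStrongSolution e lam B f T u) (h : S ≤ T) :
    IsStrongSolution e lam B f S u where
  mem_diagDomain := ae_mono (timeMeasure_mono h) hu.mem_diagDomain
  memLp_diagOp := hu.memLp_diagOp.mono_measure (timeMeasure_mono h)
  memLp_constrainedRHS := hu.memLp_constrainedRHS.mono_measure (timeMeasure_mono h)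
  eq_add_integral t ht := hu.eq_add_integral t ⟨ht.1, ht.2.trans h⟩

theorem congr (hu : IsStrongSolution e lam B f T u) (h : EqOn v u (Icc 0 T)) :
    IsStrongSolution e lam B f T v where
  mem_diagDomain := by
    filter_upwards [hu.mem_diagDomain, ae_timeMeasure_of_Icc h] with t ht hvu
    rwa [hvu]
  memLp_diagOp := (memLp_congr_ae (ae_timeMeasure_of_Icc fun t ht => by rw [h ht])).1
    hu.memLp_diagOp
  memLp_constrainedRHS := (memLp_congr_ae (ae_timeMeasure_of_Icc fun t ht => by rw [h ht])).1
    hu.memLp_constrainedRHS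
  eq_add_integral t ht := by
    have hintegral : ∫ s in 0..t, constrainedRHS e lam B f (v s)
        = ∫ s in 0..t, constrainedRHS e lam B f (u s) :=
      intervalIntegral.integral_congr fun s hs => by
        rw [uIcc_of_le ht.1] at hs
        simp only [h ⟨hs.1, hs.2.trans ht.2⟩]
    rw [h ht, h ⟨le_rfl, ht.1.trans ht.2⟩, hu.eq_add_integral t ht, hintegral]

end IsStrongSolution

end StrongSolution

/-! ### Limits of Galerkin approximations -/

section Limit

variable {ι E : Type*} [NormedAddCommGroup E] [InnerProductSpace ℝ E]
  {e : HilbertBasis ι ℝ E} {lam : ι → ℝ} {B : E → E → E} {C : ℝ} {f : E → E} {K : ℝ≥0}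
  {T Y Z : ℝ} {F : ℕ → Finset ι} {un : ℕ → ℝ → E} {u : ℝ → E}

theorem energy_le_of_sum_le {x : E} (hx : x ∈ diagDomain e lam)
    (h : ∀ S : Finset ι, ∑ k ∈ S, lam k * ⟪e k, x⟫_ℝ ^ 2 ≤ Y) : energy e lam x ≤ Y :=
  hasSum_le_of_sum_le (hasSum_energy hx) h

open Filter Topology in
theorem sum_le_of_tendsto_of_energy_le (hlam : ∀ k, 0 ≤ lam k) {xn : ℕ → E} {x : E}
    (hxn : ∀ n, xn n ∈ diagDomain e lam) (hY : ∀ n, energy e lam (xn n) ≤ Y)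
    (hlim : Tendsto xn atTop (𝓝 x)) (S : Finset ι) :
    ∑ k ∈ S, lam k * ⟪e k, x⟫_ℝ ^ 2 ≤ Y :=
  le_of_tendsto
    (tendsto_finsetSum S fun k _ => ((tendsto_const_nhds.inner hlim).pow 2).const_mul (lam k))
    (Eventually.of_forall fun n => (sum_le_hasSum S
      (fun k _ => mul_nonneg (hlam k) (sq_nonneg _)) (hasSum_energy (hxn n))).trans (hY n))

open Filter Topology

theorem lintegral_diagNormSq_le_of_isGalerkin_of_tendsto [Countable ι] (hT : 0 ≤ T)
    (hun : ∀ n, IsGalerkin e lam B f (F n) T (un n))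
    (hZ : ∀ n, ∫ s in 0..T, ‖diagOp e lam (un n s)‖ ^ 2 ≤ Z)
    (hlim : ∀ t ∈ Icc 0 T, Tendsto (fun n => un n t) atTop (𝓝 (u t))) :
    ∫⁻ t, diagNormSq e lam (u t) ∂timeMeasure T ≤ ENNReal.ofReal Z := by
  refine lintegral_diagNormSq_le_of_tendsto
    (fun n => aestronglyMeasurable_of_continuousOn (hun n).continuousOn)
    (ae_timeMeasure_of_Icc hlim) fun n => ?_
  rw [lintegral_diagNormSq_eq (ae_timeMeasure_of_Icc fun t ht => (hun n).mem_diagDomain ht)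
    (integrable_timeMeasure_of_continuousOn ((hun n).continuousOn_diagOp.norm.pow 2)),
    integral_timeMeasure hT]
  exact ENNReal.ofReal_le_ofReal (hZ n)

theorem integral_timeMeasure_const_add_add_le (hT : 0 ≤ T) {t c : ℝ} (ht : t ≤ T) (hc : 0 ≤ c)
    {g h : ℝ → ℝ} (hg₀ : ∀ s, 0 ≤ g s) (hh₀ : ∀ s, 0 ≤ h s) (hg : Integrable g (timeMeasure T))
    (hh : Integrable h (timeMeasure T)) :
    ∫ s, c + g s + h s ∂timeMeasure t
      ≤ c * T + ∫ s, g s ∂timeMeasure T + ∫ s, h s ∂timeMeasure T := by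
  have hcint : Integrable (fun _ : ℝ => c) (timeMeasure T) := integrable_const c
  have hcg : Integrable (fun s => c + g s) (timeMeasure T) := hcint.add hg
  calc ∫ s, c + g s + h s ∂timeMeasure t ≤ ∫ s, c + g s + h s ∂timeMeasure T :=
        integral_mono_measure (timeMeasure_mono ht)
          (Eventually.of_forall fun s => add_nonneg (add_nonneg hc (hg₀ s)) (hh₀ s)) (hcg.add hh)
    _ = c * T + ∫ s, g s ∂timeMeasure T + ∫ s, h s ∂timeMeasure T := by
        rw [integral_add hcg hh, integral_add hcint hg, integral_timeMeasure hT,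
          intervalIntegral.integral_const, sub_zero, smul_eq_mul, mul_comm]

/- The coordinates of the right-hand side are Lipschitz in `u` with a constant that grows only
linearly in `A u`, so bounded dissipation and uniform convergence suffice to pass to the limit. -/
theorem IsConvection.tendsto_integral_coord_constrainedRHS (hB : IsConvection e lam B C)
    (hf : LipschitzWith K f) (hT : 0 ≤ T) (hun : ∀ n, IsGalerkin e lam B f (F n) T (un n))
    (hZ : ∀ n, ∫ s in 0..T, ‖diagOp e lam (un n s)‖ ^ 2 ≤ Z)
    (hlim : TendstoUniformlyOn un u atTop (Icc 0 T)) (hnorm : ∀ t ∈ Icc 0 T, ‖u t‖ = 1)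
    (hmem : ∀ᵐ t ∂timeMeasure T, u t ∈ diagDomain e lam)
    (hA : MemLp (fun t => diagOp e lam (u t)) 2 (timeMeasure T))
    (hR : MemLp (fun t => constrainedRHS e lam B f (u t)) 2 (timeMeasure T)) (k : ι) {t : ℝ}
    (ht : t ∈ Icc 0 T) :
    Tendsto (fun n => ∫ s in 0..t, ⟪e k, constrainedRHS e lam B f (un n s)⟫_ℝ) atTop
      (𝓝 (∫ s in 0..t, ⟪e k, constrainedRHS e lam B f (u s)⟫_ℝ)) := by
  obtain ⟨c, hc0, hc⟩ := hB.exists_abs_coord_constrainedRHS_sub_le hf k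
  have hle := timeMeasure_mono ht.2
  have hAn n : Integrable (fun s => ‖diagOp e lam (un n s)‖ ^ 2) (timeMeasure T) :=
    integrable_timeMeasure_of_continuousOn ((hun n).continuousOn_diagOp.norm.pow 2)
  have hA₁ : Integrable (fun s => ‖diagOp e lam (u s)‖) (timeMeasure T) :=
    hA.norm.integrable one_le_two
  have hg n : Integrable (fun s => c * (2 + ‖diagOp e lam (un n s)‖ ^ 2 + ‖diagOp e lam (u s)‖))
      (timeMeasure T) := (((integrable_const _).add (hAn n)).add hA₁).const_mul c
  simp only [← integral_timeMeasure ht.1]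
  refine tendsto_integral_of_norm_sub_le_mul
    (W := c * (2 * T + Z + ∫ s, ‖diagOp e lam (u s)‖ ∂timeMeasure T))
    (fun n => (integrable_timeMeasure_of_continuousOn (continuousOn_const.inner
      ((hun n).continuousOn_constrainedRHS hB hf))).mono_measure hle)
    ((hR.integrable one_le_two).const_inner (e k) |>.mono_measure hle)
    (fun n => (hg n).mono_measure hle) (fun n => ?_) fun δ hδ => ?_
  · rw [integral_const_mul]
    refine mul_le_mul_of_nonneg_left ((integral_timeMeasure_const_add_add_le hT ht.2 zero_le_two
      (fun s => sq_nonneg _) (fun s => norm_nonneg _) (hAn n) hA₁).trans ?_) hc0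
    rw [integral_timeMeasure hT (fun s => ‖diagOp e lam (un n s)‖ ^ 2)]
    gcongr
    exact hZ n
  · filter_upwards [Metric.tendstoUniformlyOn_iff.1 hlim δ hδ] with n hn
    filter_upwards [ae_mono hle hmem, ae_timeMeasure_of_Icc (p := (· ∈ Icc 0 t)) fun s hs => hs]
      with s hs hst
    have hsT : s ∈ Icc 0 T := ⟨hst.1, hst.2.trans ht.2⟩
    rw [← inner_sub_right, Real.norm_eq_abs]
    refine (hc _ ((hun n).mem_diagDomain hsT) _ hs ((hun n).norm_eq s hsT).le
      (hnorm s hsT).le).trans ?_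
    have hdist : ‖un n s - u s‖ ≤ δ := (dist_eq_norm' (u s) (un n s)).symm.trans_le (hn s hsT).le
    have hsq : 1 + ‖diagOp e lam (un n s)‖ ≤ 2 + ‖diagOp e lam (un n s)‖ ^ 2 := by
      nlinarith [sq_nonneg (‖diagOp e lam (un n s)‖ - 1)]
    rw [mul_comm δ]
    gcongr

theorem IsConvection.eq_add_integral_of_tendsto [CompleteSpace E] (hB : IsConvection e lam B C)
    (hf : LipschitzWith K f) (hun : ∀ n, IsGalerkin e lam B f (F n) T (un n))
    (hF : ∀ k, ∀ᶠ n in atTop, k ∈ F n) {t : ℝ} (ht : t ∈ Icc 0 T)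
    (hlim₀ : Tendsto (fun n => un n 0) atTop (𝓝 (u 0)))
    (hlim : Tendsto (fun n => un n t) atTop (𝓝 (u t)))
    (hint : IntervalIntegrable (fun s => constrainedRHS e lam B f (u s)) volume 0 t)
    (hcoord : ∀ k, Tendsto (fun n => ∫ s in 0..t, ⟪e k, constrainedRHS e lam B f (un n s)⟫_ℝ)
      atTop (𝓝 (∫ s in 0..t, ⟪e k, constrainedRHS e lam B f (u s)⟫_ℝ))) :
    u t = u 0 + ∫ s in 0..t, constrainedRHS e lam B f (u s) := by
  refine ext_coord e fun k => ?_
  have hinner {h : ℝ → E} (hh : IntervalIntegrable h volume 0 t) :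
      ⟪e k, ∫ s in 0..t, h s⟫_ℝ = ∫ s in 0..t, ⟪e k, h s⟫_ℝ :=
    ((innerSL ℝ (e k)).intervalIntegral_comp_comm hh).symm
  have heq : ∀ᶠ n in atTop, ⟪e k, un n 0⟫_ℝ
      + ∫ s in 0..t, ⟪e k, constrainedRHS e lam B f (un n s)⟫_ℝ = ⟪e k, un n t⟫_ℝ := by
    filter_upwards [hF k] with n hn
    have hprim := (hun n).isPrimitiveOn hB hf (ht.1.trans ht.2)
    rw [hprim.eq_add_integral t ht, inner_add_right,
      hinner (hprim.intervalIntegrable_of_mem ⟨le_rfl, ht.1.trans ht.2⟩ ht)]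
    simp only [coord_trunc_of_mem e _ hn]
  rw [inner_add_right, hinner hint]
  exact tendsto_nhds_unique (tendsto_const_nhds.inner hlim)
    (((tendsto_const_nhds.inner hlim₀).add (hcoord k)).congr' heq)

theorem IsConvection.isStrongSolution_of_tendstoUniformlyOn [CompleteSpace E] [Countable ι]
    (hB : IsConvection e lam B C) (hf : LipschitzWith K f) (hT : 0 ≤ T)
    (hun : ∀ n, IsGalerkin e lam B f (F n) T (un n)) (hF : ∀ k, ∀ᶠ n in atTop, k ∈ F n)
    (hY : ∀ n, ∀ t ∈ Icc 0 T, energy e lam (un n t) ≤ Y)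
    (hZ : ∀ n, ∫ s in 0..T, ‖diagOp e lam (un n s)‖ ^ 2 ≤ Z)
    (hlim : TendstoUniformlyOn un u atTop (Icc 0 T)) : IsStrongSolution e lam B f T u := by
  have hpt t (ht : t ∈ Icc 0 T) : Tendsto (fun n => un n t) atTop (𝓝 (u t)) := hlim.tendsto_at ht
  have hmeas : AEStronglyMeasurable u (timeMeasure T) := aestronglyMeasurable_of_continuousOn
    (hlim.continuousOn (Frequently.of_forall fun n => (hun n).continuousOn))
  have hnorm t (ht : t ∈ Icc 0 T) : ‖u t‖ = 1 :=
    tendsto_nhds_unique (hpt t ht).norm (by simp [fun n => (hun n).norm_eq t ht])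
  have hfin : ∫⁻ t, diagNormSq e lam (u t) ∂timeMeasure T ≠ ⊤ :=
    ((lintegral_diagNormSq_le_of_isGalerkin_of_tendsto hT hun hZ hpt).trans_lt
      ENNReal.ofReal_lt_top).ne
  have hmem := ae_mem_diagDomain_of_lintegral_ne_top hmeas hfin
  have hA := memLp_diagOp_of_lintegral_ne_top hmeas hfin
  have henergy : ∀ᵐ t ∂timeMeasure T, energy e lam (u t) ≤ Y := by
    filter_upwards [hmem, ae_timeMeasure_of_Icc hpt, ae_timeMeasure_of_Icc
      (p := (· ∈ Icc 0 T)) fun t ht => ht] with t hDt hlimt ht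
    exact energy_le_of_sum_le hDt (sum_le_of_tendsto_of_energy_le hB.zero_le
      (fun n => (hun n).mem_diagDomain ht) (fun n => hY n t ht) hlimt)
  have hR := hB.memLp_constrainedRHS hf hmeas hmem (ae_timeMeasure_of_Icc hnorm) henergy hA
  refine ⟨hmem, hA, hR, fun t ht => ?_⟩
  exact hB.eq_add_integral_of_tendsto hf hun hF ht (hpt 0 ⟨le_rfl, hT⟩) (hpt t ht)
    ((integrable_timeMeasure_iff ht.1).1 ((hR.mono_measure (timeMeasure_mono ht.2)).integrable
      one_le_two))
    fun k => hB.tendsto_integral_coord_constrainedRHS hf hT hun hZ hlim hnorm hmem hA hR k ht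

end Limit

/-! ### Global existence of strong solutions -/

section Existence

variable {ι E : Type*} [NormedAddCommGroup E] [InnerProductSpace ℝ E]
  {e : HilbertBasis ι ℝ E} {lam : ι → ℝ} {B : E → E → E} {C : ℝ} {f : E → E} {K : ℝ≥0} {u₀ : E}

theorem norm_inv_norm_smul_sub_le {p : E} (hu₀ : ‖u₀‖ = 1) (hp : p ≠ 0) :
    ‖‖p‖⁻¹ • p - p‖ ≤ ‖p - u₀‖ := by
  have hp' : 0 < ‖p‖ := norm_pos_iff.2 hp
  have hsmul : ‖p‖⁻¹ • p - p = ((‖u₀‖ - ‖p‖) * ‖p‖⁻¹) • p := by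
    rw [hu₀, sub_mul, one_mul, mul_inv_cancel₀ hp'.ne', sub_smul, one_smul]
  rw [hsmul, norm_smul, norm_mul, norm_inv, norm_norm, mul_assoc, inv_mul_cancel₀ hp'.ne',
    mul_one, Real.norm_eq_abs, norm_sub_rev]
  exact abs_norm_sub_norm_le u₀ p

section Trunc

variable {y₀ : ℝ} (hlam : ∀ k, 0 ≤ lam k) (hy₀ : HasSum (fun k => lam k * ⟪e k, u₀⟫_ℝ ^ 2) y₀)
include hlam hy₀

theorem norm_trunc_sub_le_of_hasSum {F : Finset ι} {r : ℝ} (hr : 0 < r)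
    (hF : ∀ k ∉ F, r ^ 2 ≤ lam k) : ‖trunc e F u₀ - u₀‖ ≤ √y₀ * r⁻¹ := by
  classical
  rw [← div_eq_mul_inv, le_div_iff₀ hr]
  refine Real.le_sqrt_of_sq_le ?_
  rw [mul_pow, mul_comm]
  refine hasSum_le (fun k => ?_) ((hasSum_coord_sq e _).mul_left (r ^ 2)) hy₀
  rw [inner_sub_right, coord_trunc]
  split_ifs with hk
  · simpa using mul_nonneg (hlam k) (sq_nonneg ⟪e k, u₀⟫_ℝ)
  · rw [zero_sub, neg_sq]
    exact mul_le_mul_of_nonneg_right (hF k hk) (sq_nonneg _)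

theorem energy_trunc_le_of_hasSum (F : Finset ι) : energy e lam (trunc e F u₀) ≤ y₀ := by
  classical
  refine hasSum_le (fun k => ?_) (hasSum_energy (trunc_mem_diagDomain F u₀)) hy₀
  rw [coord_trunc]
  refine mul_le_mul_of_nonneg_left ?_ (hlam k)
  split_ifs
  · rfl
  · simpa using sq_nonneg ⟪e k, u₀⟫_ℝ

theorem exists_unit_approx_of_hasSum (hu₀ : ‖u₀‖ = 1) {F : Finset ι} {r : ℝ}
    (hr : 0 < r) (hyr : 2 * √y₀ ≤ r) (hF : ∀ k ∉ F, r ^ 2 ≤ lam k) :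
    ∃ v : E, ‖v‖ = 1 ∧ (∀ k ∉ F, ⟪e k, v⟫_ℝ = 0) ∧ energy e lam v ≤ 4 * y₀ ∧
      ‖v - u₀‖ ≤ 2 * √y₀ * r⁻¹ := by
  have hmem := trunc_mem_diagDomain (e := e) (lam := lam) F u₀
  have hdist := norm_trunc_sub_le_of_hasSum hlam hy₀ hr hF
  have henergy := energy_trunc_le_of_hasSum hlam hy₀ F
  have henergy₀ := energy_nonneg hlam hmem
  set p := trunc e F u₀
  have hhalf : 1 / 2 ≤ ‖p‖ := by
    have hle : √y₀ * r⁻¹ ≤ 1 / 2 := by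
      rw [← div_eq_mul_inv, div_le_iff₀ hr]
      linarith
    have htri := norm_le_norm_add_norm_sub' u₀ p
    rw [norm_sub_rev, hu₀] at htri
    linarith
  have hpos : 0 < ‖p‖ := by linarith
  refine ⟨‖p‖⁻¹ • p, ?_, fun k hk => ?_, ?_, ?_⟩
  · rw [norm_smul, norm_inv, norm_norm, inv_mul_cancel₀ hpos.ne']
  · rw [inner_smul_right, coord_trunc_of_notMem _ _ hk, mul_zero]
  · have hinv : ‖p‖⁻¹ ≤ 2 := (inv_anti₀ one_half_pos hhalf).trans_eq (by norm_num)
    rw [energy_smul _ hmem]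
    calc ‖p‖⁻¹ ^ 2 * energy e lam p ≤ 2 ^ 2 * y₀ := by gcongr
      _ = 4 * y₀ := by norm_num
  · have htri := norm_sub_le_norm_sub_add_norm_sub (‖p‖⁻¹ • p) p u₀
    have hnormalize := norm_inv_norm_smul_sub_le hu₀ (norm_pos_iff.1 hpos)
    linarith

end Trunc

namespace IsConvection

open Filter Topology

theorem exists_isGalerkin_approx [CompleteSpace E] (hB : IsConvection e lam B C)
    (hf : LipschitzWith K f) (hfM : ∀ u, ‖u‖ = 1 → ⟪f u, u⟫_ℝ = 0) (hu₀ : ‖u₀‖ = 1) {y₀ : ℝ}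
    (hy₀ : HasSum (fun k => lam k * ⟪e k, u₀⟫_ℝ ^ 2) y₀) {T : ℝ} (hT : 0 ≤ T) :
    ∃ (F : ℕ → Finset ι) (un : ℕ → ℝ → E), (∀ r, ∀ᶠ n in atTop, ∀ k ∉ F n, r ≤ lam k) ∧
      (∀ n, IsGalerkin e lam B f (F n) T (un n)) ∧ (∀ n, energy e lam (un n 0) ≤ 4 * y₀) ∧
      Tendsto (fun n => un n 0) atTop (𝓝 u₀) := by
  set r : ℕ → ℝ := fun n => n + 1 + 2 * √y₀ with hr
  have hr_pos n : 0 < r n := by positivity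
  have hr_top : Tendsto r atTop atTop := by
    simp only [hr, add_assoc]
    exact tendsto_atTop_add_const_right _ _ tendsto_natCast_atTop_atTop
  choose F hF using fun n => hB.tail (r n ^ 2)
  choose v hv hvF hvE hvu₀ using fun n => exists_unit_approx_of_hasSum hB.zero_le hy₀ hu₀
    (hr_pos n) (by simp only [hr]; linarith [Nat.cast_nonneg (α := ℝ) n]) (hF n)
  choose un hun₀ hun using fun n => hB.exists_isGalerkin hf hfM (hv n) (hvF n) hT
  refine ⟨F, un, fun R => ?_, hun, fun n => hun₀ n ▸ hvE n, ?_⟩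
  · filter_upwards [((tendsto_pow_atTop two_ne_zero).comp hr_top).eventually_ge_atTop R]
      with n hn k hk using hn.trans (hF n k hk)
  · simp only [hun₀]
    rw [tendsto_iff_norm_sub_tendsto_zero]
    refine squeeze_zero (fun n => norm_nonneg _) hvu₀ ?_
    simpa using (tendsto_inv_atTop_zero.comp hr_top).const_mul (2 * √y₀)

theorem uniformCauchySeqOn_of_isGalerkin [CompleteSpace E] (hB : IsConvection e lam B C)
    (hf : LipschitzWith K f) {T Y Z : ℝ} {F : ℕ → Finset ι} {un : ℕ → ℝ → E}
    (hun : ∀ n, IsGalerkin e lam B f (F n) T (un n))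
    (hF : ∀ r, ∀ᶠ n in atTop, ∀ k ∉ F n, r ≤ lam k)
    (hY : ∀ n, ∀ t ∈ Icc 0 T, energy e lam (un n t) ≤ Y)
    (hZ : ∀ n, ∫ s in 0..T, ‖diagOp e lam (un n s)‖ ^ 2 ≤ Z)
    (h₀ : CauchySeq fun n => un n 0) : UniformCauchySeqOn un atTop (Icc 0 T) := by
  rw [Metric.uniformCauchySeqOn_iff]
  intro ε hε
  set D := Real.exp ((C ^ 2 + 4 + 2 * K + 4 * (√Y * (C * √Y + ‖f 0‖ + K))) * (T + 2 * Z))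
  have hD₀ : 0 < D := Real.exp_pos _
  set η := ε ^ 2 / (2 * D) with hη
  have hη₀ : 0 < η := by positivity
  obtain ⟨N₁, hN₁⟩ := Metric.cauchySeq_iff.1 h₀ √η (Real.sqrt_pos.2 hη₀)
  obtain ⟨N₂, hN₂⟩ := eventually_atTop.1 (hF (η⁻¹ ^ 2))
  refine ⟨max N₁ N₂, fun m hm n hn t ht => ?_⟩
  have hinit : ‖un m 0 - un n 0‖ ^ 2 < η := by
    rw [← Real.lt_sqrt (norm_nonneg _), ← dist_eq_norm]
    exact hN₁ m (le_of_max_le_left hm) n (le_of_max_le_left hn)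
  rw [dist_eq_norm]
  refine lt_of_pow_lt_pow_left₀ 2 hε.le ?_
  calc ‖un m t - un n t‖ ^ 2 ≤ (‖un m 0 - un n 0‖ ^ 2 + η⁻¹⁻¹) * D :=
        (hun m).norm_sub_sq_le (hun n) hB hf (inv_pos.2 hη₀) (hN₂ m (le_of_max_le_right hm))
          (hN₂ n (le_of_max_le_right hn)) (hY m) (hY n) (hZ m) (hZ n) ht
    _ < (η + η) * D := by
        rw [inv_inv]
        gcongr
    _ = ε ^ 2 := by
        rw [hη]
        field_simp
        ring

theorem exists_isStrongSolution [CompleteSpace E] [Countable ι] (hB : IsConvection e lam B C)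
    (hf : LipschitzWith K f) (hfM : ∀ u, ‖u‖ = 1 → ⟪f u, u⟫_ℝ = 0) (hu₀ : ‖u₀‖ = 1)
    (hV : Summable fun k => lam k * ⟪e k, u₀⟫_ℝ ^ 2) {T : ℝ} (hT : 0 ≤ T) :
    ∃ (u : ℝ → E) (Y : ℝ), u 0 = u₀ ∧ IsStrongSolution e lam B f T u ∧
      ∀ t ∈ Icc 0 T, ∀ S : Finset ι, ∑ k ∈ S, lam k * ⟪e k, u t⟫_ℝ ^ 2 ≤ Y := by
  obtain ⟨F, un, hF, hun, hE, h₀⟩ := hB.exists_isGalerkin_approx hf hfM hu₀ hV.hasSum hT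
  set Y := 4 * (∑' k, lam k * ⟪e k, u₀⟫_ℝ ^ 2) + (‖f 0‖ + K) ^ 2 * T
  have hE' n : energy e lam (un n 0) + (‖f 0‖ + K) ^ 2 * T ≤ Y := add_le_add_left (hE n) _
  have hY n t (ht : t ∈ Icc 0 T) : energy e lam (un n t) ≤ Y :=
    ((hun n).energy_le hB hf hfM ht).trans (hE' n)
  have hZ n := (hun n).integral_norm_diagOp_sq_le hB hf hfM hT (hE' n)
  have hcauchy := hB.uniformCauchySeqOn_of_isGalerkin hf hun hF hY hZ h₀.cauchySeq
  set u : ℝ → E := fun t => limUnder atTop fun n => un n t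
  have hu t (ht : t ∈ Icc 0 T) : Tendsto (fun n => un n t) atTop (𝓝 (u t)) :=
    (hcauchy.cauchySeq ht).tendsto_limUnder
  have hmode k : ∀ᶠ n in atTop, k ∈ F n := by
    filter_upwards [hF (lam k + 1)] with n hn
    by_contra hk
    linarith [hn k hk]
  exact ⟨u, Y, tendsto_nhds_unique (hu 0 ⟨le_rfl, hT⟩) h₀,
    hB.isStrongSolution_of_tendstoUniformlyOn hf hT hun hmode hY hZ
      (hcauchy.tendstoUniformlyOn_of_tendsto hu),
    fun t ht => sum_le_of_tendsto_of_energy_le hB.zero_le (fun n => (hun n).mem_diagDomain ht)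
      (fun n => hY n t ht) (hu t ht)⟩

theorem exists_global_isStrongSolution [CompleteSpace E] [Countable ι]
    (hB : IsConvection e lam B C) (hf : LipschitzWith K f)
    (hfM : ∀ u, ‖u‖ = 1 → ⟪f u, u⟫_ℝ = 0) (hu₀ : ‖u₀‖ = 1)
    (hV : Summable fun k => lam k * ⟪e k, u₀⟫_ℝ ^ 2) :
    ∃ u : ℝ → E, u 0 = u₀ ∧ ∀ T, 0 ≤ T → IsStrongSolution e lam B f T u ∧
      ∃ Y, ∀ t ∈ Icc 0 T, ∀ S : Finset ι, ∑ k ∈ S, lam k * ⟪e k, u t⟫_ℝ ^ 2 ≤ Y := by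
  choose U Y hU₀ hU hUY using fun n : ℕ =>
    hB.exists_isStrongSolution hf hfM hu₀ hV (Nat.cast_nonneg (α := ℝ) n)
  have hcoherent {m n : ℕ} (h : m ≤ n) : EqOn (U m) (U n) (Icc 0 m) :=
    (hU m).eqOn hB hf (Nat.cast_nonneg m) ((hU n).mono (Nat.cast_le.2 h)) (by rw [hU₀, hU₀])
  have hglue n : EqOn (fun t => U ⌈t⌉₊ t) (U n) (Icc 0 n) := fun t ht =>
    hcoherent (Nat.ceil_le.2 ht.2) ⟨ht.1, Nat.le_ceil t⟩
  refine ⟨fun t => U ⌈t⌉₊ t, by simp [hU₀], fun T _ => ?_⟩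
  have hsub : Icc 0 T ⊆ Icc 0 (⌈T⌉₊ : ℝ) := Icc_subset_Icc_right (Nat.le_ceil T)
  refine ⟨((hU ⌈T⌉₊).congr (hglue _)).mono (Nat.le_ceil T), Y ⌈T⌉₊, fun t ht S => ?_⟩
  simpa only [hglue ⌈T⌉₊ (hsub ht)] using hUY _ t (hsub ht) S

end IsConvection

end Existence
/-! ### Test functions on the torus -/

section TestFunctions

theorem proj_surjective : Function.Surjective proj := isOpenQuotientMap_proj.surjective

theorem proj_add_single (y : Fin 2 → ℝ) (i : Fin 2) (s : ℝ) :
    proj y + Pi.single i (s : UnitAddCircle) = proj (y + s • (Pi.single i 1 : Fin 2 → ℝ)) := by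
  funext j
  by_cases h : j = i
  · subst h; simp [proj]
  · simp [proj, h]

theorem single_add_coe (i : Fin 2) (s t : ℝ) :
    (Pi.single i ((s + t : ℝ) : UnitAddCircle) : T2)
      = Pi.single i (s : UnitAddCircle) + Pi.single i (t : UnitAddCircle) := by
  rw [← Pi.single_add, AddCircle.coe_add]

theorem IsTest.continuous {φ : T2 → ℝ} (hφ : IsTest φ) : Continuous φ := by
  rw [isOpenQuotientMap_proj.isQuotientMap.continuous_iff]
  exact ContDiff.continuous hφ

theorem IsTest.const (c : ℝ) : IsTest fun _ => c := contDiff_const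

theorem IsTest.add {φ ψ : T2 → ℝ} (hφ : IsTest φ) (hψ : IsTest ψ) : IsTest fun x => φ x + ψ x :=
  ContDiff.add hφ hψ

theorem IsTest.mul {φ ψ : T2 → ℝ} (hφ : IsTest φ) (hψ : IsTest ψ) : IsTest fun x => φ x * ψ x :=
  ContDiff.mul hφ hψ

theorem IsTest.sum {ι : Type*} {φ : ι → T2 → ℝ} (F : Finset ι) (hφ : ∀ k ∈ F, IsTest (φ k)) :
    IsTest fun x => ∑ k ∈ F, φ k x :=
  ContDiff.sum hφ

theorem IsTest.hasDerivAt {φ : T2 → ℝ} (hφ : IsTest φ) (i : Fin 2) (x : T2) :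
    HasDerivAt (fun s : ℝ => φ (x + Pi.single i (s : UnitAddCircle))) (pderiv i φ x) 0 := by
  obtain ⟨y, rfl⟩ := proj_surjective x
  unfold pderiv
  simp only [proj_add_single]
  refine DifferentiableAt.hasDerivAt ?_
  have hdiff : Differentiable ℝ (fun y : Fin 2 → ℝ => φ (proj y)) := hφ.differentiable (by simp)
  exact (hdiff.comp (g := fun y : Fin 2 → ℝ => φ (proj y))
    (f := fun s : ℝ => y + s • (Pi.single i 1 : Fin 2 → ℝ)) (by fun_prop)).differentiableAt

theorem IsTest.hasDerivAt_shift {φ : T2 → ℝ} (hφ : IsTest φ) (i : Fin 2) (x : T2) (s : ℝ) :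
    HasDerivAt (fun s : ℝ => φ (x + Pi.single i (s : UnitAddCircle)))
      (pderiv i φ (x + Pi.single i (s : UnitAddCircle))) s := by
  have h := hφ.hasDerivAt i (x + Pi.single i (s : UnitAddCircle))
  rw [← sub_self s] at h
  refine (h.comp_sub_const s s).congr_of_eventuallyEq (Filter.Eventually.of_forall fun t => ?_)
  simp only
  rw [add_assoc, ← single_add_coe, add_sub_cancel]

theorem pderiv_eq_of_hasDerivAt {φ : T2 → ℝ} {i : Fin 2} {x : T2} {c : ℝ}
    (h : HasDerivAt (fun s : ℝ => φ (x + Pi.single i (s : UnitAddCircle))) c 0) :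
    pderiv i φ x = c := h.deriv

theorem pderiv_mul {φ ψ : T2 → ℝ} (hφ : IsTest φ) (hψ : IsTest ψ) (i : Fin 2) (x : T2) :
    pderiv i (fun x => φ x * ψ x) x = pderiv i φ x * ψ x + φ x * pderiv i ψ x := by
  refine pderiv_eq_of_hasDerivAt ?_
  exact ((hφ.hasDerivAt i x).mul (hψ.hasDerivAt i x)).congr_deriv (by simp)

theorem pderiv_add {φ ψ : T2 → ℝ} (hφ : IsTest φ) (hψ : IsTest ψ) (i : Fin 2) (x : T2) :
    pderiv i (fun x => φ x + ψ x) x = pderiv i φ x + pderiv i ψ x :=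
  pderiv_eq_of_hasDerivAt ((hφ.hasDerivAt i x).add (hψ.hasDerivAt i x))

theorem pderiv_const_mul {φ : T2 → ℝ} (hφ : IsTest φ) (c : ℝ) (i : Fin 2) (x : T2) :
    pderiv i (fun x => c * φ x) x = c * pderiv i φ x :=
  pderiv_eq_of_hasDerivAt ((hφ.hasDerivAt i x).const_mul c)

theorem pderiv_sum {ι : Type*} {φ : ι → T2 → ℝ} (F : Finset ι) (hφ : ∀ k ∈ F, IsTest (φ k))
    (i : Fin 2) (x : T2) :
    pderiv i (fun x => ∑ k ∈ F, φ k x) x = ∑ k ∈ F, pderiv i (φ k) x := by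
  refine pderiv_eq_of_hasDerivAt ?_
  have h := HasDerivAt.sum fun k hk => (hφ k hk).hasDerivAt i x
  refine h.congr_of_eventuallyEq (Filter.Eventually.of_forall fun s => ?_)
  simp

theorem integrable_of_continuous {E : Type*} [NormedAddCommGroup E] {h : T2 → E}
    (hh : Continuous h) : Integrable h torusMeasure :=
  hh.integrable_of_hasCompactSupport (HasCompactSupport.of_compactSpace h)

theorem integral_pderiv {φ : T2 → ℝ} (hφ : IsTest φ) (i : Fin 2) :
    ∫ x, pderiv i φ x ∂torusMeasure = 0 := by
  obtain ⟨c, hc⟩ := (isCompact_range (continuous_pderiv i hφ)).isBounded.exists_norm_le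
  have hshift : ∀ s : ℝ, Continuous fun x : T2 => x + Pi.single i (s : UnitAddCircle) := fun s =>
    continuous_id.add continuous_const
  let Φ : ℝ → T2 → ℝ := fun s x => φ (x + Pi.single i (s : UnitAddCircle))
  let Φ' : ℝ → T2 → ℝ := fun s x => pderiv i φ (x + Pi.single i (s : UnitAddCircle))
  have hΦ : ∀ s, Continuous (Φ s) := fun s => hφ.continuous.comp (hshift s)
  have hΦ' : ∀ s, Continuous (Φ' s) := fun s => (continuous_pderiv i hφ).comp (hshift s)
  have h : HasDerivAt (fun s => ∫ x, Φ s x ∂torusMeasure) (∫ x, Φ' 0 x ∂torusMeasure) 0 :=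
    (hasDerivAt_integral_of_dominated_loc_of_deriv_le (μ := torusMeasure) (F := Φ) (x₀ := (0 : ℝ))
    (F' := Φ') (s := univ) (bound := fun _ => c) Filter.univ_mem
    (Filter.Eventually.of_forall fun s => (hΦ s).aestronglyMeasurable)
    (integrable_of_continuous (hΦ 0)) (hΦ' 0).aestronglyMeasurable
    (Filter.Eventually.of_forall fun x s _ => hc _ (mem_range_self _))
    (integrable_const c)
    (Filter.Eventually.of_forall fun x s _ => hφ.hasDerivAt_shift i x s)).2
  have hinv : (fun s => ∫ x, Φ s x ∂torusMeasure) = fun _ => ∫ x, φ x ∂torusMeasure :=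
    funext fun s => integral_add_right_eq_self φ _
  rw [hinv] at h
  simpa [Φ'] using h.unique (hasDerivAt_const (0 : ℝ) _)

theorem integral_mul_pderiv {φ ψ : T2 → ℝ} (hφ : IsTest φ) (hψ : IsTest ψ) (i : Fin 2) :
    ∫ x, ψ x * pderiv i φ x ∂torusMeasure = -∫ x, pderiv i ψ x * φ x ∂torusMeasure := by
  have h := integral_pderiv (hψ.mul hφ) i
  simp only [pderiv_mul hψ hφ] at h
  rw [integral_add] at h
  · linarith
  · exact integrable_of_continuous ((continuous_pderiv i hψ).mul hφ.continuous)
  · exact integrable_of_continuous (hψ.continuous.mul (continuous_pderiv i hφ))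

end TestFunctions

/-! ### The Hartley functions `cos (2π k·x) + sin (2π k·x)` -/

section Hartley

open UnitAddTorus

/-- The Hartley function `cos (2π k·x) + sin (2π k·x)`. These functions replace the characters
`exp (2π i k·x)`: they form an orthonormal basis of the real space `L²(𝕋²)`, and differentiation
only multiplies by a real factor and reflects the frequency. -/
def hartley (k : Fin 2 → ℤ) (x : T2) : ℝ := (mFourier k x).re + (mFourier k x).im

theorem continuous_hartley (k : Fin 2 → ℤ) : Continuous (hartley k) :=
  (Complex.continuous_re.comp (mFourier k).continuous).add
    (Complex.continuous_im.comp (mFourier k).continuous)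

theorem abs_hartley_le (k : Fin 2 → ℤ) (x : T2) : |hartley k x| ≤ 2 := by
  have h : ‖mFourier k x‖ ≤ 1 := ((mFourier k).norm_coe_le_norm x).trans mFourier_norm.le
  have hre := (Complex.abs_re_le_norm (mFourier k x)).trans h
  have him := (Complex.abs_im_le_norm (mFourier k x)).trans h
  exact (abs_add_le _ _).trans (by linarith)

theorem hartley_neg (k : Fin 2 → ℤ) (x : T2) :
    hartley (-k) x = (mFourier k x).re - (mFourier k x).im := by
  simp [hartley, mFourier_neg, sub_eq_add_neg]

theorem hartley_mul_hartley (k l : Fin 2 → ℤ) (x : T2) :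
    hartley k x * hartley l x = (mFourier (k + -l) x).re + (mFourier (k + l) x).im := by
  rw [mFourier_add, mFourier_add, mFourier_neg]
  simp only [hartley, Complex.mul_re, Complex.mul_im, Complex.conj_re, Complex.conj_im]
  ring

theorem mFourier_proj (k : Fin 2 → ℤ) (y : Fin 2 → ℝ) :
    mFourier k (proj y) = Complex.exp (∑ j, 2 * Real.pi * Complex.I * k j * y j) := by
  simp only [mFourier, ContinuousMap.coe_mk, proj, fourier_coe_apply, Complex.exp_sum,
    Complex.ofReal_one, div_one]

theorem isTest_hartley (k : Fin 2 → ℤ) : IsTest (hartley k) := by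
  have h : ContDiff ℝ ∞ fun y : Fin 2 → ℝ =>
      Complex.exp (∑ j, 2 * Real.pi * Complex.I * k j * y j) := by
    refine ContDiff.cexp (ContDiff.sum fun j _ => contDiff_const.mul ?_)
    exact Complex.ofRealCLM.contDiff.comp (contDiff_apply ℝ ℝ j)
  unfold IsTest hartley
  simp only [mFourier_proj]
  exact (Complex.reCLM.contDiff.comp h).add (Complex.imCLM.contDiff.comp h)

theorem mFourier_add_single (k : Fin 2 → ℤ) (x : T2) (i : Fin 2) (s : ℝ) :
    mFourier k (x + Pi.single i (s : UnitAddCircle))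
      = mFourier k x * Complex.exp (2 * Real.pi * Complex.I * k i * s) := by
  obtain ⟨y, rfl⟩ := proj_surjective x
  rw [proj_add_single, mFourier_proj, mFourier_proj, ← Complex.exp_add]
  congr 1
  simp only [Pi.add_apply, Pi.smul_apply, smul_eq_mul, Complex.ofReal_add, mul_add,
    Finset.sum_add_distrib]
  congr 1
  rw [Finset.sum_eq_single i]
  · simp
  · intro j _ hj
    simp [hj]
  · simp

theorem pderiv_hartley (k : Fin 2 → ℤ) (i : Fin 2) (x : T2) :
    pderiv i (hartley k) x = 2 * Real.pi * k i * hartley (-k) x := by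
  refine pderiv_eq_of_hasDerivAt ?_
  have h : HasDerivAt (fun s : ℝ => mFourier k (x + Pi.single i (s : UnitAddCircle)))
      (mFourier k x * (2 * Real.pi * Complex.I * k i)) 0 := by
    simp only [mFourier_add_single]
    have hlin : HasDerivAt (fun s : ℝ => 2 * Real.pi * Complex.I * k i * (s : ℂ))
        (2 * Real.pi * Complex.I * k i * 1) 0 :=
      (Complex.ofRealCLM.hasDerivAt (x := (0 : ℝ))).const_mul _
    simpa using hlin.cexp.const_mul (mFourier k x)
  have hre := Complex.reCLM.hasFDerivAt.comp_hasDerivAt (0 : ℝ) h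
  have him := Complex.imCLM.hasFDerivAt.comp_hasDerivAt (0 : ℝ) h
  refine (hre.add him).congr_deriv ?_
  rw [hartley_neg]
  simp only [Complex.reCLM_apply, Complex.mul_re, Complex.re_ofNat, Complex.ofReal_re,
    Complex.im_ofNat, Complex.ofReal_im, mul_zero, sub_zero, Complex.I_re, Complex.mul_im, zero_mul,
    add_zero, Complex.I_im, mul_one, sub_self, Complex.intCast_re, Complex.intCast_im, zero_add,
    zero_sub, Complex.imCLM_apply]
  ring

theorem integral_mFourier (k : Fin 2 → ℤ) :
    ∫ x, mFourier k x ∂torusMeasure = if k = 0 then 1 else 0 := by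
  have h := orthonormal_iff_ite.1 (orthonormal_mFourier (d := Fin 2)) 0 k
  simp only [ContinuousMap.inner_toLp, mFourier_zero, ContinuousMap.one_apply, map_one,
    mul_one] at h
  exact h.trans (if_congr eq_comm rfl rfl)

theorem integral_hartley_mul_hartley (k l : Fin 2 → ℤ) :
    ∫ x, hartley k x * hartley l x ∂torusMeasure = if k = l then 1 else 0 := by
  have hint : ∀ k : Fin 2 → ℤ, Integrable (fun x => mFourier k x) torusMeasure := fun k =>
    integrable_of_continuous (mFourier k).continuous
  have hre : Integrable (fun x => (mFourier (k + -l) x).re) torusMeasure := (hint _).re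
  have him : Integrable (fun x => (mFourier (k + l) x).im) torusMeasure := (hint _).im
  have hre_eq := integral_re (hint (k + -l))
  have him_eq := integral_im (hint (k + l))
  simp only [RCLike.re_to_complex, RCLike.im_to_complex, integral_mFourier] at hre_eq him_eq
  have hkl : k + -l = 0 ↔ k = l := by rw [← sub_eq_add_neg, sub_eq_zero]
  simp only [hartley_mul_hartley]
  rw [integral_add hre him, hre_eq, him_eq]
  simp only [hkl]
  split_ifs <;> simp

theorem mFourier_neg_eq_hartley (k : Fin 2 → ℤ) (x : T2) :
    mFourier (-k) x
      = hartley k x * ((1 - Complex.I) / 2) + hartley (-k) x * ((1 + Complex.I) / 2) := by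
  rw [mFourier_neg, hartley_neg, hartley]
  apply Complex.ext
  · simp only [Complex.conj_re, Complex.ofReal_add, Complex.ofReal_sub, Complex.add_re,
      Complex.mul_re, Complex.ofReal_re, Complex.div_ofNat_re, Complex.sub_re, Complex.one_re,
      Complex.I_re, sub_zero, one_div, Complex.add_im, Complex.ofReal_im, add_zero,
      Complex.div_ofNat_im, Complex.sub_im, Complex.one_im, Complex.I_im, zero_sub, zero_mul,
      sub_self, zero_add]
    ring
  · simp only [Complex.conj_im, Complex.ofReal_add, Complex.ofReal_sub, Complex.add_im,
      Complex.mul_im, Complex.add_re, Complex.ofReal_re, Complex.div_ofNat_im, Complex.sub_im,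
      Complex.one_im, Complex.I_im, zero_sub, Complex.ofReal_im, add_zero, Complex.div_ofNat_re,
      Complex.sub_re, Complex.one_re, Complex.I_re, sub_zero, one_div, zero_mul, zero_add, sub_self]
    ring

theorem integral_mFourier_smul_eq_zero {g : T2 → ℝ} (hg : Integrable g torusMeasure)
    (h : ∀ k, ∫ x, hartley k x * g x ∂torusMeasure = 0) (k : Fin 2 → ℤ) :
    ∫ x, mFourier (-k) x • (g x : ℂ) ∂torusMeasure = 0 := by
  have hint : ∀ l, Integrable (fun x => hartley l x * g x) torusMeasure := fun l =>
    hg.bdd_mul (continuous_hartley l).aestronglyMeasurable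
      (Filter.Eventually.of_forall (abs_hartley_le l))
  have hsplit : ∀ x, mFourier (-k) x • (g x : ℂ)
      = ((hartley k x * g x : ℝ) : ℂ) * ((1 - Complex.I) / 2)
        + ((hartley (-k) x * g x : ℝ) : ℂ) * ((1 + Complex.I) / 2) := by
    intro x
    rw [mFourier_neg_eq_hartley]
    push_cast
    rw [smul_eq_mul]
    ring
  simp only [hsplit]
  rw [integral_add ((hint k).ofReal.mul_const _) ((hint (-k)).ofReal.mul_const _),
    integral_mul_const, integral_mul_const, integral_complex_ofReal, integral_complex_ofReal, h, h]
  simp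

theorem ae_eq_zero_of_integral_hartley {g : T2 → ℝ} (hg : MemLp g 2 torusMeasure)
    (h : ∀ k, ∫ x, hartley k x * g x ∂torusMeasure = 0) : g =ᵐ[torusMeasure] 0 := by
  have hgC : MemLp (fun x => (g x : ℂ)) 2 torusMeasure := hg.ofReal
  set G : Lp ℂ 2 torusMeasure := hgC.toLp _
  have hGg : (G : T2 → ℂ) =ᵐ[torusMeasure] fun x => (g x : ℂ) := hgC.coeFn_toLp
  have hrepr : ∀ k, (mFourierBasis (d := Fin 2)).repr G k = 0 := by
    intro k
    rw [mFourierBasis_repr]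
    refine Eq.trans (integral_congr_ae ?_)
      (integral_mFourier_smul_eq_zero (hg.integrable one_le_two) h k)
    filter_upwards [hGg] with x hx
    rw [hx]
  have hG : G = 0 := by
    apply (mFourierBasis (d := Fin 2)).repr.injective
    ext k
    rw [hrepr k, map_zero]
    rfl
  filter_upwards [hGg, Lp.coeFn_zero ℂ 2 torusMeasure] with x hx hzero
  rw [hG, hzero] at hx
  simpa using hx.symm

end Hartley
/-! ### Fourier analysis of vector fields -/

section FourierL2

theorem memLp_component (u : L2) (j : Fin 2) : MemLp (fun x => u x j) 2 torusMeasure :=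
  (EuclideanSpace.proj (𝕜 := ℝ) j).comp_memLp' (Lp.memLp u)

theorem integrable_component (u : L2) (j : Fin 2) :
    Integrable (fun x => u x j) torusMeasure :=
  (memLp_component u j).integrable one_le_two

theorem integrable_mul_component (u : L2) (j : Fin 2) {φ : T2 → ℝ} (hφ : Continuous φ) :
    Integrable (fun x => φ x * u x j) torusMeasure := by
  obtain ⟨c, hc⟩ := (isCompact_range hφ).isBounded.exists_norm_le
  exact (integrable_component u j).bdd_mul (c := c) hφ.aestronglyMeasurable
    (Filter.Eventually.of_forall fun x => hc _ (mem_range_self x))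

theorem integrable_smul_field (u : L2) {φ : T2 → ℝ} (hφ : Continuous φ) :
    Integrable (fun x => φ x • u x) torusMeasure := by
  obtain ⟨c, hc⟩ := (isCompact_range hφ).isBounded.exists_norm_le
  exact ((Lp.memLp u).integrable (by norm_num)).bdd_smul c hφ.aestronglyMeasurable
    (Filter.Eventually.of_forall fun x => hc _ (mem_range_self x))

theorem integral_apply {h : T2 → R2} (hh : Integrable h torusMeasure) (j : Fin 2) :
    (∫ x, h x ∂torusMeasure) j = ∫ x, h x j ∂torusMeasure :=
  ((EuclideanSpace.proj (𝕜 := ℝ) j).integral_comp_comm hh).symm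

theorem integral_smul_field_apply (u : L2) {φ : T2 → ℝ} (hφ : Continuous φ) (j : Fin 2) :
    (∫ x, φ x • u x ∂torusMeasure) j = ∫ x, φ x * u x j ∂torusMeasure := by
  rw [integral_apply (integrable_smul_field u hφ)]
  simp

/-- The field with `j`-th component `φ` and the other component zero, as an element of `L²`. -/
def componentField (j : Fin 2) (φ : T2 → ℝ) (hφ : Continuous φ) : L2 :=
  ContinuousMap.toLp 2 torusMeasure ℝ
    ⟨fun x => EuclideanSpace.single j (φ x), by
      refine (PiLp.continuous_toLp 2 _).comp (continuous_pi fun l => ?_)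
      by_cases h : l = j
      · subst h; simpa using hφ
      · simpa [h] using continuous_const⟩

theorem coeFn_componentField (j : Fin 2) {φ : T2 → ℝ} (hφ : Continuous φ) :
    componentField j φ hφ =ᵐ[torusMeasure] fun x => EuclideanSpace.single j (φ x) :=
  ContinuousMap.coeFn_toLp torusMeasure _

theorem inner_componentField (j : Fin 2) {φ : T2 → ℝ} (hφ : Continuous φ) (u : L2) :
    ⟪componentField j φ hφ, u⟫_ℝ = ∫ x, φ x * u x j ∂torusMeasure := by
  rw [L2.inner_def]
  refine integral_congr_ae ?_
  filter_upwards [coeFn_componentField j hφ] with x hx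
  rw [hx, EuclideanSpace.inner_single_left]
  simp

/-- The Hartley coefficients of a vector field: the inner product of its `j`-th component with
`hartley k`. -/
def hartleyCoeff (u : L2) (k : Fin 2 → ℤ) (j : Fin 2) : ℝ := ∫ x, hartley k x * u x j ∂torusMeasure

theorem hartleyCoeff_componentField (j : Fin 2) {φ : T2 → ℝ} (hφ : Continuous φ) (k : Fin 2 → ℤ)
    (m : Fin 2) :
    hartleyCoeff (componentField j φ hφ) k m
      = if m = j then ∫ x, hartley k x * φ x ∂torusMeasure else 0 := by
  have h : hartleyCoeff (componentField j φ hφ) k m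
      = ∫ x, hartley k x * (EuclideanSpace.single j (φ x) : R2) m ∂torusMeasure := by
    refine integral_congr_ae ?_
    filter_upwards [coeFn_componentField j hφ] with x hx
    rw [hx]
  rw [h]
  split_ifs with hm
  · subst hm; simp
  · simp [hm]

theorem orthonormal_componentField_hartley : Orthonormal ℝ
    fun p : (Fin 2 → ℤ) × Fin 2 => componentField p.2 (hartley p.1) (continuous_hartley p.1) := by
  rw [orthonormal_iff_ite]
  rintro ⟨k, j⟩ ⟨l, m⟩
  rw [inner_componentField]
  refine (hartleyCoeff_componentField m (continuous_hartley l) k j).trans ?_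
  rw [integral_hartley_mul_hartley]
  simp only [Prod.mk.injEq, ← ite_and, and_comm]

theorem eq_zero_of_hartleyCoeff {u : L2} (h : ∀ k j, hartleyCoeff u k j = 0) : u = 0 := by
  have h0 : ∀ j, (fun x => u x j) =ᵐ[torusMeasure] 0 := fun j =>
    ae_eq_zero_of_integral_hartley (memLp_component u j) fun k => h k j
  refine Lp.ext ?_
  filter_upwards [h0 0, h0 1, Lp.coeFn_zero R2 2 torusMeasure] with x hx₀ hx₁ hzero
  rw [hzero]
  ext j
  fin_cases j
  · exact hx₀
  · exact hx₁

theorem orthogonal_span_hartley : (Submodule.span ℝ (range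
    fun p : (Fin 2 → ℤ) × Fin 2 => componentField p.2 (hartley p.1) (continuous_hartley p.1)))ᗮ
      = ⊥ := by
  rw [Submodule.eq_bot_iff]
  intro u hu
  refine eq_zero_of_hartleyCoeff fun k j => ?_
  have := (Submodule.mem_orthogonal _ u).1 hu _ (Submodule.subset_span ⟨(k, j), rfl⟩)
  rwa [inner_componentField] at this

/-- The basis of `L²(𝕋², ℝ²)` consisting of the fields with one component a Hartley function and
the other component zero. -/
def hartleyBasis : HilbertBasis ((Fin 2 → ℤ) × Fin 2) ℝ L2 :=
  HilbertBasis.mkOfOrthogonalEqBot orthonormal_componentField_hartley orthogonal_span_hartley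

theorem inner_hartleyBasis (p : (Fin 2 → ℤ) × Fin 2) (u : L2) :
    ⟪hartleyBasis p, u⟫_ℝ = hartleyCoeff u p.1 p.2 := by
  rw [hartleyBasis, HilbertBasis.coe_mkOfOrthogonalEqBot, inner_componentField]
  rfl

theorem ext_hartleyCoeff {u v : L2} (h : ∀ k j, hartleyCoeff u k j = hartleyCoeff v k j) : u = v :=
  ext_coord hartleyBasis fun p => by rw [inner_hartleyBasis, inner_hartleyBasis, h]

theorem hasSum_hartleyCoeff_mul (u v : L2) :
    HasSum (fun p : (Fin 2 → ℤ) × Fin 2 => hartleyCoeff u p.1 p.2 * hartleyCoeff v p.1 p.2)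
      ⟪u, v⟫_ℝ := by
  simpa only [inner_hartleyBasis] using hasSum_coord_mul hartleyBasis u v

theorem hasSum_hartleyCoeff_sq (u : L2) :
    HasSum (fun p : (Fin 2 → ℤ) × Fin 2 => hartleyCoeff u p.1 p.2 ^ 2) (‖u‖ ^ 2) := by
  simpa only [inner_hartleyBasis] using hasSum_coord_sq hartleyBasis u

theorem exists_hartleyCoeff_eq {c : (Fin 2 → ℤ) → Fin 2 → ℝ}
    (hc : Summable fun p : (Fin 2 → ℤ) × Fin 2 => c p.1 p.2 ^ 2) :
    ∃ u : L2, ∀ k j, hartleyCoeff u k j = c k j := by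
  obtain ⟨u, hu⟩ := exists_coord_eq hartleyBasis (c := fun p => c p.1 p.2) hc
  exact ⟨u, fun k j => by rw [← inner_hartleyBasis (k, j), hu]⟩

theorem hartleyCoeff_add (u v : L2) (k : Fin 2 → ℤ) (j : Fin 2) :
    hartleyCoeff (u + v) k j = hartleyCoeff u k j + hartleyCoeff v k j := by
  simp only [← inner_hartleyBasis (k, j), inner_add_right]

theorem hartleyCoeff_neg (u : L2) (k : Fin 2 → ℤ) (j : Fin 2) :
    hartleyCoeff (-u) k j = -hartleyCoeff u k j := by
  simp only [← inner_hartleyBasis (k, j), inner_neg_right]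

theorem hartleyCoeff_smul (c : ℝ) (u : L2) (k : Fin 2 → ℤ) (j : Fin 2) :
    hartleyCoeff (c • u) k j = c * hartleyCoeff u k j := by
  simp only [← inner_hartleyBasis (k, j), inner_smul_right]

theorem hartleyCoeff_sum {ι : Type*} (F : Finset ι) (u : ι → L2) (k : Fin 2 → ℤ) (j : Fin 2) :
    hartleyCoeff (∑ i ∈ F, u i) k j = ∑ i ∈ F, hartleyCoeff (u i) k j := by
  simp only [← inner_hartleyBasis (k, j), inner_sum]

theorem hasSum_integral_mul_component (u : L2) (j : Fin 2) {φ : T2 → ℝ} (hφ : Continuous φ) :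
    HasSum (fun k => (∫ x, hartley k x * φ x ∂torusMeasure) * hartleyCoeff u k j)
      (∫ x, φ x * u x j ∂torusMeasure) := by
  have h := hasSum_hartleyCoeff_mul (componentField j φ hφ) u
  rw [inner_componentField] at h
  have hinj : Function.Injective fun k : Fin 2 → ℤ => (k, j) := fun k l hkl => by
    simpa using hkl
  rw [← hinj.hasSum_iff] at h
  · simpa only [Function.comp_def, hartleyCoeff_componentField, if_true] using h
  · rintro ⟨k, m⟩ hm
    have : m ≠ j := fun hmj => hm ⟨k, by rw [hmj]⟩
    simp [hartleyCoeff_componentField, this]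

/-- The reflection `k ↦ -k` of the frequency, through which differentiation permutes the Hartley
coefficients. -/
def reflectFreq : (Fin 2 → ℤ) × Fin 2 ≃ (Fin 2 → ℤ) × Fin 2 :=
  (Equiv.neg _).prodCongr (Equiv.refl _)

theorem isWeakPartial_iff (i : Fin 2) (u g : L2) :
    IsWeakPartial i u g
      ↔ ∀ k j, hartleyCoeff g k j = -(2 * Real.pi * k i * hartleyCoeff u (-k) j) := by
  constructor
  · intro h k j
    have htest := congrArg (fun v : R2 => v j) (h (hartley k) (isTest_hartley k))
    simp only [PiLp.neg_apply] at htest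
    rw [integral_smul_field_apply u (continuous_pderiv i (isTest_hartley k)),
      integral_smul_field_apply g (continuous_hartley k)] at htest
    simp only [pderiv_hartley, mul_assoc] at htest
    rw [integral_const_mul, integral_const_mul, integral_const_mul] at htest
    simp only [hartleyCoeff]
    linarith
  · intro h φ hφ
    ext j
    rw [PiLp.neg_apply, integral_smul_field_apply u (continuous_pderiv i hφ),
      integral_smul_field_apply g hφ.continuous]
    have hu := hasSum_integral_mul_component u j (continuous_pderiv i hφ)
    have hg := (hasSum_integral_mul_component g j hφ.continuous).neg
    rw [← (Equiv.neg (Fin 2 → ℤ)).hasSum_iff] at hg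
    refine hu.unique (hg.congr_fun fun k => ?_)
    simp only [Function.comp, Equiv.neg_apply, h, neg_neg]
    rw [integral_mul_pderiv hφ (isTest_hartley k)]
    simp only [pderiv_hartley, mul_assoc]
    rw [integral_const_mul, integral_const_mul, integral_const_mul]
    simp only [Pi.neg_apply, Int.cast_neg]
    ring

theorem exists_isWeakPartial_iff (i : Fin 2) (u : L2) : (∃ g, IsWeakPartial i u g) ↔
    Summable fun p : (Fin 2 → ℤ) × Fin 2 => (2 * Real.pi * p.1 i * hartleyCoeff u p.1 p.2) ^ 2 := by
  rw [← reflectFreq.summable_iff]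
  constructor
  · rintro ⟨g, hg⟩
    rw [isWeakPartial_iff] at hg
    refine (hasSum_hartleyCoeff_sq g).summable.congr fun p => ?_
    rw [hg]
    simp [reflectFreq]
  · intro h
    obtain ⟨g, hg⟩ := exists_hartleyCoeff_eq
      (c := fun k j => -(2 * Real.pi * k i * hartleyCoeff u (-k) j))
      (h.congr fun p => by simp [reflectFreq])
    exact ⟨g, (isWeakPartial_iff i u g).2 hg⟩

theorem hartleyCoeff_wpartial {i : Fin 2} {u : L2} (h : ∃ g, IsWeakPartial i u g) (k : Fin 2 → ℤ)
    (j : Fin 2) :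
    hartleyCoeff (wpartial i u) k j = -(2 * Real.pi * k i * hartleyCoeff u (-k) j) := by
  rw [wpartial, dif_pos h]
  exact (isWeakPartial_iff i u _).1 h.choose_spec k j

theorem wpartial_eq {i : Fin 2} {u g : L2} (h : IsWeakPartial i u g) : wpartial i u = g :=
  ext_hartleyCoeff fun k j => by rw [hartleyCoeff_wpartial ⟨g, h⟩, (isWeakPartial_iff i u g).1 h]

theorem hasSum_norm_wpartial_sq {i : Fin 2} {u : L2} (h : ∃ g, IsWeakPartial i u g) :
    HasSum (fun p : (Fin 2 → ℤ) × Fin 2 => (2 * Real.pi * p.1 i * hartleyCoeff u p.1 p.2) ^ 2)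
      (‖wpartial i u‖ ^ 2) := by
  rw [← reflectFreq.hasSum_iff]
  refine (hasSum_hartleyCoeff_sq (wpartial i u)).congr_fun fun p => ?_
  rw [hartleyCoeff_wpartial h]
  simp [reflectFreq]

end FourierL2
/-! ### The space `H` in Fourier variables -/

section SpaceH

theorem hartley_zero (x : T2) : hartley 0 x = 1 := by
  simp [hartley, UnitAddTorus.mFourier_zero]

theorem integral_eq_zero_iff (u : L2) :
    ∫ x, u x ∂torusMeasure = 0 ↔ ∀ j, hartleyCoeff u 0 j = 0 := by
  have hmean : ∀ j, hartleyCoeff u 0 j = (∫ x, u x ∂torusMeasure) j := fun j => by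
    rw [integral_apply ((Lp.memLp u).integrable (by norm_num))]
    simp only [hartleyCoeff, hartley_zero, one_mul]
  simp only [hmean]
  exact ⟨fun h j => by rw [h]; rfl, fun h => PiLp.ext h⟩

theorem integral_div_eq_sum (u : L2) {φ : T2 → ℝ} (hφ : IsTest φ) :
    ∫ x, ∑ i, pderiv i φ x * u x i ∂torusMeasure
      = ∑ i, ∫ x, pderiv i φ x * u x i ∂torusMeasure :=
  integral_finsetSum _ fun i _ => integrable_mul_component u i (continuous_pderiv i hφ)

theorem isDivFree_iff (u : L2) :
    IsDivFree u ↔ ∀ k, ∑ i, (k i : ℝ) * hartleyCoeff u k i = 0 := by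
  constructor
  · intro hdiv k
    have h := hdiv _ (isTest_hartley (-k))
    rw [integral_div_eq_sum u (isTest_hartley (-k))] at h
    simp only [pderiv_hartley, neg_neg, mul_assoc] at h
    simp only [integral_const_mul, ← Finset.mul_sum] at h
    simp only [Pi.neg_apply, Int.cast_neg, neg_mul, Finset.sum_neg_distrib, mul_neg,
      neg_eq_zero] at h
    simpa only [hartleyCoeff, mul_eq_zero, two_ne_zero, Real.pi_pos.ne', false_or] using h
  · intro hdiv φ hφ
    rw [integral_div_eq_sum u hφ]
    have h := hasSum_sum (s := Finset.univ) fun i _ =>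
      hasSum_integral_mul_component u i (continuous_pderiv i hφ)
    refine h.unique ?_
    convert hasSum_zero with k
    calc ∑ i, (∫ x, hartley k x * pderiv i φ x ∂torusMeasure) * hartleyCoeff u k i
        = ∑ i, -(2 * Real.pi * ∫ x, hartley (-k) x * φ x ∂torusMeasure)
            * (k i * hartleyCoeff u k i) := by
          refine Finset.sum_congr rfl fun i _ => ?_
          rw [integral_mul_pderiv hφ (isTest_hartley k)]
          simp only [pderiv_hartley, mul_assoc]
          rw [integral_const_mul, integral_const_mul, integral_const_mul]
          ring
      _ = 0 := by rw [← Finset.mul_sum, hdiv, mul_zero]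

theorem mem_H_iff (u : L2) : u ∈ H ↔
    (∀ j, hartleyCoeff u 0 j = 0) ∧ ∀ k, ∑ i, (k i : ℝ) * hartleyCoeff u k i = 0 :=
  and_congr (integral_eq_zero_iff u) (isDivFree_iff u)

theorem isClosed_H : IsClosed (H : Set L2) := by
  have hc : ∀ k j, Continuous fun u : L2 => hartleyCoeff u k j := fun k j => by
    simp only [← inner_hartleyBasis (k, j)]
    fun_prop
  have h : (H : Set L2)
      = (⋂ j, {u | hartleyCoeff u 0 j = 0})
        ∩ ⋂ k, {u | ∑ i, (k i : ℝ) * hartleyCoeff u k i = 0} := by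
    ext u
    simpa using mem_H_iff u
  rw [h]
  refine (isClosed_iInter fun j => isClosed_eq (hc 0 j) continuous_const).inter
    (isClosed_iInter fun k => isClosed_eq ?_ continuous_const)
  exact continuous_finsetSum _ fun i _ => continuous_const.mul (hc k i)

instance : CompleteSpace H := isClosed_H.completeSpace_coe

/-- The nonzero frequencies, which index the basis of `H`. -/
abbrev Freq : Type := {k : Fin 2 → ℤ // k ≠ 0}

/-- The eigenvalue `|2πk|²` of `-Δ` at the frequency `k`. -/
def eigenvalue (k : Fin 2 → ℤ) : ℝ := (2 * Real.pi) ^ 2 * ((k 0 : ℝ) ^ 2 + (k 1 : ℝ) ^ 2)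

theorem one_le_freq_sq {k : Fin 2 → ℤ} (hk : k ≠ 0) : (1 : ℝ) ≤ (k 0 : ℝ) ^ 2 + (k 1 : ℝ) ^ 2 := by
  have h : (1 : ℤ) ≤ k 0 ^ 2 + k 1 ^ 2 := by
    by_contra hlt
    have h0 : k 0 = 0 := by nlinarith [sq_nonneg (k 0), sq_nonneg (k 1), sq_nonneg (k 0 - 1)]
    have h1 : k 1 = 0 := by nlinarith [sq_nonneg (k 0), sq_nonneg (k 1)]
    refine hk (funext fun i => ?_)
    fin_cases i
    · exact h0
    · exact h1
  exact_mod_cast h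

theorem one_le_eigenvalue {k : Fin 2 → ℤ} (hk : k ≠ 0) : 1 ≤ eigenvalue k := by
  have h := one_le_freq_sq hk
  have hpi : (1 : ℝ) ≤ (2 * Real.pi) ^ 2 := by nlinarith [Real.pi_gt_three]
  unfold eigenvalue
  nlinarith

theorem eigenvalue_nonneg (k : Fin 2 → ℤ) : 0 ≤ eigenvalue k := by
  unfold eigenvalue
  positivity

theorem sum_sq_eq_eigenvalue (k : Fin 2 → ℤ) : ∑ i, (2 * Real.pi * k i) ^ 2 = eigenvalue k := by
  rw [Fin.sum_univ_two, eigenvalue]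
  ring

theorem sq_le_eigenvalue (k : Fin 2 → ℤ) (i : Fin 2) : (2 * Real.pi * k i) ^ 2 ≤ eigenvalue k :=
  sum_sq_eq_eigenvalue k ▸ Finset.single_le_sum (f := fun i => (2 * Real.pi * k i) ^ 2)
    (fun _ _ => sq_nonneg _) (Finset.mem_univ i)

theorem abs_le_eigenvalue (k : Fin 2 → ℤ) (i : Fin 2) : |(k i : ℝ)| ≤ eigenvalue k := by
  have hint : |(k i : ℝ)| ≤ (k i : ℝ) ^ 2 := by
    have h : |k i| ≤ k i ^ 2 := (Int.natCast_natAbs (k i)).symm.trans_le (Int.natAbs_le_self_sq _)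
    exact_mod_cast h
  have hpi : (1 : ℝ) ≤ (2 * Real.pi) ^ 2 := by nlinarith [Real.pi_gt_three]
  calc |(k i : ℝ)| ≤ (k i : ℝ) ^ 2 := hint
    _ ≤ (2 * Real.pi) ^ 2 * (k i : ℝ) ^ 2 := le_mul_of_one_le_left (sq_nonneg _) hpi
    _ = (2 * Real.pi * k i) ^ 2 := by ring
    _ ≤ eigenvalue k := sq_le_eigenvalue k i

theorem finite_setOf_eigenvalue_lt (r : ℝ) : {k : Fin 2 → ℤ | eigenvalue k < r}.Finite := by
  obtain ⟨n, hn⟩ := exists_nat_gt r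
  refine (Set.finite_Icc (fun _ => -(n : ℤ) : Fin 2 → ℤ) fun _ => (n : ℤ)).subset fun k hk => ?_
  have habs : ∀ i, |k i| ≤ (n : ℤ) := fun i => by
    have h : |(k i : ℝ)| ≤ n := (abs_le_eigenvalue k i).trans (lt_trans hk hn).le
    exact_mod_cast h
  exact ⟨fun i => (abs_le.1 (habs i)).1, fun i => (abs_le.1 (habs i)).2⟩

theorem exists_le_eigenvalue (r : ℝ) :
    ∃ F : Finset Freq, ∀ k ∉ F, r ≤ eigenvalue (k : Fin 2 → ℤ) := by
  have hfin : {k : Freq | eigenvalue (k : Fin 2 → ℤ) < r}.Finite :=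
    (finite_setOf_eigenvalue_lt r).preimage Subtype.val_injective.injOn
  refine ⟨hfin.toFinset, fun k hk => ?_⟩
  simpa using hk

/-- The unit vector orthogonal to the frequency `k`, the only direction (up to sign) of a
divergence-free mode of frequency `k`; it is `0` at `k = 0`. -/
def polarization (k : Fin 2 → ℤ) : Fin 2 → ℝ :=
  ![-(k 1 : ℝ) / √((k 0 : ℝ) ^ 2 + (k 1 : ℝ) ^ 2), (k 0 : ℝ) / √((k 0 : ℝ) ^ 2 + (k 1 : ℝ) ^ 2)]

theorem sum_polarization_sq {k : Fin 2 → ℤ} (hk : k ≠ 0) : ∑ j, polarization k j ^ 2 = 1 := by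
  have h := one_le_freq_sq hk
  simp only [Fin.sum_univ_two, polarization, Matrix.cons_val_zero, Matrix.cons_val_one, div_pow]
  rw [Real.sq_sqrt (by linarith)]
  field_simp
  ring

theorem abs_polarization_le {k : Fin 2 → ℤ} (hk : k ≠ 0) (j : Fin 2) : |polarization k j| ≤ 1 := by
  rw [← sq_le_one_iff_abs_le_one, ← sum_polarization_sq hk]
  exact Finset.single_le_sum (f := fun j => polarization k j ^ 2) (fun _ _ => sq_nonneg _)
    (Finset.mem_univ j)

theorem sum_mul_polarization (k : Fin 2 → ℤ) : ∑ i, (k i : ℝ) * polarization k i = 0 := by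
  simp only [Fin.sum_univ_two, polarization, Matrix.cons_val_zero, Matrix.cons_val_one]
  ring

theorem eq_mul_polarization {k : Fin 2 → ℤ} (hk : k ≠ 0) {c : Fin 2 → ℝ}
    (hc : ∑ i, (k i : ℝ) * c i = 0) (j : Fin 2) :
    c j = (∑ m, polarization k m * c m) * polarization k j := by
  have h := one_le_freq_sq hk
  rw [Fin.sum_univ_two] at hc
  have hs : √((k 0 : ℝ) ^ 2 + (k 1 : ℝ) ^ 2) ≠ 0 := (Real.sqrt_pos.2 (by linarith)).ne'
  have hs2 := Real.sq_sqrt (show (0 : ℝ) ≤ (k 0 : ℝ) ^ 2 + (k 1 : ℝ) ^ 2 by linarith)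
  rw [Fin.sum_univ_two]
  fin_cases j
  · simp only [Fin.zero_eta, polarization, Matrix.cons_val_zero, Matrix.cons_val_one]
    field_simp
    rw [hs2]
    linear_combination (k 0 : ℝ) * hc
  · simp only [Fin.mk_one, polarization, Matrix.cons_val_zero, Matrix.cons_val_one]
    field_simp
    rw [hs2]
    linear_combination (k 1 : ℝ) * hc

theorem hartleyCoeff_hartleyBasis (p : (Fin 2 → ℤ) × Fin 2) (l : Fin 2 → ℤ) (m : Fin 2) :
    hartleyCoeff (hartleyBasis p) l m = if l = p.1 ∧ m = p.2 then 1 else 0 := by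
  rw [← inner_hartleyBasis (l, m), inner_basis_basis]
  simp [Prod.ext_iff]

/-- The field `hartley k` in the direction `polarization k`: the divergence-free mode of
frequency `k`. -/
def stokesMode (k : Fin 2 → ℤ) : L2 := ∑ j, polarization k j • hartleyBasis (k, j)

theorem hartleyCoeff_stokesMode (k l : Fin 2 → ℤ) (j : Fin 2) :
    hartleyCoeff (stokesMode k) l j = if l = k then polarization k j else 0 := by
  simp only [stokesMode, hartleyCoeff_sum, hartleyCoeff_smul, hartleyCoeff_hartleyBasis]
  by_cases h : l = k <;> simp [h]

theorem stokesMode_mem {k : Fin 2 → ℤ} (hk : k ≠ 0) : stokesMode k ∈ H := by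
  rw [mem_H_iff]
  refine ⟨fun j => by rw [hartleyCoeff_stokesMode, if_neg hk.symm], fun l => ?_⟩
  simp only [hartleyCoeff_stokesMode]
  split_ifs with h
  · rw [h]
    exact sum_mul_polarization k
  · simp

theorem inner_stokesMode (k : Fin 2 → ℤ) (u : L2) :
    ⟪stokesMode k, u⟫_ℝ = ∑ j, polarization k j * hartleyCoeff u k j := by
  simp only [stokesMode, sum_inner, real_inner_smul_left, inner_hartleyBasis]

theorem orthonormal_stokesMode :
    Orthonormal ℝ fun k : Freq => (⟨stokesMode k, stokesMode_mem k.2⟩ : H) := by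
  classical
  rw [orthonormal_iff_ite]
  intro k l
  rw [Submodule.coe_inner]
  simp only [inner_stokesMode, hartleyCoeff_stokesMode]
  by_cases h : k = l
  · subst h
    simpa [sq] using sum_polarization_sq k.2
  · have h' : (k : Fin 2 → ℤ) ≠ l := fun hkl => h (Subtype.ext hkl)
    simp [h, h']

theorem hartleyCoeff_eq_inner_stokesMode (u : H) {k : Fin 2 → ℤ} (hk : k ≠ 0) (j : Fin 2) :
    hartleyCoeff u k j = ⟪stokesMode k, (u : L2)⟫_ℝ * polarization k j := by
  rw [inner_stokesMode]
  exact eq_mul_polarization hk (((mem_H_iff _).1 u.2).2 k) j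

theorem orthogonal_span_stokesMode : (Submodule.span ℝ (range
    fun k : Freq => (⟨stokesMode k, stokesMode_mem k.2⟩ : H)))ᗮ = ⊥ := by
  rw [Submodule.eq_bot_iff]
  intro u hu
  refine Subtype.ext (eq_zero_of_hartleyCoeff fun k j => ?_)
  by_cases hk : k = 0
  · rw [hk]
    exact ((mem_H_iff _).1 u.2).1 j
  · have := (Submodule.mem_orthogonal _ u).1 hu _ (Submodule.subset_span ⟨⟨k, hk⟩, rfl⟩)
    rw [Submodule.coe_inner] at this
    rw [hartleyCoeff_eq_inner_stokesMode u hk, this, zero_mul]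

/-- The basis of `H` of eigenfields of the Stokes operator. -/
def stokesBasis : HilbertBasis Freq ℝ H :=
  HilbertBasis.mkOfOrthogonalEqBot orthonormal_stokesMode orthogonal_span_stokesMode

theorem coe_stokesBasis (k : Freq) : (stokesBasis k : L2) = stokesMode k := by
  rw [stokesBasis, HilbertBasis.coe_mkOfOrthogonalEqBot]

theorem hartleyCoeff_eq (u : H) (k : Freq) (j : Fin 2) :
    hartleyCoeff u k j = ⟪stokesBasis k, u⟫_ℝ * polarization k j := by
  rw [hartleyCoeff_eq_inner_stokesMode u k.2, Submodule.coe_inner, coe_stokesBasis]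

theorem hartleyCoeff_zero (u : H) (j : Fin 2) : hartleyCoeff u 0 j = 0 := ((mem_H_iff _).1 u.2).1 j

end SpaceH

/-! ### Sobolev spaces in Fourier variables -/

theorem hasSum_prod_iff_hasSum_sum {α β : Type*} [Fintype β] {f : α × β → ℝ}
    (hf : ∀ p, 0 ≤ f p) {S : ℝ} : HasSum f S ↔ HasSum (fun a => ∑ b, f (a, b)) S := by
  have hfwd : ∀ {S}, HasSum f S → HasSum (fun a => ∑ b, f (a, b)) S := fun h =>
    h.prod_fiberwise fun a => hasSum_fintype _
  refine ⟨hfwd, fun h => ?_⟩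
  have hsum : Summable f := by
    rw [summable_prod_of_nonneg hf]
    refine ⟨fun a => (hasSum_fintype _).summable, ?_⟩
    simpa only [tsum_fintype] using h.summable
  rw [h.unique (hfwd hsum.hasSum)]
  exact hsum.hasSum

section SobolevSpaces

theorem sum_hartleyCoeff_sq (u : H) (k : Freq) :
    ∑ j, hartleyCoeff u k j ^ 2 = ⟪stokesBasis k, u⟫_ℝ ^ 2 := by
  simp only [hartleyCoeff_eq, mul_pow]
  rw [← Finset.mul_sum, sum_polarization_sq k.2, mul_one]

theorem hasSum_weight_iff {w : (Fin 2 → ℤ) → ℝ} (hw : ∀ k, 0 ≤ w k) (u : H) (S : ℝ) :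
    HasSum (fun p : (Fin 2 → ℤ) × Fin 2 => w p.1 * hartleyCoeff u p.1 p.2 ^ 2) S
      ↔ HasSum (fun k : Freq => w k * ⟪stokesBasis k, u⟫_ℝ ^ 2) S := by
  have hsupp : Function.support (fun k => ∑ j, w k * hartleyCoeff u k j ^ 2) ⊆ {k | k ≠ 0} := by
    rintro k hk rfl
    exact hk (by simp [hartleyCoeff_zero])
  rw [hasSum_prod_iff_hasSum_sum fun p => mul_nonneg (hw p.1) (sq_nonneg _),
    ← hasSum_subtype_iff_of_support_subset hsupp]
  simp only [Function.comp_def, ← Finset.mul_sum]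
  exact iff_of_eq (congrArg (HasSum · S) (funext fun k => congrArg _ (sum_hartleyCoeff_sq u k)))

theorem summable_weight_iff {w : (Fin 2 → ℤ) → ℝ} (hw : ∀ k, 0 ≤ w k) (u : H) :
    Summable (fun p : (Fin 2 → ℤ) × Fin 2 => w p.1 * hartleyCoeff u p.1 p.2 ^ 2)
      ↔ Summable fun k : Freq => w k * ⟪stokesBasis k, u⟫_ℝ ^ 2 :=
  exists_congr fun S => hasSum_weight_iff hw u S

theorem exists_isWeakPartial_iff_of_H (i : Fin 2) (u : H) : (∃ g, IsWeakPartial i u g) ↔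
    Summable fun k : Freq => (2 * Real.pi * k.1 i) ^ 2 * ⟪stokesBasis k, u⟫_ℝ ^ 2 := by
  rw [exists_isWeakPartial_iff,
    ← summable_weight_iff (w := fun k => (2 * Real.pi * k i) ^ 2) (fun k => sq_nonneg _)]
  simp only [mul_pow]

theorem mem_V_iff (u : H) :
    u ∈ V ↔ Summable fun k : Freq => eigenvalue k * ⟪stokesBasis k, u⟫_ℝ ^ 2 := by
  constructor
  · intro h
    have h' := summable_sum (s := Finset.univ) fun i _ =>
      (exists_isWeakPartial_iff_of_H i u).1 (h i)
    simpa only [← Finset.sum_mul, sum_sq_eq_eigenvalue] using h'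
  · intro h i
    refine (exists_isWeakPartial_iff_of_H i u).2 (Summable.of_nonneg_of_le
      (fun k => mul_nonneg (sq_nonneg _) (sq_nonneg _)) (fun k => ?_) h)
    exact mul_le_mul_of_nonneg_right (sq_le_eigenvalue _ i) (sq_nonneg _)

theorem hasSum_norm_wpartial_sq_of_H {u : H} (hu : u ∈ V) (i : Fin 2) :
    HasSum (fun k : Freq => (2 * Real.pi * k.1 i) ^ 2 * ⟪stokesBasis k, u⟫_ℝ ^ 2)
      (‖wpartial i u‖ ^ 2) := by
  rw [← hasSum_weight_iff (w := fun k => (2 * Real.pi * k i) ^ 2) (fun k => sq_nonneg _)]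
  simpa only [mul_pow] using hasSum_norm_wpartial_sq (hu i)

theorem hasSum_gradSq {u : H} (hu : u ∈ V) :
    HasSum (fun k : Freq => eigenvalue k * ⟪stokesBasis k, u⟫_ℝ ^ 2) (gradSq u) := by
  have h := hasSum_sum (s := Finset.univ) fun i _ => hasSum_norm_wpartial_sq_of_H hu i
  unfold gradSq
  simpa only [← Finset.sum_mul, sum_sq_eq_eigenvalue] using h

theorem hartleyCoeff_wpartial_wpartial {u : L2} {i j : Fin 2} (hi : ∃ g, IsWeakPartial i u g)
    (hj : ∃ g, IsWeakPartial j (wpartial i u) g) (k : Fin 2 → ℤ) (m : Fin 2) :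
    hartleyCoeff (wpartial j (wpartial i u)) k m
      = -(2 * Real.pi * k j * (2 * Real.pi * k i) * hartleyCoeff u k m) := by
  rw [hartleyCoeff_wpartial hj, hartleyCoeff_wpartial hi, neg_neg, Pi.neg_apply]
  push_cast
  ring

theorem exists_isWeakPartial_wpartial_iff {u : H} (hu : u ∈ V) (i j : Fin 2) :
    (∃ g, IsWeakPartial j (wpartial i u) g) ↔ Summable fun k : Freq =>
      (2 * Real.pi * k.1 j * (2 * Real.pi * k.1 i)) ^ 2 * ⟪stokesBasis k, u⟫_ℝ ^ 2 := by
  rw [exists_isWeakPartial_iff, ← reflectFreq.summable_iff, ← summable_weight_iff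
    (w := fun k => (2 * Real.pi * k j * (2 * Real.pi * k i)) ^ 2) (fun k => sq_nonneg _)]
  refine summable_congr fun p => ?_
  simp only [Function.comp_def, hartleyCoeff_wpartial (hu i)]
  simp only [reflectFreq, Equiv.prodCongr_apply, Equiv.neg_apply, Equiv.coe_refl, Prod.map_fst,
    Pi.neg_apply, Int.cast_neg, mul_neg, neg_neg, Prod.map_snd, id_eq, neg_mul, even_two,
    Even.neg_pow]
  ring

theorem hasSum_norm_wpartial_wpartial_sq {u : H} (hu : u ∈ DA) (i j : Fin 2) :
    HasSum (fun k : Freq => (2 * Real.pi * k.1 j * (2 * Real.pi * k.1 i)) ^ 2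
      * ⟪stokesBasis k, u⟫_ℝ ^ 2) (‖wpartial j (wpartial i u)‖ ^ 2) := by
  rw [← hasSum_weight_iff
    (w := fun k => (2 * Real.pi * k j * (2 * Real.pi * k i)) ^ 2) (fun k => sq_nonneg _)]
  refine (hasSum_hartleyCoeff_sq (wpartial j (wpartial i u))).congr_fun fun p => ?_
  rw [hartleyCoeff_wpartial_wpartial (hu.1 i) (hu.2 i j)]
  ring

theorem sq_mul_le_eigenvalue_sq (k : Fin 2 → ℤ) (i j : Fin 2) :
    (2 * Real.pi * k j * (2 * Real.pi * k i)) ^ 2 ≤ eigenvalue k ^ 2 := by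
  rw [mul_pow, sq (eigenvalue k)]
  exact mul_le_mul (sq_le_eigenvalue k j) (sq_le_eigenvalue k i) (sq_nonneg _) (eigenvalue_nonneg k)

/-- The eigenvalues of the Stokes operator in the basis `stokesBasis`. -/
def stokesEigenvalue (k : Freq) : ℝ := eigenvalue k

theorem mem_V_of_mem_diagDomain {u : H} (hu : u ∈ diagDomain stokesBasis stokesEigenvalue) :
    u ∈ V := by
  rw [mem_V_iff]
  refine Summable.of_nonneg_of_le (fun k => mul_nonneg (eigenvalue_nonneg _) (sq_nonneg _))
    (fun k => ?_) hu
  have h := one_le_eigenvalue k.2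
  rw [mul_pow, stokesEigenvalue]
  exact mul_le_mul_of_nonneg_right (by nlinarith) (sq_nonneg _)

theorem mem_DA_iff (u : H) : u ∈ DA ↔ u ∈ diagDomain stokesBasis stokesEigenvalue := by
  constructor
  · intro h
    have h' := summable_sum (s := Finset.univ) fun i _ =>
      summable_sum (s := Finset.univ) fun j _ =>
        (exists_isWeakPartial_wpartial_iff h.1 i j).1 (h.2 i j)
    refine h'.congr fun k => ?_
    simp only [mul_pow (2 * Real.pi * _) (2 * Real.pi * _), ← Finset.sum_mul, ← Finset.mul_sum,
      sum_sq_eq_eigenvalue, stokesEigenvalue]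
    ring
  · intro h
    have hV := mem_V_of_mem_diagDomain h
    refine ⟨hV, fun i j => (exists_isWeakPartial_wpartial_iff hV i j).2 (Summable.of_nonneg_of_le
      (fun k => mul_nonneg (sq_nonneg _) (sq_nonneg _)) (fun k => ?_) h)⟩
    rw [mul_pow (stokesEigenvalue k)]
    exact mul_le_mul_of_nonneg_right (sq_mul_le_eigenvalue_sq _ i j) (sq_nonneg _)

theorem hartleyCoeff_diagOp {u : H} (hu : u ∈ diagDomain stokesBasis stokesEigenvalue)
    (k : Fin 2 → ℤ) (j : Fin 2) :
    hartleyCoeff (diagOp stokesBasis stokesEigenvalue u : H) k j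
      = eigenvalue k * hartleyCoeff u k j := by
  by_cases hk : k = 0
  · subst hk
    simp [hartleyCoeff_zero]
  · rw [hartleyCoeff_eq _ ⟨k, hk⟩, hartleyCoeff_eq u ⟨k, hk⟩, coord_diagOp hu, stokesEigenvalue]
    ring

theorem stokesA_eq {u : H} (hu : u ∈ DA) :
    stokesA u = (diagOp stokesBasis stokesEigenvalue u : H) := by
  refine ext_hartleyCoeff fun k j => ?_
  rw [hartleyCoeff_diagOp ((mem_DA_iff u).1 hu), stokesA, hartleyCoeff_neg, hartleyCoeff_sum,
    ← sum_sq_eq_eigenvalue, Finset.sum_mul, ← Finset.sum_neg_distrib]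
  refine Finset.sum_congr rfl fun i _ => ?_
  rw [hartleyCoeff_wpartial_wpartial (hu.1 i) (hu.2 i i)]
  ring

theorem gradSq_eq {u : H} (hu : u ∈ diagDomain stokesBasis stokesEigenvalue) :
    gradSq u = energy stokesBasis stokesEigenvalue u :=
  (hasSum_gradSq (mem_V_of_mem_diagDomain hu)).unique (hasSum_energy hu)

theorem norm_wpartial_sq_le_gradSq (i : Fin 2) (u : L2) : ‖wpartial i u‖ ^ 2 ≤ gradSq u :=
  Finset.single_le_sum (f := fun i => ‖wpartial i u‖ ^ 2) (fun _ _ => sq_nonneg _)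
    (Finset.mem_univ i)

theorem norm_wpartial_wpartial_le {u : H} (hu : u ∈ diagDomain stokesBasis stokesEigenvalue)
    (i j : Fin 2) :
    ‖wpartial j (wpartial i u)‖ ≤ ‖diagOp stokesBasis stokesEigenvalue u‖ := by
  refine abs_le_of_sq_le_sq' ?_ (norm_nonneg _) |>.2
  refine hasSum_le (fun k => ?_) (hasSum_norm_wpartial_wpartial_sq ((mem_DA_iff u).2 hu) i j)
    (hasSum_norm_diagOp_sq hu)
  rw [mul_pow (stokesEigenvalue k)]
  exact mul_le_mul_of_nonneg_right (sq_mul_le_eigenvalue_sq _ i j) (sq_nonneg _)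

end SobolevSpaces
/-! ### Boundedness of the fields in `D(A)` -/

section SupBound

theorem norm_sq_le_eigenvalue (k : Fin 2 → ℤ) : ‖k‖ ^ 2 ≤ eigenvalue k := by
  have h : ∀ i, |(k i : ℝ)| ≤ √(eigenvalue k) := fun i => by
    refine Real.abs_le_sqrt (le_trans ?_ (sq_le_eigenvalue k i))
    rw [mul_pow]
    have hpi : (1 : ℝ) ≤ (2 * Real.pi) ^ 2 := by nlinarith [Real.pi_gt_three]
    exact le_mul_of_one_le_left (sq_nonneg _) hpi
  have hnorm : ‖k‖ ≤ √(eigenvalue k) :=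
    (pi_norm_le_iff_of_nonneg (Real.sqrt_nonneg _)).2 fun i => by
    simpa [Int.norm_eq_abs] using h i
  calc ‖k‖ ^ 2 ≤ √(eigenvalue k) ^ 2 := pow_le_pow_left₀ (norm_nonneg _) hnorm 2
    _ = eigenvalue k := Real.sq_sqrt (eigenvalue_nonneg k)

theorem summable_stokesEigenvalue_inv_sq :
    Summable fun k : Freq => ((stokesEigenvalue k)⁻¹) ^ 2 := by
  have h : Summable fun k : Fin 2 → ℤ => ‖k‖ ^ (-(4 : ℝ)) :=
    EisensteinSeries.summable_one_div_norm_rpow (by norm_num)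
  refine Summable.of_nonneg_of_le (fun k => sq_nonneg _) (fun k => ?_)
    (h.comp_injective Subtype.val_injective)
  have hk : 0 < ‖(k : Fin 2 → ℤ)‖ := norm_pos_iff.2 k.2
  have hpow : (‖(k : Fin 2 → ℤ)‖) ^ (-(4 : ℝ)) = ((‖(k : Fin 2 → ℤ)‖ ^ 2)⁻¹) ^ 2 := by
    rw [Real.rpow_neg hk.le, inv_pow, ← pow_mul]
    norm_cast
  simp only [Function.comp_apply]
  rw [hpow, stokesEigenvalue]
  exact pow_le_pow_left₀ (inv_nonneg.2 (eigenvalue_nonneg _))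
    (inv_anti₀ (by positivity) (norm_sq_le_eigenvalue _)) 2

theorem exists_sum_abs_coord_le : ∃ C, 0 ≤ C ∧ ∀ u ∈ diagDomain stokesBasis stokesEigenvalue,
    ∃ S, S ≤ C * ‖diagOp stokesBasis stokesEigenvalue u‖ ∧
      HasSum (fun k : Freq => |⟪stokesBasis k, u⟫_ℝ|) S := by
  obtain ⟨z, hz⟩ := exists_coord_eq stokesBasis summable_stokesEigenvalue_inv_sq
  refine ⟨‖z‖, norm_nonneg _, fun u hu => ?_⟩
  obtain ⟨w, hw⟩ := exists_coord_eq stokesBasis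
    (c := fun k => |stokesEigenvalue k * ⟪stokesBasis k, u⟫_ℝ|) (by
    simp only [sq_abs]
    exact hu)
  have hnorm : ‖w‖ ≤ 1 * ‖diagOp stokesBasis stokesEigenvalue u‖ :=
    norm_le_of_abs_coord_le stokesBasis zero_le_one fun k => by
      rw [hw, coord_diagOp hu, abs_abs, one_mul]
  refine ⟨⟪z, w⟫_ℝ, ?_, ?_⟩
  · refine (real_inner_le_norm _ _).trans ?_
    rw [one_mul] at hnorm
    gcongr
  · refine (hasSum_coord_mul stokesBasis z w).congr_fun fun k => ?_
    have hk : 0 < stokesEigenvalue k := zero_lt_one.trans_le (one_le_eigenvalue k.2)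
    rw [hz, hw, abs_mul, abs_of_pos hk, inv_mul_cancel_left₀ hk.ne']

theorem norm_mul_hartley_le (c : ℝ) (k : Fin 2 → ℤ) (x : T2) : ‖c * hartley k x‖ ≤ 2 * |c| := by
  rw [Real.norm_eq_abs, abs_mul, mul_comm]
  exact mul_le_mul_of_nonneg_right (abs_hartley_le k x) (abs_nonneg c)

section HartleySeries

variable {c : (Fin 2 → ℤ) → ℝ}

theorem continuous_tsum_hartley (hc : Summable fun k => |c k|) :
    Continuous fun x => ∑' k, c k * hartley k x :=
  continuous_tsum (fun k => continuous_const.mul (continuous_hartley k)) (hc.mul_left 2)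
    fun k => norm_mul_hartley_le (c k) k

theorem abs_tsum_hartley_le {S : ℝ} (hc : HasSum (fun k => |c k|) S) (x : T2) :
    |∑' k, c k * hartley k x| ≤ 2 * S :=
  tsum_of_norm_bounded (hc.mul_left 2) fun k => norm_mul_hartley_le (c k) k x

theorem integral_hartley_mul_tsum (hc : Summable fun k => |c k|) (l : Fin 2 → ℤ) :
    ∫ x, hartley l x * ∑' k, c k * hartley k x ∂torusMeasure = c l := by
  have hint : HasSum (fun k => ∫ x, hartley l x * (c k * hartley k x) ∂torusMeasure)
      (∫ x, hartley l x * ∑' k, c k * hartley k x ∂torusMeasure) := by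
    refine hasSum_integral_of_dominated_convergence (fun k _ => 2 * (2 * |c k|))
      (fun k => ((continuous_hartley l).mul
        (continuous_const.mul (continuous_hartley k))).aestronglyMeasurable)
      (fun k => .of_forall fun x => ?_) (.of_forall fun _ => (hc.mul_left 2).mul_left 2)
      (integrable_const _) (.of_forall fun x => ?_)
    · rw [norm_mul]
      exact mul_le_mul (abs_hartley_le l x) (norm_mul_hartley_le _ k x) (norm_nonneg _) zero_le_two
    · exact (Summable.of_norm_bounded (hc.mul_left 2)
        fun k => norm_mul_hartley_le (c k) k x).hasSum.mul_left _
  refine hint.unique ?_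
  convert hasSum_ite_eq l (c l) using 2 with k
  simp only [mul_left_comm (hartley l _), integral_const_mul, integral_hartley_mul_hartley]
  by_cases h : k = l
  · simp [h]
  · simp [h, Ne.symm h]

theorem ae_eq_tsum_hartley (hc : Summable fun k => |c k|) {g : T2 → ℝ}
    (hg : MemLp g 2 torusMeasure) (hgc : ∀ k, ∫ x, hartley k x * g x ∂torusMeasure = c k) :
    ∀ᵐ x ∂torusMeasure, g x = ∑' k, c k * hartley k x := by
  have hcont := continuous_tsum_hartley hc
  have hsum : MemLp (fun x => ∑' k, c k * hartley k x) 2 torusMeasure :=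
    .of_bound hcont.aestronglyMeasurable _ (.of_forall fun x => abs_tsum_hartley_le hc.hasSum x)
  have hdiff : (fun x => g x - ∑' k, c k * hartley k x) =ᵐ[torusMeasure] 0 := by
    refine ae_eq_zero_of_integral_hartley (hg.sub hsum) fun l => ?_
    simp only [mul_sub]
    rw [integral_sub, hgc, integral_hartley_mul_tsum hc, sub_self]
    · exact (hg.integrable one_le_two).bdd_mul (continuous_hartley l).aestronglyMeasurable
        (.of_forall (abs_hartley_le l))
    · exact integrable_of_continuous ((continuous_hartley l).mul hcont)
  filter_upwards [hdiff] with x hx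
  exact sub_eq_zero.1 hx

end HartleySeries

theorem ae_abs_le_of_hasSum {u : H} {S : ℝ}
    (h : HasSum (fun k : Freq => |⟪stokesBasis k, u⟫_ℝ|) S) (j : Fin 2) :
    ∀ᵐ x ∂torusMeasure, |(u : L2) x j| ≤ 2 * S := by
  have hle : ∀ k : Freq, |hartleyCoeff u k j| ≤ |⟪stokesBasis k, u⟫_ℝ| := fun k => by
    rw [hartleyCoeff_eq, abs_mul]
    exact mul_le_of_le_one_right (abs_nonneg _) (abs_polarization_le k.2 j)
  have hsupp : Function.support (fun k => |hartleyCoeff u k j|) ⊆ {k | k ≠ 0} := by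
    rintro k hk rfl
    exact hk (by simp [hartleyCoeff_zero])
  obtain ⟨R, hR⟩ : Summable fun k : Freq => |hartleyCoeff u k j| :=
    .of_nonneg_of_le (fun k => abs_nonneg _) hle h.summable
  have hRS : R ≤ S := hasSum_le hle hR h
  have hsum : HasSum (fun k => |hartleyCoeff u k j|) R :=
    (hasSum_subtype_iff_of_support_subset hsupp).1 hR
  filter_upwards [ae_eq_tsum_hartley hsum.summable (memLp_component u j) fun k => rfl] with x hx
  rw [hx]
  exact (abs_tsum_hartley_le hsum x).trans (by linarith)

theorem exists_ae_abs_le_mul_norm_diagOp :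
    ∃ C, 0 ≤ C ∧ ∀ u ∈ diagDomain stokesBasis stokesEigenvalue, ∀ j,
      ∀ᵐ x ∂torusMeasure, |(u : L2) x j| ≤ C * ‖diagOp stokesBasis stokesEigenvalue u‖ := by
  obtain ⟨C, hC, h⟩ := exists_sum_abs_coord_le
  refine ⟨2 * C, by positivity, fun u hu j => ?_⟩
  obtain ⟨S, hS, hsum⟩ := h u hu
  filter_upwards [ae_abs_le_of_hasSum hsum j] with x hx
  linarith

end SupBound

/-! ### The trilinear form -/

section Trilinear

theorem integral_norm_mul_norm_le (g w : L2) :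
    Integrable (fun x => ‖g x‖ * ‖w x‖) torusMeasure
      ∧ ∫ x, ‖g x‖ * ‖w x‖ ∂torusMeasure ≤ ‖g‖ * ‖w‖ := by
  have hg := (Lp.memLp g).norm
  have hw := (Lp.memLp w).norm
  refine ⟨hg.integrable_mul hw, ?_⟩
  have h := real_inner_le_norm (hw.toLp _) (hg.toLp _)
  rw [Lp.norm_toLp, Lp.norm_toLp, eLpNorm_norm, eLpNorm_norm, ← Lp.norm_def, ← Lp.norm_def,
    L2.inner_def, mul_comm] at h
  refine le_of_eq_of_le (integral_congr_ae ?_) h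
  filter_upwards [hg.coeFn_toLp, hw.coeFn_toLp] with x hgx hwx
  rw [hgx, hwx]
  simp

theorem integrable_and_abs_integral_le {F : T2 → ℝ} {g w : L2} {c : ℝ}
    (hFm : AEStronglyMeasurable F torusMeasure) (hc : 0 ≤ c)
    (hF : ∀ᵐ x ∂torusMeasure, |F x| ≤ c * (‖g x‖ * ‖w x‖)) :
    Integrable F torusMeasure ∧ |∫ x, F x ∂torusMeasure| ≤ c * (‖g‖ * ‖w‖) := by
  obtain ⟨hi, hle⟩ := integral_norm_mul_norm_le g w
  refine ⟨(hi.const_mul c).mono' hFm hF, ?_⟩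
  calc |∫ x, F x ∂torusMeasure| ≤ ∫ x, c * (‖g x‖ * ‖w x‖) ∂torusMeasure :=
        (Real.norm_eq_abs _).symm.trans_le (norm_integral_le_of_norm_le (hi.const_mul c) hF)
    _ ≤ c * (‖g‖ * ‖w‖) := by
        rw [integral_const_mul]
        gcongr

theorem aestronglyMeasurable_triple (u g w : L2) (i j : Fin 2) :
    AEStronglyMeasurable (fun x => u x i * g x j * w x j) torusMeasure :=
  ((memLp_component u i).1.mul (memLp_component g j).1).mul (memLp_component w j).1

theorem integrable_triple_and_abs_integral_le_left {u : L2} {c : ℝ} (hc : 0 ≤ c)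
    (hu : ∀ i, ∀ᵐ x ∂torusMeasure, |u x i| ≤ c) (g w : L2) (i j : Fin 2) :
    Integrable (fun x => u x i * g x j * w x j) torusMeasure
      ∧ |∫ x, u x i * g x j * w x j ∂torusMeasure| ≤ c * (‖g‖ * ‖w‖) := by
  refine integrable_and_abs_integral_le (aestronglyMeasurable_triple u g w i j) hc ?_
  filter_upwards [hu i] with x hx
  rw [abs_mul, abs_mul, mul_assoc]
  exact mul_le_mul hx (mul_le_mul (PiLp.norm_apply_le (g x) j) (PiLp.norm_apply_le (w x) j)
    (abs_nonneg _) (norm_nonneg _)) (by positivity) hc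

theorem integrable_triple_and_abs_integral_le_right {w : L2} {c : ℝ} (hc : 0 ≤ c)
    (hw : ∀ i, ∀ᵐ x ∂torusMeasure, |w x i| ≤ c) (u g : L2) (i j : Fin 2) :
    Integrable (fun x => u x i * g x j * w x j) torusMeasure
      ∧ |∫ x, u x i * g x j * w x j ∂torusMeasure| ≤ c * (‖u‖ * ‖g‖) := by
  refine integrable_and_abs_integral_le (aestronglyMeasurable_triple u g w i j) hc ?_
  filter_upwards [hw j] with x hx
  rw [abs_mul, abs_mul, mul_comm]
  exact mul_le_mul hx (mul_le_mul (PiLp.norm_apply_le (u x) i) (PiLp.norm_apply_le (g x) j)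
    (abs_nonneg _) (norm_nonneg _)) (by positivity) hc

theorem integrable_triple_and_abs_integral_le_middle {g : L2} {c : ℝ} (hc : 0 ≤ c)
    (hg : ∀ i, ∀ᵐ x ∂torusMeasure, |g x i| ≤ c) (u w : L2) (i j : Fin 2) :
    Integrable (fun x => u x i * g x j * w x j) torusMeasure
      ∧ |∫ x, u x i * g x j * w x j ∂torusMeasure| ≤ c * (‖u‖ * ‖w‖) := by
  refine integrable_and_abs_integral_le (aestronglyMeasurable_triple u g w i j) hc ?_
  filter_upwards [hg j] with x hx
  rw [abs_mul, abs_mul, mul_comm |u x i|, mul_assoc]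
  exact mul_le_mul hx (mul_le_mul (PiLp.norm_apply_le (u x) i) (PiLp.norm_apply_le (w x) j)
    (abs_nonneg _) (norm_nonneg _)) (by positivity) hc

theorem abs_bForm_le {u v w : L2} {r : ℝ}
    (h : ∀ i j, |∫ x, u x i * wpartial i v x j * w x j ∂torusMeasure| ≤ r) :
    |bForm u v w| ≤ 4 * r := by
  unfold bForm
  refine (Finset.abs_sum_le_sum_abs _ _).trans ?_
  calc ∑ i, |∑ j, ∫ x, u x i * wpartial i v x j * w x j ∂torusMeasure|
      ≤ ∑ _i : Fin 2, ∑ _j : Fin 2, r := Finset.sum_le_sum fun i _ =>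
        (Finset.abs_sum_le_sum_abs _ _).trans (Finset.sum_le_sum fun j _ => h i j)
    _ = 4 * r := by
        simp only [Fin.sum_univ_two]
        ring

theorem norm_wpartial_le_sqrt (i : Fin 2) (v : L2) : ‖wpartial i v‖ ≤ √(gradSq v) :=
  Real.le_sqrt_of_sq_le (norm_wpartial_sq_le_gradSq i v)

theorem ae_apply_add (u v : L2) : ∀ᵐ x ∂torusMeasure, ∀ j, (u + v) x j = u x j + v x j := by
  filter_upwards [Lp.coeFn_add u v] with x hx j
  rw [hx]
  rfl

theorem ae_apply_smul (c : ℝ) (u : L2) : ∀ᵐ x ∂torusMeasure, ∀ j, (c • u) x j = c * u x j := by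
  filter_upwards [Lp.coeFn_smul c u] with x hx j
  rw [hx]
  rfl

theorem wpartial_add {v w : H} (hv : v ∈ V) (hw : w ∈ V) (i : Fin 2) :
    wpartial i ((v + w : H) : L2) = wpartial i v + wpartial i w := by
  refine wpartial_eq ((isWeakPartial_iff i _ _).2 fun k j => ?_)
  rw [hartleyCoeff_add, hartleyCoeff_wpartial (hv i), hartleyCoeff_wpartial (hw i),
    Submodule.coe_add, hartleyCoeff_add]
  ring

theorem wpartial_smul (c : ℝ) {v : H} (hv : v ∈ V) (i : Fin 2) :
    wpartial i ((c • v : H) : L2) = c • wpartial i v := by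
  refine wpartial_eq ((isWeakPartial_iff i _ _).2 fun k j => ?_)
  rw [hartleyCoeff_smul, hartleyCoeff_wpartial (hv i), Submodule.coe_smul, hartleyCoeff_smul]
  ring

theorem exists_ae_abs_le {u : H} (hu : u ∈ diagDomain stokesBasis stokesEigenvalue) :
    ∃ c, 0 ≤ c ∧ ∀ i, ∀ᵐ x ∂torusMeasure, |(u : L2) x i| ≤ c := by
  obtain ⟨C, hC, h⟩ := exists_ae_abs_le_mul_norm_diagOp
  exact ⟨_, mul_nonneg hC (norm_nonneg _), h u hu⟩

theorem integrable_triple {u : H} (hu : u ∈ diagDomain stokesBasis stokesEigenvalue) (g w : L2)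
    (i j : Fin 2) :
    Integrable (fun x => (u : L2) x i * g x j * w x j) torusMeasure := by
  obtain ⟨c, hc, h⟩ := exists_ae_abs_le hu
  exact (integrable_triple_and_abs_integral_le_left hc h g w i j).1

theorem bForm_add_right {u : H} (hu : u ∈ diagDomain stokesBasis stokesEigenvalue) (v w z : L2) :
    bForm u v (w + z) = bForm u v w + bForm u v z := by
  simp only [bForm, ← Finset.sum_add_distrib]
  refine Finset.sum_congr rfl fun i _ => Finset.sum_congr rfl fun j _ => ?_
  rw [← integral_add (integrable_triple hu _ _ i j) (integrable_triple hu _ _ i j)]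
  refine integral_congr_ae ?_
  filter_upwards [ae_apply_add w z] with x hx
  rw [hx]
  ring

theorem bForm_smul_right (c : ℝ) (u v w : L2) : bForm u v (c • w) = c * bForm u v w := by
  simp only [bForm, Finset.mul_sum, ← integral_const_mul]
  refine Finset.sum_congr rfl fun i _ => Finset.sum_congr rfl fun j _ => integral_congr_ae ?_
  filter_upwards [ae_apply_smul c w] with x hx
  rw [hx]
  ring

theorem bForm_add_left {u v : H} (hu : u ∈ diagDomain stokesBasis stokesEigenvalue)
    (hv : v ∈ diagDomain stokesBasis stokesEigenvalue) (w z : L2) :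
    bForm ((u + v : H) : L2) w z = bForm u w z + bForm v w z := by
  simp only [bForm, ← Finset.sum_add_distrib]
  refine Finset.sum_congr rfl fun i _ => Finset.sum_congr rfl fun j _ => ?_
  rw [← integral_add (integrable_triple hu _ _ i j) (integrable_triple hv _ _ i j)]
  refine integral_congr_ae ?_
  filter_upwards [ae_apply_add (u : L2) v] with x hx
  rw [Submodule.coe_add, hx]
  ring

theorem bForm_add_middle {u v w : H} (hu : u ∈ diagDomain stokesBasis stokesEigenvalue)
    (hv : v ∈ V) (hw : w ∈ V) (z : L2) :
    bForm u ((v + w : H) : L2) z = bForm u v z + bForm u w z := by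
  simp only [bForm, ← Finset.sum_add_distrib]
  refine Finset.sum_congr rfl fun i _ => Finset.sum_congr rfl fun j _ => ?_
  rw [← integral_add (integrable_triple hu _ _ i j) (integrable_triple hu _ _ i j)]
  refine integral_congr_ae ?_
  filter_upwards [ae_apply_add (wpartial i v) (wpartial i w)] with x hx
  rw [wpartial_add hv hw, hx]
  ring

theorem bForm_smul_middle (c : ℝ) (u : L2) {v : H} (hv : v ∈ V) (z : L2) :
    bForm u ((c • v : H) : L2) z = c * bForm u v z := by
  simp only [bForm, Finset.mul_sum, ← integral_const_mul]
  refine Finset.sum_congr rfl fun i _ => Finset.sum_congr rfl fun j _ => integral_congr_ae ?_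
  filter_upwards [ae_apply_smul c (wpartial i v)] with x hx
  rw [wpartial_smul c hv, hx]
  ring

theorem abs_bForm_le_left {u : L2} {c : ℝ} (hc : 0 ≤ c)
    (hu : ∀ i, ∀ᵐ x ∂torusMeasure, |u x i| ≤ c) (v w : L2) :
    |bForm u v w| ≤ 4 * c * √(gradSq v) * ‖w‖ := by
  refine (abs_bForm_le (r := c * (√(gradSq v) * ‖w‖)) fun i j => ?_).trans_eq (by ring)
  refine (integrable_triple_and_abs_integral_le_left hc hu _ _ i j).2.trans ?_
  gcongr
  exact norm_wpartial_le_sqrt i v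

theorem abs_bForm_le_right {w : L2} {c : ℝ} (hc : 0 ≤ c)
    (hw : ∀ i, ∀ᵐ x ∂torusMeasure, |w x i| ≤ c) (u v : L2) :
    |bForm u v w| ≤ 4 * c * ‖u‖ * √(gradSq v) := by
  refine (abs_bForm_le (r := c * (‖u‖ * √(gradSq v))) fun i j => ?_).trans_eq (by ring)
  refine (integrable_triple_and_abs_integral_le_right hc hw _ _ i j).2.trans ?_
  gcongr
  exact norm_wpartial_le_sqrt i v

theorem inner_opB {u : H} (hu : u ∈ diagDomain stokesBasis stokesEigenvalue) (v w : H) :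
    ⟪opB u v, w⟫_ℝ = bForm u v w := by
  have hex : ∃ z : H, ∀ w : H, ⟪z, w⟫_ℝ = bForm u v w := by
    obtain ⟨c, hc, h⟩ := exists_ae_abs_le hu
    let L : H →ₗ[ℝ] ℝ :=
      { toFun := fun w => bForm u v w
        map_add' := fun w z => bForm_add_right hu v w z
        map_smul' := fun c w => bForm_smul_right c u v w }
    let Lc : H →L[ℝ] ℝ := L.mkContinuous (4 * c * √(gradSq v)) fun w =>
      abs_bForm_le_left hc h v w
    exact ⟨(InnerProductSpace.toDual ℝ H).symm Lc, fun w =>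
      InnerProductSpace.toDual_symm_apply⟩
  rw [opB, dif_pos hex]
  exact hex.choose_spec w

end Trilinear

/-! ### Fields with smooth representatives -/

section SmoothFields

/-- `U` is a smooth representative of the field `u ∈ L²`. It gives access to the classical calculus
behind the almost everywhere defined integrands of `bForm`. -/
structure IsSmoothRepr (u : L2) (U : Fin 2 → T2 → ℝ) : Prop where
  isTest : ∀ j, IsTest (U j)
  ae_eq : ∀ j, ∀ᵐ x ∂torusMeasure, u x j = U j x

theorem exists_ae_eq_of_continuous {G : Fin 2 → T2 → ℝ} (hG : ∀ j, Continuous (G j)) :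
    ∃ g : L2, ∀ j, ∀ᵐ x ∂torusMeasure, g x j = G j x := by
  let G' : C(T2, R2) :=
    ⟨fun x => WithLp.toLp 2 fun j => G j x, (PiLp.continuous_toLp 2 _).comp (continuous_pi hG)⟩
  refine ⟨ContinuousMap.toLp 2 torusMeasure ℝ G', fun j => ?_⟩
  filter_upwards [ContinuousMap.coeFn_toLp (p := 2) (𝕜 := ℝ) torusMeasure G'] with x hx
  rw [hx]
  rfl

theorem IsSmoothRepr.wpartial_ae_eq {u : L2} {U : Fin 2 → T2 → ℝ} (hu : IsSmoothRepr u U)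
    (i j : Fin 2) : ∀ᵐ x ∂torusMeasure, wpartial i u x j = pderiv i (U j) x := by
  obtain ⟨g, hg⟩ := exists_ae_eq_of_continuous fun j => continuous_pderiv i (hu.isTest j)
  have hweak : IsWeakPartial i u g := (isWeakPartial_iff i u g).2 fun k j => calc
    hartleyCoeff g k j = ∫ x, hartley k x * pderiv i (U j) x ∂torusMeasure :=
        integral_congr_ae <| (hg j).mono fun x hx => congrArg (hartley k x * ·) hx
    _ = -∫ x, pderiv i (hartley k) x * U j x ∂torusMeasure :=
        integral_mul_pderiv (hu.isTest j) (isTest_hartley k) i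
    _ = -∫ x, 2 * Real.pi * k i * (hartley (-k) x * u x j) ∂torusMeasure := by
        refine congrArg Neg.neg (integral_congr_ae <| (hu.ae_eq j).mono fun x hx => ?_)
        simp only [pderiv_hartley, hx, mul_assoc]
    _ = -(2 * Real.pi * k i * hartleyCoeff u (-k) j) := by
        rw [integral_const_mul, hartleyCoeff]
  rw [wpartial_eq hweak]
  exact hg j

theorem bForm_eq_integral {u v w : L2}
    (h : ∀ i j, Integrable (fun x => u x i * wpartial i v x j * w x j) torusMeasure) :
    bForm u v w = ∫ x, ∑ i, ∑ j, u x i * wpartial i v x j * w x j ∂torusMeasure := by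
  rw [integral_finsetSum _ fun i _ => integrable_finsetSum _ fun j _ => h i j]
  exact Finset.sum_congr rfl fun i _ => (integral_finsetSum _ fun j _ => h i j).symm

theorem integrable_triple_of_isSmoothRepr {v w : L2} {v' w' : Fin 2 → T2 → ℝ}
    (hv : IsSmoothRepr v v') (hw : IsSmoothRepr w w') (u : L2) (i j : Fin 2) :
    Integrable (fun x => u x i * wpartial i v x j * w x j) torusMeasure := by
  refine (integrable_mul_component u i ((continuous_pderiv i (hv.isTest j)).mul
    (hw.isTest j).continuous)).congr ?_
  filter_upwards [hv.wpartial_ae_eq i j, hw.ae_eq j] with x hvx hwx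
  rw [hvx, hwx, Pi.mul_apply]
  ring

theorem IsSmoothRepr.bForm_antisymm {v w : L2} {v' w' : Fin 2 → T2 → ℝ}
    (hv : IsSmoothRepr v v') (hw : IsSmoothRepr w w') {u : L2} (hu : IsDivFree u) :
    bForm u v w = -bForm u w v := by
  have hvw : IsTest fun x => ∑ j, v' j x * w' j x :=
    IsTest.sum _ fun j _ => (hv.isTest j).mul (hw.isTest j)
  have hiv := integrable_triple_of_isSmoothRepr hv hw u
  have hiw := integrable_triple_of_isSmoothRepr hw hv u
  rw [eq_neg_iff_add_eq_zero, ← hu _ hvw, bForm_eq_integral hiv, bForm_eq_integral hiw,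
    ← integral_add (integrable_finsetSum _ fun i _ => integrable_finsetSum _ fun j _ => hiv i j)
      (integrable_finsetSum _ fun i _ => integrable_finsetSum _ fun j _ => hiw i j)]
  refine integral_congr_ae ?_
  filter_upwards [ae_all_iff.2 hv.ae_eq, ae_all_iff.2 hw.ae_eq,
    ae_all_iff.2 fun i => ae_all_iff.2 (hv.wpartial_ae_eq i),
    ae_all_iff.2 fun i => ae_all_iff.2 (hw.wpartial_ae_eq i)] with x hvx hwx hdv hdw
  simp only [hvx, hwx, hdv, hdw, pderiv_sum _ fun j _ => (hv.isTest j).mul (hw.isTest j),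
    pderiv_mul (hv.isTest _) (hw.isTest _)]
  simp only [Fin.sum_univ_two]
  ring

theorem IsSmoothRepr.exists_abs_bForm_le {v : L2} {v' : Fin 2 → T2 → ℝ}
    (hv : IsSmoothRepr v v') : ∃ c, ∀ u w : L2, |bForm u v w| ≤ c * ‖u‖ * ‖w‖ := by
  have hcont : Continuous fun x => fun p : Fin 2 × Fin 2 => pderiv p.1 (v' p.2) x :=
    continuous_pi fun p => continuous_pderiv p.1 (hv.isTest p.2)
  obtain ⟨c, hc⟩ := (isCompact_range hcont).isBounded.exists_norm_le
  have hc0 : 0 ≤ c := (norm_nonneg _).trans (hc _ (mem_range_self 0))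
  refine ⟨4 * c, fun u w => ?_⟩
  refine (abs_bForm_le (r := c * (‖u‖ * ‖w‖)) fun i j => ?_).trans_eq (by ring)
  refine (integrable_triple_and_abs_integral_le_middle hc0 (fun m => ?_) u w i j).2
  filter_upwards [hv.wpartial_ae_eq i m] with x hx
  rw [hx]
  exact (norm_le_pi_norm (fun p : Fin 2 × Fin 2 => pderiv p.1 (v' p.2) x) (i, m)).trans
    (hc _ (mem_range_self x))

/-- Pointwise, `(u·∇)u · w = ½ ∇|u|² · w - ½ ∇(η²) · u` for the vorticity `η` of `u` and
`w = (∂₁η, -∂₀η)`, and both terms integrate to zero because `w` and `u` are divergence free. -/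
theorem IsSmoothRepr.bForm_self_eq_zero_of_vorticity {u w : L2} {U : Fin 2 → T2 → ℝ} {η : T2 → ℝ}
    (hU : IsSmoothRepr u U) (hu : IsDivFree u) (hw : IsDivFree w) (hη : IsTest η)
    (hcurl : ∀ x, η x = pderiv 0 (U 1) x - pderiv 1 (U 0) x)
    (hw₀ : ∀ᵐ x ∂torusMeasure, w x 0 = pderiv 1 η x)
    (hw₁ : ∀ᵐ x ∂torusMeasure, w x 1 = -pderiv 0 η x) : bForm u u w = 0 := by
  have hq : IsTest fun x => U 0 x * U 0 x + U 1 x * U 1 x :=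
    ((hU.isTest 0).mul (hU.isTest 0)).add ((hU.isTest 1).mul (hU.isTest 1))
  have hint : ∀ i j, Integrable (fun x => u x i * wpartial i u x j * w x j) torusMeasure := by
    intro i j
    refine (integrable_mul_component w j
      ((hU.isTest i).continuous.mul (continuous_pderiv i (hU.isTest j)))).congr ?_
    filter_upwards [hU.ae_eq i, hU.wpartial_ae_eq i j] with x hx hdx
    rw [hx, hdx, Pi.mul_apply]
  calc bForm u u w
      = ∫ x, ((1 / 2) * (∑ j, pderiv j (fun x => U 0 x * U 0 x + U 1 x * U 1 x) x * w x j)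
          - (1 / 2) * ∑ j, pderiv j (fun x => η x * η x) x * u x j) ∂torusMeasure := by
        rw [bForm_eq_integral hint]
        refine integral_congr_ae ?_
        filter_upwards [ae_all_iff.2 hU.ae_eq,
          ae_all_iff.2 fun i => ae_all_iff.2 (hU.wpartial_ae_eq i), hw₀, hw₁] with x hx hdx h₀ h₁
        simp only [Fin.sum_univ_two, hx, hdx, h₀, h₁, pderiv_mul hη hη,
          pderiv_add ((hU.isTest 0).mul (hU.isTest 0)) ((hU.isTest 1).mul (hU.isTest 1)),
          pderiv_mul (hU.isTest 0) (hU.isTest 0), pderiv_mul (hU.isTest 1) (hU.isTest 1)]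
        rw [hcurl]
        ring
    _ = 0 := by
        rw [integral_sub ((integrable_div w hq).const_mul _)
          ((integrable_div u (hη.mul hη)).const_mul _), integral_const_mul, integral_const_mul,
          hw _ hq, hu _ (hη.mul hη)]
        ring

end SmoothFields

section FiniteModes

theorem isTest_sum_hartley {ι : Type*} (F : Finset ι) (c : ι → ℝ) (κ : ι → Fin 2 → ℤ) :
    IsTest fun x => ∑ k ∈ F, c k * hartley (κ k) x :=
  IsTest.sum F fun k _ => (IsTest.const (c k)).mul (isTest_hartley (κ k))

theorem pderiv_sum_hartley {ι : Type*} (F : Finset ι) (c : ι → ℝ) (κ : ι → Fin 2 → ℤ) (i : Fin 2)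
    (x : T2) :
    pderiv i (fun x => ∑ k ∈ F, c k * hartley (κ k) x) x
      = ∑ k ∈ F, 2 * Real.pi * κ k i * c k * hartley (-κ k) x := by
  rw [pderiv_sum F fun k _ => (IsTest.const (c k)).mul (isTest_hartley (κ k))]
  refine Finset.sum_congr rfl fun k _ => ?_
  rw [pderiv_const_mul (isTest_hartley _), pderiv_hartley]
  ring

theorem isSmoothRepr_of_hartleyCoeff_eq_zero {u : L2} {F : Finset (Fin 2 → ℤ)}
    (h : ∀ k ∉ F, ∀ j, hartleyCoeff u k j = 0) :
    IsSmoothRepr u fun j x => ∑ k ∈ F, hartleyCoeff u k j * hartley k x where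
  isTest j := isTest_sum_hartley F _ fun k => k
  ae_eq j := by
    have hsum : Summable fun k => |hartleyCoeff u k j| :=
      summable_of_ne_finset_zero (s := F) fun k hk => by rw [h k hk, abs_zero]
    filter_upwards [ae_eq_tsum_hartley hsum (memLp_component u j) fun k => rfl] with x hx
    rw [hx]
    exact tsum_eq_sum fun k hk => by rw [h k hk, zero_mul]

theorem hartleyCoeff_eq_zero_of_coord_eq_zero {u : H} {F : Finset Freq}
    (h : ∀ k ∉ F, ⟪stokesBasis k, u⟫_ℝ = 0) :
    ∀ k ∉ F.map (.subtype _), ∀ j, hartleyCoeff u k j = 0 := by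
  intro k hk j
  rcases eq_or_ne k 0 with rfl | hk₀
  · exact hartleyCoeff_zero u j
  · have hkF : (⟨k, hk₀⟩ : Freq) ∉ F := fun hF => hk (Finset.mem_map_of_mem _ hF)
    rw [hartleyCoeff_eq u ⟨k, hk₀⟩, h _ hkF, zero_mul]

theorem exists_isSmoothRepr_stokesBasis (k : Freq) : ∃ U, IsSmoothRepr (stokesBasis k : H) U :=
  ⟨_, isSmoothRepr_of_hartleyCoeff_eq_zero <|
    hartleyCoeff_eq_zero_of_coord_eq_zero (F := {k}) fun l hl => by
      rw [inner_basis_basis, if_neg (by simpa using hl)]⟩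

theorem bForm_diagOp_eq_zero {u : H} (hu : u ∈ diagDomain stokesBasis stokesEigenvalue)
    {F : Finset (Fin 2 → ℤ)} (h : ∀ k ∉ F, ∀ j, hartleyCoeff u k j = 0) :
    bForm u u (diagOp stokesBasis stokesEigenvalue u : H) = 0 := by
  have hA := isSmoothRepr_of_hartleyCoeff_eq_zero (F := F)
    (u := (diagOp stokesBasis stokesEigenvalue u : H)) fun k hk j => by
      rw [hartleyCoeff_diagOp hu, h k hk, mul_zero]
  have hdiv : ∀ k : Fin 2 → ℤ, (k 0 : ℝ) * hartleyCoeff u k 0 + k 1 * hartleyCoeff u k 1 = 0 :=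
    fun k => by simpa using ((mem_H_iff _).1 u.2).2 k
  let vorticity (k : Fin 2 → ℤ) : ℝ :=
    2 * Real.pi * (k 0 * hartleyCoeff u k 1 - k 1 * hartleyCoeff u k 0)
  refine (isSmoothRepr_of_hartleyCoeff_eq_zero h).bForm_self_eq_zero_of_vorticity u.2.2
    (diagOp stokesBasis stokesEigenvalue u).2.2 (isTest_sum_hartley F vorticity fun k => -k)
    (fun x => ?_) ?_ ?_
  · rw [pderiv_sum_hartley _ _ fun k => k, pderiv_sum_hartley _ _ fun k => k,
      ← Finset.sum_sub_distrib]
    exact Finset.sum_congr rfl fun k _ => by ring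
  · filter_upwards [hA.ae_eq 0] with x hx
    rw [hx, pderiv_sum_hartley]
    refine Finset.sum_congr rfl fun k _ => ?_
    rw [hartleyCoeff_diagOp hu, eigenvalue, neg_neg, Pi.neg_apply]
    push_cast
    linear_combination (2 * Real.pi) ^ 2 * k 0 * hartley k x * hdiv k
  · filter_upwards [hA.ae_eq 1] with x hx
    rw [hx, pderiv_sum_hartley, ← Finset.sum_neg_distrib]
    refine Finset.sum_congr rfl fun k _ => ?_
    rw [hartleyCoeff_diagOp hu, eigenvalue, neg_neg, Pi.neg_apply]
    push_cast
    linear_combination (2 * Real.pi) ^ 2 * k 1 * hartley k x * hdiv k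

end FiniteModes

section Convection

theorem opB_sub_left {u v : H} (hu : u ∈ diagDomain stokesBasis stokesEigenvalue)
    (hv : v ∈ diagDomain stokesBasis stokesEigenvalue) (w : H) :
    opB (u - v) w = opB u w - opB v w := by
  rw [eq_sub_iff_add_eq]
  refine ext_inner_right ℝ fun z => ?_
  rw [inner_add_left, inner_opB (sub_mem hu hv), inner_opB hv, inner_opB hu,
    ← bForm_add_left (sub_mem hu hv) hv, sub_add_cancel]

theorem opB_add_right {u v w : H} (hu : u ∈ diagDomain stokesBasis stokesEigenvalue) (hv : v ∈ V)
    (hw : w ∈ V) : opB u (v + w) = opB u v + opB u w := by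
  refine ext_inner_right ℝ fun z => ?_
  rw [inner_add_left, inner_opB hu, inner_opB hu, inner_opB hu, bForm_add_middle hu hv hw]

theorem opB_smul_right {u v : H} (c : ℝ) (hu : u ∈ diagDomain stokesBasis stokesEigenvalue)
    (hv : v ∈ V) : opB u (c • v) = c • opB u v := by
  refine ext_inner_right ℝ fun z => ?_
  rw [inner_opB hu, bForm_smul_middle c _ hv, ← inner_opB hu]
  exact (real_inner_smul_left _ _ _).symm

theorem norm_opB_le {u : H} (hu : u ∈ diagDomain stokesBasis stokesEigenvalue) {c : ℝ}
    (hc : 0 ≤ c) (hbound : ∀ i, ∀ᵐ x ∂torusMeasure, |(u : L2) x i| ≤ c) (v : H) :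
    ‖opB u v‖ ≤ 4 * c * √(gradSq v) := by
  rcases (norm_nonneg (opB u v)).eq_or_lt with hzero | hpos
  · rw [← hzero]
    positivity
  · refine le_of_mul_le_mul_right ?_ hpos
    calc ‖opB u v‖ * ‖opB u v‖ = bForm u v (opB u v) := by
          rw [← inner_opB hu, real_inner_self_eq_norm_mul_norm]
      _ ≤ 4 * c * √(gradSq v) * ‖opB u v‖ :=
          (le_abs_self _).trans (abs_bForm_le_left hc hbound v (opB u v))

theorem exists_isConvection_opB : ∃ C, IsConvection stokesBasis stokesEigenvalue opB C := by
  obtain ⟨C, hC, hsup⟩ := exists_ae_abs_le_mul_norm_diagOp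
  refine ⟨4 * C, ⟨fun k => one_le_eigenvalue k.2, exists_le_eigenvalue, by positivity,
    fun hu hv _ => opB_sub_left hu hv _,
    fun hu hv hw => opB_add_right hu (mem_V_of_mem_diagDomain hv) (mem_V_of_mem_diagDomain hw),
    fun c hu hv => opB_smul_right c hu (mem_V_of_mem_diagDomain hv), fun {u v} hu hv => ?norm_le,
    fun {u v w} hu hv hw => ?abs_inner_le, fun {u} k l hu => ?inner_basis,
    fun h => ?inner_diagOp, fun k => ?basis_le⟩⟩
  case norm_le =>
    rw [mul_assoc 4 C, ← gradSq_eq hv]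
    exact norm_opB_le hu (by positivity) (hsup u hu) v
  case abs_inner_le =>
    rw [inner_opB hu, ← gradSq_eq hv]
    refine (abs_bForm_le_right (by positivity) (hsup w hw) u v).trans_eq ?_
    simp only [Submodule.coe_norm]
    ring
  case inner_basis =>
    obtain ⟨U, hU⟩ := exists_isSmoothRepr_stokesBasis k
    obtain ⟨W, hW⟩ := exists_isSmoothRepr_stokesBasis l
    rw [inner_opB hu, inner_opB hu, hU.bForm_antisymm hW u.2.2]
  case inner_diagOp =>
    have hu := mem_diagDomain_of_coord_eq_zero (lam := stokesEigenvalue) h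
    rw [inner_opB hu, bForm_diagOp_eq_zero hu (hartleyCoeff_eq_zero_of_coord_eq_zero h)]
  case basis_le =>
    obtain ⟨U, hU⟩ := exists_isSmoothRepr_stokesBasis k
    obtain ⟨c, hc⟩ := hU.exists_abs_bForm_le
    refine ⟨c, fun {u w} hu _ => ?_⟩
    rw [inner_opB hu]
    exact hc u w

end Convection

/-! ### Solutions of the constrained Navier–Stokes equations -/

section Solutions

theorem aestronglyMeasurable_wpartial {α : Type*} [MeasurableSpace α] {μ : Measure α} {g : α → L2}
    (hg : AEStronglyMeasurable g μ) {i : Fin 2} (h : ∀ᵐ t ∂μ, ∃ w, IsWeakPartial i (g t) w) :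
    AEStronglyMeasurable (fun t => wpartial i (g t)) μ := by
  refine aestronglyMeasurable_of_coord hartleyBasis fun p => ?_
  have hcoeff : AEStronglyMeasurable
      (fun t => -(2 * Real.pi * p.1 i * ⟪hartleyBasis (-p.1, p.2), g t⟫_ℝ)) μ :=
    ((aestronglyMeasurable_const.inner hg).const_mul _).neg
  refine hcoeff.congr ?_
  filter_upwards [h] with t ht
  rw [inner_hartleyBasis, inner_hartleyBasis, hartleyCoeff_wpartial ht]

theorem norm_wpartial_le {u : H} (hu : u ∈ diagDomain stokesBasis stokesEigenvalue) (i : Fin 2) :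
    ‖wpartial i u‖ ≤ ‖diagOp stokesBasis stokesEigenvalue u‖ := by
  refine abs_le_of_sq_le_sq' ?_ (norm_nonneg _) |>.2
  refine (norm_wpartial_sq_le_gradSq i u).trans ?_
  rw [gradSq_eq hu]
  exact energy_le_norm_sq (fun k => one_le_eigenvalue k.2) hu

theorem coe_constrainedRHS {u : H} (hu : u ∈ diagDomain stokesBasis stokesEigenvalue)
    (f : H → H) :
    ((constrainedRHS stokesBasis stokesEigenvalue opB f u : H) : L2) + stokesA u + (opB u u : L2)
      = gradSq u • (u : L2) + (f u : L2) := by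
  rw [stokesA_eq ((mem_DA_iff u).2 hu), gradSq_eq hu, constrainedRHS]
  push_cast
  abel

theorem coe_intervalIntegral {h : ℝ → H} {t : ℝ} (hh : IntervalIntegrable h volume 0 t) :
    ((∫ s in 0..t, h s : H) : L2) = ∫ s in 0..t, (h s : L2) :=
  (H.subtypeL.intervalIntegral_comp_comm hh).symm

variable {f : H → H} {T : ℝ} {u : ℝ → H}

theorem intervalIntegrable_of_memLp {h : ℝ → H} (hh : MemLp h 2 (timeMeasure T)) {t : ℝ}
    (ht : t ∈ Icc 0 T) : IntervalIntegrable h volume 0 t :=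
  (integrable_timeMeasure_iff ht.1).1 <|
    (hh.mono_measure (timeMeasure_mono ht.2)).integrable one_le_two

namespace IsStrongSolution

theorem memLp (hu : IsStrongSolution stokesBasis stokesEigenvalue opB f T u) (hT : 0 ≤ T)
    (p : ℝ≥0∞) : MemLp u p (timeMeasure T) := by
  have hcont := (hu.isPrimitiveOn hT).continuousOn
  obtain ⟨c, hc⟩ := isCompact_Icc.exists_bound_of_continuousOn hcont
  exact MemLp.of_bound (aestronglyMeasurable_of_continuousOn hcont) c (ae_timeMeasure_of_Icc hc)

theorem aestronglyMeasurable_coe (hu : IsStrongSolution stokesBasis stokesEigenvalue opB f T u)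
    (hT : 0 ≤ T) : AEStronglyMeasurable (fun t => (u t : L2)) (timeMeasure T) :=
  H.subtypeL.continuous.comp_aestronglyMeasurable (hu.memLp hT 2).1

theorem memLpDA (hu : IsStrongSolution stokesBasis stokesEigenvalue opB f T u) (hT : 0 ≤ T) :
    MemLpDA 2 T u := by
  have hDA : ∀ᵐ t ∂timeMeasure T, u t ∈ DA :=
    hu.mem_diagDomain.mono fun t => (mem_DA_iff _).2
  have hmeas (i) : AEStronglyMeasurable (fun t => wpartial i (u t)) (timeMeasure T) :=
    aestronglyMeasurable_wpartial (hu.aestronglyMeasurable_coe hT) (hDA.mono fun t ht => ht.1 i)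
  refine ⟨hDA, hu.memLp hT 2, fun i => ?_, fun i j => ?_⟩
  · exact hu.memLp_diagOp.mono (hmeas i)
      (hu.mem_diagDomain.mono fun t ht => norm_wpartial_le ht i)
  · exact hu.memLp_diagOp.mono
      (aestronglyMeasurable_wpartial (hmeas i) (hDA.mono fun t ht => ht.2 i j))
      (hu.mem_diagDomain.mono fun t ht => norm_wpartial_wpartial_le ht i j)

theorem memLpV (hu : IsStrongSolution stokesBasis stokesEigenvalue opB f T u) (hT : 0 ≤ T) {Y : ℝ}
    (hY : ∀ t ∈ Icc 0 T, ∀ S : Finset Freq,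
      ∑ k ∈ S, stokesEigenvalue k * ⟪stokesBasis k, u t⟫_ℝ ^ 2 ≤ Y) : MemLpV ⊤ T u := by
  have hV : ∀ᵐ t ∂timeMeasure T, u t ∈ V :=
    hu.mem_diagDomain.mono fun t => mem_V_of_mem_diagDomain
  refine ⟨hV, hu.memLp hT ⊤, fun i => ?_⟩
  refine MemLp.of_bound (aestronglyMeasurable_wpartial (hu.aestronglyMeasurable_coe hT)
    (hV.mono fun t ht => ht i)) (√Y) ?_
  filter_upwards [hV, ae_timeMeasure_of_Icc hY] with t ht hYt
  exact (norm_wpartial_le_sqrt i _).trans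
    (Real.sqrt_le_sqrt (hasSum_le_of_sum_le (hasSum_gradSq ht) hYt))

theorem isSolutionOn (hu : IsStrongSolution stokesBasis stokesEigenvalue opB f T u) (hT : 0 ≤ T) :
    IsSolutionOn f (u 0) T u := by
  refine ⟨rfl, hu.memLpDA hT, fun t => constrainedRHS stokesBasis stokesEigenvalue opB f (u t),
    ⟨hu.memLp_constrainedRHS, fun t ht => ?_⟩,
    hu.mem_diagDomain.mono fun _ ht => coe_constrainedRHS ht f⟩
  rw [← coe_intervalIntegral (intervalIntegrable_of_memLp hu.memLp_constrainedRHS ht),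
    ← Submodule.coe_add, ← hu.eq_add_integral t ht]

end IsStrongSolution

theorem MemLpDA.mem_diagDomain {p : ℝ≥0∞} (hu : MemLpDA p T u) :
    ∀ᵐ t ∂timeMeasure T, u t ∈ diagDomain stokesBasis stokesEigenvalue :=
  hu.1.mono fun _ => (mem_DA_iff _).1

theorem MemLpDA.memLp_diagOp {p : ℝ≥0∞} (hu : MemLpDA p T u) :
    MemLp (fun t => diagOp stokesBasis stokesEigenvalue (u t)) p (timeMeasure T) := by
  have hA : MemLp (fun t => stokesA (u t)) p (timeMeasure T) :=
    (memLp_finsetSum _ fun i _ => hu.2.2.2 i i).neg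
  refine hA.mono (aestronglyMeasurable_diagOp hu.2.1.1 hu.mem_diagDomain) (hu.1.mono fun t ht => ?_)
  rw [stokesA_eq ht, Submodule.coe_norm]

theorem intervalIntegral_congr_timeMeasure {g h : ℝ → H} (hgh : g =ᵐ[timeMeasure T] h) {t : ℝ}
    (ht : t ∈ Icc 0 T) : ∫ s in 0..t, g s = ∫ s in 0..t, h s := by
  rw [← integral_timeMeasure ht.1, ← integral_timeMeasure ht.1]
  exact integral_congr_ae (ae_mono (timeMeasure_mono ht.2) hgh)

theorem IsSolutionOn.isStrongSolution {u₀ : H} (hu : IsSolutionOn f u₀ T u) :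
    IsStrongSolution stokesBasis stokesEigenvalue opB f T u := by
  obtain ⟨-, hDA, u', ⟨hu', hprim⟩, heq⟩ := hu
  have hrhs : u' =ᵐ[timeMeasure T]
      fun t => constrainedRHS stokesBasis stokesEigenvalue opB f (u t) := by
    filter_upwards [hDA.mem_diagDomain, heq] with t hdom ht
    have hcoe := coe_constrainedRHS hdom f
    rw [← ht, add_assoc, add_assoc] at hcoe
    exact Subtype.ext (add_right_cancel hcoe).symm
  refine ⟨hDA.mem_diagDomain, hDA.memLp_diagOp, (memLp_congr_ae hrhs).1 hu', fun t ht => ?_⟩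
  rw [← intervalIntegral_congr_timeMeasure hrhs ht]
  refine Subtype.ext ?_
  rw [Submodule.coe_add, coe_intervalIntegral (intervalIntegrable_of_memLp hu' ht)]
  exact hprim t ht

end Solutions

end CNS

end

theorem mainTheorem1 (f : CNS.H → CNS.H) (K : ℝ≥0) (hf : LipschitzWith K f)
    (hfM : ∀ u ∈ CNS.M, f u ∈ CNS.tangentM u)
    (u₀ : CNS.H) (hu₀V : u₀ ∈ CNS.V) (hu₀M : u₀ ∈ CNS.M) :
    ∃ u : ℝ → CNS.H,
      (∀ T : ℝ, 0 < T →
        CNS.IsSolutionOn f u₀ T u ∧ CNS.MemLpV ∞ T u ∧ CNS.MemLpDA 2 T u) ∧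
      ∀ T : ℝ, 0 < T → ∀ v : ℝ → CNS.H, CNS.IsSolutionOn f u₀ T v → EqOn v u (Icc 0 T) := by
  obtain ⟨C, hB⟩ := CNS.exists_isConvection_opB
  obtain ⟨u, hu0, hu⟩ := hB.exists_global_isStrongSolution hf hfM hu₀M
    ((CNS.mem_V_iff u₀).1 hu₀V)
  refine ⟨u, fun T hT => ?_, fun T hT v hv => ?_⟩
  · obtain ⟨hsol, Y, hY⟩ := hu T hT.le
    exact ⟨hu0 ▸ hsol.isSolutionOn hT.le, hsol.memLpV hT.le hY, hsol.memLpDA hT.le⟩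
  · exact hv.isStrongSolution.eqOn hB hf hT.le (hu T hT.le).1 (hv.1.trans hu0.symm)
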